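/- Let $1\le n$ and let $F(x,\dot x)=0$ be an implicit control system with $n$ states, $m=1$ control and $n-1$ equations, where $F$ is an $\mathbb R^{n-1}$-valued map that is real analytic on an open set $D$ of pairs $(x,\dot x)\in\mathbb R^n\times\mathbb R^n$ and satisfies $\operatorname{rank}\frac{\partial F}{\partial\dot x}=n-1$ on $D$. On the jet space $\mathfrak X$ with coordinates $\bar x=(x,\dot x,\ddot x,\dots)$ (product topology; analytic functions depend on finitely many coordinates) let $\frac{d}{dt}=\sum_{i,j}x_i^{(j+1)}\frac{\partial}{\partial x_i^{(j)}}$ and $\mathfrak X_0=\{\bar x: (x,\dot x)\in D,\ \frac{d^k}{dt^k}F(\bar x)=0\ \ \forall k\ge 0\}$. Fix $\bar x_0\in\mathfrak X_0$. Consider matrices of polynomials in $\frac{d}{dt}$ (with $\frac{d}{dt}a=a\frac{d}{dt}+\dot a$) whose coefficients are analytic functions near $\bar x_0$, identities between them being required on a neighborhood of $\bar x_0$ in $\mathfrak X_0$; such a square matrix is unimodular if it has an inverse of the same kind. Assume that $P(F)=\frac{\partial F}{\partial x}+\frac{\partial F}{\partial\dot x}\frac{d}{dt}$ is hyper-regular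 near $\bar x_0$, i.e. $V\,P(F)\,U=(I_{n-1},0)$ for some unimodular $V,U$. For any such $U$ let $\hat U$ be its last column, let $Q$ be a unimodular $n\times n$ matrix with $Q\hat U W=(1,0,\dots,0)^T$ for some unimodular $1\times 1$ matrix $W$, and let $\omega_1=\sum_{j,k}Q_{1,j}^k\,dx_j^{(k)}$, where $Q_{1,j}=\sum_kQ_{1,j}^k\frac{d^k}{dt^k}$, restricted to $\mathfrak X_0$; let $\Omega$ be the ideal generated by $\omega_1$. Call $\Omega$ closed in the ordinary sense if, in a neighborhood of $\bar x_0$ in $\mathfrak X_0$, $d\omega_1=\tau\wedge\omega_1$ for some analytic 1-form $\tau$ (a finite combination of the $dx_j^{(k)}$). The system is flat at $\bar x_0$ if, for some $\bar y_0$ in the jet space $\mathbb R^1_\infty$ of one free variable $y$, there are mutually inverse analytic maps between a neighborhood of $\bar x_0$ in $\mathfrak X_0$ and a neighborhood of $\bar y_0$ in $\mathbb R^1_\infty$ that exchange $\bar x_0$ and $\bar y_0$ and the fields $\frac{d}{dt}$. It is static feedback linearizable at $\bar x_0$ if it has near $(x_0,\dot x_0)$ an analytic explicit form $\dot x=f(x,u)$,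 with $u\in\mathbb R$, $F(x,f(x,u))=0$, $f(x_0,u_0)=\dot x_0$, $\frac{\partial f}{\partial u}(x_0,u_0)\ne0$, that is transformed into a controllable linear system $\dot z=Az+Bv$ by an analytic local diffeomorphism $z=\zeta(x)$ at $x_0$ and an analytic feedback $u=\alpha(x,v)$ near some $(x_0,v_0)$ with $\alpha(x_0,v_0)=u_0$, $\frac{\partial\alpha}{\partial v}(x_0,v_0)\neq0$. Then: 1. the system is flat at $\bar x_0$ if and only if $\Omega$ is closed in the ordinary sense for some such choice of $U$ and $Q$; 2. for every such choice of $U$ and $Q$, the system is flat at $\bar x_0$ if and only if $\Omega$ is closed in the ordinary sense; 3. the system is flat at $\bar x_0$ if and only if it is static feedback linearizable at $\bar x_0$. -/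

import Mathlib

open Set Filter Topology

noncomputable section

namespace Flatness

/-! ## Jets of infinite order -/

/-- The jet space `ℝⁿ × ℝⁿ × ⋯`; `x k i` is the coordinate `xᵢ⁽ᵏ⁾`. It carries the product
topology. -/
abbrev Jet (n : ℕ) := ℕ → Fin n → ℝ

/-- The jet of order `< r` of `x`. -/
def trunc {n : ℕ} (r : ℕ) (x : Jet n) : Fin r → Fin n → ℝ := fun k => x k

/-- `f` is an analytic function on `N ⊆ Jet n`: it depends on finitely many of the variables
`xᵢ⁽ᵏ⁾` only, and analytically on them. -/
def JetAnalyticOn {n : ℕ} (N : Set (Jet n)) (f : Jet n → ℝ) : Prop :=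
  ∃ (r : ℕ) (g : (Fin r → Fin n → ℝ) → ℝ),
    AnalyticOnNhd ℝ g (trunc r '' N) ∧ ∀ x ∈ N, f x = g (trunc r x)

/-- The value at `x` of the trivial Cartan field `∑ xᵢ⁽ʲ⁺¹⁾ ∂/∂xᵢ⁽ʲ⁾`. -/
def cartanField {n : ℕ} (x : Jet n) : Jet n := fun k => x (k + 1)

/-- `d/dt`: the Lie derivative of a function along the trivial Cartan field. -/
def ddt {n : ℕ} (f : Jet n → ℝ) : Jet n → ℝ := fun x => lineDeriv ℝ f x (cartanField x)

theorem ddt_zero {n : ℕ} : ddt (0 : Jet n → ℝ) = 0 := by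
  funext x
  simp [ddt, lineDeriv]

/-! ## Implicit control systems -/

/-- A regular implicit control system `F(x, ẋ) = 0` with `n` states, `m` controls and `n - m`
equations. The field `dom` is an open set of pairs `(x, ẋ)` on which `F` is analytic and regular. -/
structure ImplicitSystem (n m : ℕ) where
  le : m ≤ n
  dom : Set ((Fin n → ℝ) × (Fin n → ℝ))
  isOpen_dom : IsOpen dom
  F : (Fin n → ℝ) × (Fin n → ℝ) → Fin (n - m) → ℝ
  analytic : AnalyticOnNhd ℝ F dom
  regular : ∀ z ∈ dom,
    (Matrix.of fun (i : Fin (n - m)) (j : Fin n) =>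
      fderiv ℝ F z (0, Pi.single j 1) i).rank = n - m

/-- The trivial system of dimension `m`: no equation on `ℝᵐ`. -/
def trivialSystem (m : ℕ) : ImplicitSystem m m where
  le := le_rfl
  dom := univ
  isOpen_dom := isOpen_univ
  F := 0
  analytic := fun _ _ => analyticAt_const
  regular := by
    intro z _
    apply Nat.le_antisymm
    · simpa using Matrix.rank_le_card_height
        (Matrix.of fun (i : Fin (m - m)) (j : Fin m) =>
          fderiv ℝ (0 : (Fin m → ℝ) × (Fin m → ℝ) → Fin (m - m) → ℝ) z (0, Pi.single j 1) i)
    · simp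

namespace ImplicitSystem

variable {n m : ℕ} (S : ImplicitSystem n m)

/-- `Fᵢ` as a function on jets. -/
def jetF (i : Fin (n - m)) : Jet n → ℝ := fun x => S.F (x 0, x 1) i

/-- `𝔛₀`: the jets that satisfy `(d/dt)ᵏ F = 0` for all `k ≥ 0`. -/
def prolonged : Set (Jet n) :=
  {x | (x 0, x 1) ∈ S.dom ∧ ∀ (k : ℕ) (i : Fin (n - m)), (ddt^[k] (S.jetF i)) x = 0}

/-- `v` is tangent to `𝔛₀` at `x`: it is annihilated by all the `d((d/dt)ᵏ Fᵢ)`. -/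
def IsTangent (x v : Jet n) : Prop :=
  ∀ (k : ℕ) (i : Fin (n - m)), lineDeriv ℝ (ddt^[k] (S.jetF i)) x v = 0

end ImplicitSystem

/-! ## Lie-Bäcklund equivalence and flatness -/

/-- All components of `Φ` are analytic on `N`. -/
def JetMapAnalyticOn {n n' : ℕ} (N : Set (Jet n)) (Φ : Jet n → Jet n') : Prop :=
  ∀ (k : ℕ) (i : Fin n'), JetAnalyticOn N (fun x => Φ x k i)

/-- `Φ` relates the trivial Cartan fields at the points of `E`: the derivative of each component
of `Φ` along the Cartan field at `x` is the corresponding component of the Cartan field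
at `Φ x`. -/
def CartanRelatedOn {n n' : ℕ} (E : Set (Jet n)) (Φ : Jet n → Jet n') : Prop :=
  ∀ x ∈ E, ∀ (k : ℕ) (i : Fin n'), ddt (fun z => Φ z k i) x = cartanField (Φ x) k i

/-- Lie-Bäcklund equivalence at `(x₀, y₀)`: there are mutually inverse analytic maps between
neighborhoods of `x₀` in `𝔛₀` and of `y₀` in `𝔜₀` that exchange `x₀` and `y₀` and the Cartan
fields. Analytic maps on `𝔛₀` are restrictions of analytic maps on the jet space. -/
def LieBacklundEquivAt {n m n' m' : ℕ} (S : ImplicitSystem n m) (T : ImplicitSystem n' m')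
    (x₀ : Jet n) (y₀ : Jet n') : Prop :=
  x₀ ∈ S.prolonged ∧ y₀ ∈ T.prolonged ∧
  ∃ (NX : Set (Jet n)) (NY : Set (Jet n')) (Φ : Jet n' → Jet n) (Ψ : Jet n → Jet n'),
    IsOpen NX ∧ x₀ ∈ NX ∧ IsOpen NY ∧ y₀ ∈ NY ∧
    JetMapAnalyticOn NY Φ ∧ JetMapAnalyticOn NX Ψ ∧
    MapsTo Φ (NY ∩ T.prolonged) (NX ∩ S.prolonged) ∧
    MapsTo Ψ (NX ∩ S.prolonged) (NY ∩ T.prolonged) ∧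
    InvOn Ψ Φ (NY ∩ T.prolonged) (NX ∩ S.prolonged) ∧
    Φ y₀ = x₀ ∧ Ψ x₀ = y₀ ∧
    CartanRelatedOn (NY ∩ T.prolonged) Φ ∧ CartanRelatedOn (NX ∩ S.prolonged) Ψ

/-- Flatness at `(x₀, y₀)`: Lie-Bäcklund equivalence with the `m`-dimensional trivial system. -/
def ImplicitSystem.FlatAt {n m : ℕ} (S : ImplicitSystem n m) (x₀ : Jet n) (y₀ : Jet m) : Prop :=
  LieBacklundEquivAt S (trivialSystem m) x₀ y₀

/-! ## Polynomial matrices in `d/dt` -/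

/-- A polynomial `∑ aₖ (d/dt)ᵏ` in the indeterminate `d/dt` whose coefficients are functions on
the jet space. -/
abbrev DiffOp (n : ℕ) := ℕ →₀ (Jet n → ℝ)

/-- Left multiplication by `d/dt`, by the rule `(d/dt) a = a (d/dt) + ȧ`. -/
def DiffOp.ddtMul {n : ℕ} (q : DiffOp n) : DiffOp n :=
  q.mapRange ddt ddt_zero + q.mapDomain (fun k => k + 1)

/-- The (non commutative) product of polynomials in `d/dt`. -/
def DiffOp.mul {n : ℕ} (p q : DiffOp n) : DiffOp n :=
  p.sum fun k a => a • DiffOp.ddtMul^[k] q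

/-- Matrices of polynomials in `d/dt`. -/
abbrev OpMatrix (n p q : ℕ) := Fin p → Fin q → DiffOp n

namespace OpMatrix

variable {n p q r : ℕ}

def mul (A : OpMatrix n p q) (B : OpMatrix n q r) : OpMatrix n p r :=
  fun i j => ∑ k, DiffOp.mul (A i k) (B k j)

/-- The `p × q` matrix with ones on the main diagonal and zeros elsewhere: `I`, `(I, 0)`
or `(I, 0)ᵀ` according to the sizes. -/
def rectOne (n p q : ℕ) : OpMatrix n p q :=
  fun i j => if (i : ℕ) = (j : ℕ) then Finsupp.single 0 1 else 0

/-- All coefficients of all entries are analytic on `N`. -/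
def AnalyticOn (N : Set (Jet n)) (A : OpMatrix n p q) : Prop :=
  ∀ i j k, JetAnalyticOn N (A i j k)

/-- The coefficients of `A` and `B` agree at the points of `E`. -/
def EqOn (E : Set (Jet n)) (A B : OpMatrix n p q) : Prop :=
  ∀ i j k, Set.EqOn (A i j k) (B i j k) E

end OpMatrix

namespace ImplicitSystem

variable {n m : ℕ} (S : ImplicitSystem n m)

/-- Unimodular matrices over the polynomials in `d/dt` with coefficients analytic on the
neighborhood `N ∩ 𝔛₀`: the inverse is such a matrix as well. -/
def Unimodular (N : Set (Jet n)) {p : ℕ} (A : OpMatrix n p p) : Prop :=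
  A.AnalyticOn N ∧ ∃ B : OpMatrix n p p, B.AnalyticOn N ∧
    (A.mul B).EqOn (N ∩ S.prolonged) (OpMatrix.rectOne n p p) ∧
    (B.mul A).EqOn (N ∩ S.prolonged) (OpMatrix.rectOne n p p)

/-- `V M U` is the rectangular identity on `N ∩ 𝔛₀`, with `V` and `U` unimodular there. -/
def IsSmithReduction (N : Set (Jet n)) {p q : ℕ} (M : OpMatrix n p q)
    (V : OpMatrix n p p) (U : OpMatrix n q q) : Prop :=
  S.Unimodular N V ∧ S.Unimodular N U ∧
    (V.mul (M.mul U)).EqOn (N ∩ S.prolonged) (OpMatrix.rectOne n p q)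

/-- `M` is hyper-regular in a neighborhood of `x₀` in `𝔛₀`. -/
def HyperRegularAt (x₀ : Jet n) {p q : ℕ} (M : OpMatrix n p q) : Prop :=
  ∃ N : Set (Jet n), IsOpen N ∧ x₀ ∈ N ∧ ∃ V U, S.IsSmithReduction N M V U

/-- `P(F) = ∂F/∂x + ∂F/∂ẋ d/dt`. -/
def P : OpMatrix n (n - m) n := fun i j =>
  Finsupp.single 0 (fun x => fderiv ℝ S.F (x 0, x 1) (Pi.single j 1, 0) i) +
  Finsupp.single 1 (fun x => fderiv ℝ S.F (x 0, x 1) (0, Pi.single j 1) i)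

/-- `Û = U (0, I_m)ᵀ`: the last `m` columns of `U`. -/
def hatU (U : OpMatrix n n n) : OpMatrix n n m := fun i j =>
  U i ⟨n - m + j, by have := S.le; have := j.isLt; omega⟩

/-- In a neighborhood of `x₀` in `𝔛₀`, `U` is a right Smith factor of `P(F)`
and `Q` is a left Smith factor of `Û`. -/
def IsSmithPairAt (x₀ : Jet n) (U Q : OpMatrix n n n) : Prop :=
  ∃ N : Set (Jet n), IsOpen N ∧ x₀ ∈ N ∧
    (∃ V, S.IsSmithReduction N S.P V U) ∧ (∃ W, S.IsSmithReduction N (S.hatU U) Q W)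

end ImplicitSystem

/-! ## Differential forms -/

/-- The 1-form `∑ⱼ ∑ₖ θⱼₖ dxⱼ⁽ᵏ⁾` (a finite sum), given by its coefficients `θ j k`. The row
`(p₁, …, pₙ)` of polynomials in `d/dt` is identified with the form `∑ⱼ pⱼ dxⱼ`. -/
abbrev OneForm (n : ℕ) := Fin n → DiffOp n

namespace OneForm

variable {n : ℕ}

/-- The value of the form at the point `x` on the tangent vector `v`. -/
def eval (θ : OneForm n) (x v : Jet n) : ℝ :=
  ∑ j, (θ j).sum fun k a => a x * v k j

/-- The exterior derivative: `dθ(v, w) = v(θ(w)) - w(θ(v))` for constant vector fields. -/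
def extDeriv (θ : OneForm n) (x v w : Jet n) : ℝ :=
  lineDeriv ℝ (fun z => θ.eval z w) x v - lineDeriv ℝ (fun z => θ.eval z v) x w

/-- The exterior product of two 1-forms. -/
def wedge (τ θ : OneForm n) (x v w : Jet n) : ℝ :=
  τ.eval x v * θ.eval x w - τ.eval x w * θ.eval x v

end OneForm

namespace ImplicitSystem

variable {n m : ℕ} (S : ImplicitSystem n m)

/-- `ωᵢ`, `i = 1, …, m`: the `i`-th component of `(I_m, 0) Q dx`. -/
def omega (Q : OpMatrix n n n) (i : Fin m) : OneForm n := Q (Fin.castLE S.le i)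

/-- `dθ = τ ∧ θ` for some 1-form `τ` in a neighborhood of `x₀` in `𝔛₀`, the forms being
restricted to `𝔛₀`. -/
def OrdinaryClosedAt (x₀ : Jet n) (θ : OneForm n) : Prop :=
  ∃ N : Set (Jet n), IsOpen N ∧ x₀ ∈ N ∧ ∃ τ : OneForm n, (∀ j k, JetAnalyticOn N (τ j k)) ∧
    ∀ x ∈ N ∩ S.prolonged, ∀ v w, S.IsTangent x v → S.IsTangent x w →
      θ.extDeriv x v w = τ.wedge θ x v w

/-! ## Static feedback linearizability -/

/-- Near `(x₀, u₀)`, the explicit system `ẋ = f(x, u)`, with `m` independent controls, is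
compatible with `F(x, ẋ) = 0`, and `f(x₀, u₀) = ẋ₀`. -/
def IsExplicitFormAt (x₀ : Jet n) (f : (Fin n → ℝ) × (Fin m → ℝ) → Fin n → ℝ)
    (u₀ : Fin m → ℝ) : Prop :=
  AnalyticAt ℝ f (x₀ 0, u₀) ∧ f (x₀ 0, u₀) = x₀ 1 ∧
  Function.Injective (fun u : Fin m → ℝ => fderiv ℝ f (x₀ 0, u₀) (0, u)) ∧
  ∀ᶠ z in 𝓝 (x₀ 0, u₀), S.F (z.1, f z) = 0

/-- Kalman's condition for the linear system `ż = A z + B v`. -/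
def Controllable (A : Matrix (Fin n) (Fin n) ℝ) (B : Matrix (Fin n) (Fin m) ℝ) : Prop :=
  Submodule.span ℝ {z | ∃ (k : ℕ) (v : Fin m → ℝ), z = (A ^ k * B).mulVec v} = ⊤

/-- Static feedback linearizability at `(x₀, ẋ₀)`: a local diffeomorphism `z = ζ(x)` and an
invertible static feedback `u = α(x, v)` transform an explicit form `ẋ = f(x, u)` of the system
into a controllable linear system `ż = A z + B v`. -/
def StaticFeedbackLinearizableAt (x₀ : Jet n) : Prop :=
  ∃ (f : (Fin n → ℝ) × (Fin m → ℝ) → Fin n → ℝ) (u₀ : Fin m → ℝ),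
    S.IsExplicitFormAt x₀ f u₀ ∧
    ∃ (ζ : (Fin n → ℝ) → Fin n → ℝ) (α : (Fin n → ℝ) × (Fin m → ℝ) → Fin m → ℝ)
      (v₀ : Fin m → ℝ) (A : Matrix (Fin n) (Fin n) ℝ) (B : Matrix (Fin n) (Fin m) ℝ),
      AnalyticAt ℝ ζ (x₀ 0) ∧ Function.Bijective (fderiv ℝ ζ (x₀ 0)) ∧
      AnalyticAt ℝ α (x₀ 0, v₀) ∧ α (x₀ 0, v₀) = u₀ ∧
      Function.Bijective (fun v : Fin m → ℝ => fderiv ℝ α (x₀ 0, v₀) (0, v)) ∧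
      Controllable A B ∧
      ∀ᶠ z in 𝓝 (x₀ 0, v₀),
        fderiv ℝ ζ z.1 (f (z.1, α z)) = A.mulVec (ζ z.1) + B.mulVec z.2

end ImplicitSystem

end Flatness

end

noncomputable section

namespace Flatness

/-! ## Analytic functions of finitely many variables on a topological vector space -/

section Cyl

variable {E : Type*} [AddCommGroup E] [Module ℝ E] [TopologicalSpace E]
variable {E' : Type*} [AddCommGroup E'] [Module ℝ E'] [TopologicalSpace E']
variable {G : Type*} [NormedAddCommGroup G] [NormedSpace ℝ G]
variable {G' : Type*} [NormedAddCommGroup G'] [NormedSpace ℝ G']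

/-! Near `x₀` the rank condition solves the equations as `ẋ = f(x, u)` with a scalar control `u =
ℓ(ẋ)`, and the jets in `𝔛₀` are then parametrized by `z = (x, u, u̇, …)`; see `LocalForm.param` and
`LocalForm.coord`. The germs of analytic functions of `z` form an integral domain `R`, the germs of
1-forms an `R`-module, and the Lie derivative `D` along the control system acts on both. The proof
compares generators: forms `ω` such that every `dxᵢ` is an `R`-combination of `ω, Dω, D²ω, …`.

With one input a generator is rigid. Applying `D` raises the order in the control by one and keeps
the leading coefficient, and `R` has no zero divisors. Hence a generator contains no differential of
the control, `ω, …, Dⁿ⁻¹ω` is a basis of the span of the `dxᵢ`, and `Dⁿω` contains `du` with an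
invertible coefficient (`ControlModule.Generates.structure`). It follows that two generators differ
by a unit (`exists_eq_unit_smul`). Two kinds of generators matter: the form `ω₁` of any Smith pair,
because `P(F) dx = dF` vanishes on `𝔛₀` (`generates_pull_omega`), and the differential `dy` of a
flat output, because `x` is a function of `y, ẏ, …` (`exists_generates_of_flatAt`).

Flat implies closed, for every choice of `U` and `Q`: `ω₁ = c dy` with `c` a unit, so `dω₁ = (dc /
c) ∧ ω₁`.

Closed implies linearizable: after one coefficient of `ω₁` is normalized to `1`, closedness forces
the other coefficients to be independent of the controls. The form then lives on the state space,
and an analytic Frobenius theorem (`exists_first_integral`) makes it proportional to some `dy` with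
`y = y(x)`. By the structure of generators `y, ẏ, …, y⁽ⁿ⁻¹⁾` are coordinates on the state space and
`y⁽ⁿ⁾` has a nonzero derivative in `u`: this is a chain of integrators up to feedback
(`exists_brunovsky`).

Linearizable implies flat: by Kalman's condition the linear system is itself a chain of integrators
after a further linear change and feedback, and the head of the chain is a flat output. These
implications form a cycle, and hyper-regularity supplies the Smith pair on which it runs. -/

/-- On `W`, the function `h` is the composite of a continuous linear map to a normed space and of
an analytic map. -/
def CylAnOn (W : Set E) (h : E → G) : Prop :=
  ∃ (F : Type) (_ : NormedAddCommGroup F) (_ : NormedSpace ℝ F) (L : E →L[ℝ] F) (g : F → G),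
    AnalyticOnNhd ℝ g (L '' W) ∧ ∀ x ∈ W, h x = g (L x)

/-- All the finite-dimensional (or normed) projections of `Φ` are analytic on `W`. -/
def CylMapOn (W : Set E) (Φ : E → E') : Prop :=
  ∀ (F : Type) [NormedAddCommGroup F] [NormedSpace ℝ F] (L : E' →L[ℝ] F),
    CylAnOn W (fun x => L (Φ x))

/-- `w` is the derivative of `Φ` at `x` along `v`. -/
def HasCylDeriv (Φ : E → E') (w : E') (x v : E) : Prop :=
  ∀ (F : Type) [NormedAddCommGroup F] [NormedSpace ℝ F] (L : E' →L[ℝ] F),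
    HasLineDerivAt ℝ (fun x => L (Φ x)) (L w) x v

namespace CylAnOn

variable {W W' : Set E} {h k : E → G}

theorem mono (hh : CylAnOn W h) (hW : W' ⊆ W) : CylAnOn W' h := by
  obtain ⟨F, _, _, L, g, hg, e⟩ := hh
  exact ⟨F, _, _, L, g, hg.mono (image_mono hW), fun x hx => e x (hW hx)⟩

theorem congr (hh : CylAnOn W h) (e : EqOn k h W) : CylAnOn W k := by
  obtain ⟨F, _, _, L, g, hg, e'⟩ := hh
  exact ⟨F, _, _, L, g, hg, fun x hx => (e hx).trans (e' x hx)⟩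

theorem comp {φ : G → G'} {s : Set G} (hφ : AnalyticOnNhd ℝ φ s) (hh : CylAnOn W h)
    (hs : MapsTo h W s) : CylAnOn W (fun x => φ (h x)) := by
  obtain ⟨F, _, _, L, g, hg, e⟩ := hh
  refine ⟨F, _, _, L, φ ∘ g, ?_, fun x hx => by simp [e x hx]⟩
  rintro _ ⟨x, hx, rfl⟩
  exact AnalyticAt.comp (by rw [← e x hx]; exact hφ _ (hs hx)) (hg _ ⟨x, hx, rfl⟩)

theorem clm_comp (φ : G →L[ℝ] G') (hh : CylAnOn W h) : CylAnOn W (fun x => φ (h x)) :=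
  hh.comp (s := univ) (fun x _ => φ.analyticAt x) (fun _ _ => mem_univ _)

theorem of_clm {F : Type} [NormedAddCommGroup F] [NormedSpace ℝ F] (L : E →L[ℝ] F) :
    CylAnOn W (fun x => L x) :=
  ⟨F, _, _, L, id, fun _ _ => analyticAt_id, fun _ _ => rfl⟩

theorem const (c : G) : CylAnOn W (fun _ : E => c) :=
  ⟨ℝ, _, _, 0, fun _ => c, fun _ _ => analyticAt_const, fun _ _ => rfl⟩

theorem prodMk {h' : E → G'} (hh : CylAnOn W h) (hh' : CylAnOn W h') :
    CylAnOn W (fun x => (h x, h' x)) := by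
  obtain ⟨F, _, _, L, g, hg, e⟩ := hh
  obtain ⟨F', _, _, L', g', hg', e'⟩ := hh'
  refine ⟨F × F', _, _, L.prod L', fun y => (g y.1, g' y.2), ?_, fun x hx => by
    simp [e x hx, e' x hx]⟩
  rintro _ ⟨x, hx, rfl⟩
  refine AnalyticAt.prod ?_ ?_
  · exact (hg _ ⟨x, hx, rfl⟩).comp_of_eq analyticAt_fst rfl
  · exact (hg' _ ⟨x, hx, rfl⟩).comp_of_eq analyticAt_snd rfl

theorem pi {ι : Type} [Fintype ι] {Gi : ι → Type*} [∀ i, NormedAddCommGroup (Gi i)]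
    [∀ i, NormedSpace ℝ (Gi i)] {h : ∀ i, E → Gi i} (hh : ∀ i, CylAnOn W (h i)) :
    CylAnOn W (fun x i => h i x) := by
  choose F _ _ L g hg e using hh
  refine ⟨∀ i, F i, inferInstance, inferInstance, ContinuousLinearMap.pi L,
    fun y i => g i (y i), ?_, fun x hx => by funext i; simp [e i x hx]⟩
  rintro _ ⟨x, hx, rfl⟩
  refine AnalyticAt.pi fun i => ?_
  exact (hg i _ ⟨x, hx, rfl⟩).comp_of_eq
    ((ContinuousLinearMap.proj (R := ℝ) (φ := F) i).analyticAt _) rfl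

theorem add (hh : CylAnOn W h) (hk : CylAnOn W k) : CylAnOn W (fun x => h x + k x) :=
  (hh.prodMk hk).comp (φ := fun p : G × G => p.1 + p.2) (s := univ)
    (fun _ _ => analyticAt_fst.add analyticAt_snd) (fun _ _ => mem_univ _)

theorem neg (hh : CylAnOn W h) : CylAnOn W (fun x => -h x) :=
  hh.comp (φ := fun p : G => -p) (s := univ) (fun _ _ => analyticAt_id.neg)
    (fun _ _ => mem_univ _)

theorem mul {h k : E → ℝ} (hh : CylAnOn W h) (hk : CylAnOn W k) :
    CylAnOn W (fun x => h x * k x) :=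
  (hh.prodMk hk).comp (φ := fun p : ℝ × ℝ => p.1 * p.2) (s := univ)
    (fun _ _ => analyticAt_fst.mul analyticAt_snd) (fun _ _ => mem_univ _)

theorem inv {h : E → ℝ} (hh : CylAnOn W h) (h0 : ∀ x ∈ W, h x ≠ 0) :
    CylAnOn W (fun x => (h x)⁻¹) :=
  hh.comp (φ := fun p : ℝ => p⁻¹) (s := {0}ᶜ) (fun _ hx => analyticAt_inv hx)
    (fun x hx => h0 x hx)

theorem continuousOn (hh : CylAnOn W h) : ContinuousOn h W := by
  obtain ⟨F, _, _, L, g, hg, e⟩ := hh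
  refine ContinuousOn.congr (f := g ∘ L) ?_ e
  exact hg.continuousOn.comp L.continuous.continuousOn (mapsTo_image _ _)

theorem comp_map {N : Set E'} {h : E' → G} {Φ : E → E'} (hh : CylAnOn N h) (hΦ : CylMapOn W Φ)
    (hm : MapsTo Φ W N) : CylAnOn W (fun x => h (Φ x)) := by
  obtain ⟨F, _, _, L, g, hg, e⟩ := hh
  refine ((hΦ F L).comp hg (fun x hx => ⟨Φ x, hm hx, rfl⟩)).congr fun x hx => e _ (hm hx)

end CylAnOn

theorem CylMapOn.of_clm (W : Set E) (L : E →L[ℝ] E') : CylMapOn W (fun x => L x) :=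
  fun _ _ _ L' => CylAnOn.of_clm (L'.comp L)

theorem CylMapOn.mono {W W' : Set E} {Φ : E → E'} (h : CylMapOn W Φ) (hW : W' ⊆ W) :
    CylMapOn W' Φ := fun F _ _ L => (h F L).mono hW

theorem hasDerivAt_clm_line {F : Type*} [NormedAddCommGroup F] [NormedSpace ℝ F] (L : E →L[ℝ] F)
    (x v : E) (t : ℝ) : HasDerivAt (fun t : ℝ => L (x + t • v)) (L v) t := by
  simpa using ((hasDerivAt_id t).smul_const (L v)).const_add (L x)

theorem hasLineDerivAt_comp_clm {F : Type*} [NormedAddCommGroup F] [NormedSpace ℝ F]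
    {L : E →L[ℝ] F} {g : F → G} {x : E} (hg : AnalyticAt ℝ g (L x)) (v : E) :
    HasLineDerivAt ℝ (fun x => g (L x)) (fderiv ℝ g (L x) (L v)) x v := by
  have h1 : HasFDerivAt g (fderiv ℝ g (L x)) (L (x + (0 : ℝ) • v)) := by
    simpa using hg.differentiableAt.hasFDerivAt
  exact h1.comp_hasDerivAt (0 : ℝ) (hasDerivAt_clm_line L x v 0)

variable [IsTopologicalAddGroup E] [ContinuousSMul ℝ E]

theorem tendsto_add_smul (x v : E) : Tendsto (fun t : ℝ => x + t • v) (𝓝 0) (𝓝 x) := by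
  have : Continuous (fun t : ℝ => x + t • v) := by fun_prop
  simpa using this.tendsto 0

theorem eventually_add_smul {p : E → Prop} {x : E} (h : ∀ᶠ y in 𝓝 x, p y) (v : E) :
    ∀ᶠ t in 𝓝 (0 : ℝ), p (x + t • v) := (tendsto_add_smul x v).eventually h

theorem lineDeriv_congr_nhds {h k : E → G} {x : E} (e : h =ᶠ[𝓝 x] k) (v : E) :
    lineDeriv ℝ h x v = lineDeriv ℝ k x v :=
  Filter.EventuallyEq.deriv_eq (eventually_add_smul e v)

theorem hasLineDerivAt_congr_nhds {h k : E → G} {x v : E} {d : G} (hd : HasLineDerivAt ℝ k d x v)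
    (e : h =ᶠ[𝓝 x] k) : HasLineDerivAt ℝ h d x v :=
  HasDerivAt.congr_of_eventuallyEq hd (eventually_add_smul e v)

namespace CylAnOn

variable {W : Set E} {h k : E → G}

theorem exists_deriv (hW : IsOpen W) (hh : CylAnOn W h) :
    ∃ (F : Type) (_ : NormedAddCommGroup F) (_ : NormedSpace ℝ F) (L : E →L[ℝ] F) (g : F → G),
      AnalyticOnNhd ℝ g (L '' W) ∧ (∀ x ∈ W, h x = g (L x)) ∧
      ∀ x ∈ W, ∀ v, HasLineDerivAt ℝ h (fderiv ℝ g (L x) (L v)) x v := by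
  obtain ⟨F, _, _, L, g, hg, e⟩ := hh
  refine ⟨F, _, _, L, g, hg, e, fun x hx v => ?_⟩
  exact hasLineDerivAt_congr_nhds (hasLineDerivAt_comp_clm (hg _ ⟨x, hx, rfl⟩) v)
    (eventually_of_mem (hW.mem_nhds hx) e)

theorem hasLineDerivAt (hW : IsOpen W) (hh : CylAnOn W h) {x : E} (hx : x ∈ W) (v : E) :
    HasLineDerivAt ℝ h (lineDeriv ℝ h x v) x v := by
  obtain ⟨F, _, _, L, g, hg, e, hd⟩ := hh.exists_deriv hW
  rw [(hd x hx v).lineDeriv]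
  exact hd x hx v

theorem lineDeriv_field [CompleteSpace G] (hW : IsOpen W) (hh : CylAnOn W h) {X : E → E}
    (hX : CylMapOn W X) :
    CylAnOn W (fun x => lineDeriv ℝ h x (X x)) := by
  obtain ⟨F, _, _, L, g, hg, e, hd⟩ := hh.exists_deriv hW
  have h1 : CylAnOn W (fun x => fderiv ℝ g (L x)) :=
    (of_clm L).comp hg.fderiv (mapsTo_image _ _)
  have h2 := (h1.prodMk (hX F L)).comp (φ := fun p : (F →L[ℝ] G) × F => p.1 p.2) (s := univ)
    (fun p _ => (ContinuousLinearMap.apply ℝ G : F →L[ℝ] (F →L[ℝ] G) →L[ℝ] G).flip.analyticAt_bilinear p)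
    (fun _ _ => mem_univ _)
  exact h2.congr fun x hx => (hd x hx (X x)).lineDeriv

theorem lineDeriv_const [CompleteSpace G] (hW : IsOpen W) (hh : CylAnOn W h) (v : E) :
    CylAnOn W (fun x => lineDeriv ℝ h x v) :=
  hh.lineDeriv_field hW (X := fun _ => v) (fun _ _ _ L => const (L v))

theorem lineDeriv_add_dir (hW : IsOpen W) (hh : CylAnOn W h) {x : E} (hx : x ∈ W) (v w : E) :
    lineDeriv ℝ h x (v + w) = lineDeriv ℝ h x v + lineDeriv ℝ h x w := by
  obtain ⟨F, _, _, L, g, hg, e, hd⟩ := hh.exists_deriv hW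
  simp [(hd x hx _).lineDeriv]

theorem lineDeriv_sub_dir (hW : IsOpen W) (hh : CylAnOn W h) {x : E} (hx : x ∈ W) (v w : E) :
    lineDeriv ℝ h x (v - w) = lineDeriv ℝ h x v - lineDeriv ℝ h x w := by
  obtain ⟨F, _, _, L, g, hg, e, hd⟩ := hh.exists_deriv hW
  simp [(hd x hx _).lineDeriv]

theorem lineDeriv_smul_dir (hW : IsOpen W) (hh : CylAnOn W h) {x : E} (hx : x ∈ W) (c : ℝ)
    (v : E) : lineDeriv ℝ h x (c • v) = c • lineDeriv ℝ h x v := by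
  obtain ⟨F, _, _, L, g, hg, e, hd⟩ := hh.exists_deriv hW
  simp [(hd x hx _).lineDeriv]

theorem hasLineDerivAt_comp_map [IsTopologicalAddGroup E'] [ContinuousSMul ℝ E']
    {N : Set E'} {h : E' → G} {Φ : E → E'} (hN : IsOpen N) (hh : CylAnOn N h) {x v : E} {w : E'}
    (hΦ : HasCylDeriv Φ w x v) (hx : ∀ᶠ y in 𝓝 x, Φ y ∈ N) :
    HasLineDerivAt ℝ (fun x => h (Φ x)) (lineDeriv ℝ h (Φ x) w) x v := by
  obtain ⟨F, _, _, L, g, hg, e, hd⟩ := hh.exists_deriv hN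
  have hx' := hx.self_of_nhds
  rw [(hd _ hx' w).lineDeriv]
  have h1 : HasFDerivAt g (fderiv ℝ g (L (Φ x))) (L (Φ (x + (0 : ℝ) • v))) := by
    simpa using (hg _ ⟨_, hx', rfl⟩).differentiableAt.hasFDerivAt
  have h2 : HasLineDerivAt ℝ (fun x => g (L (Φ x))) (fderiv ℝ g (L (Φ x)) (L w)) x v :=
    h1.comp_hasDerivAt (0 : ℝ) (hΦ F L)
  refine hasLineDerivAt_congr_nhds h2 ?_
  filter_upwards [hx] with y hy using e _ hy

/-- The derivatives along two vector fields commute up to the derivative along their bracket. -/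
theorem lineDeriv_comm [CompleteSpace G] (hW : IsOpen W) (hh : CylAnOn W h) {X : E → E}
    {x v w : E} (hx : x ∈ W) (hw : HasCylDeriv X w x v) :
    lineDeriv ℝ (fun x => lineDeriv ℝ h x (X x)) x v =
      lineDeriv ℝ (fun x => lineDeriv ℝ h x v) x (X x) + lineDeriv ℝ h x w := by
  obtain ⟨F, _, _, L, g, hg, e, hd⟩ := hh.exists_deriv hW
  have hgx : AnalyticAt ℝ g (L x) := hg _ ⟨x, hx, rfl⟩
  have key : ∀ u : E, HasDerivAt (fun t : ℝ => fderiv ℝ g (L (x + t • u)))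
      (fderiv ℝ (fderiv ℝ g) (L x) (L u)) 0 := by
    intro u
    have h1 : HasFDerivAt (fderiv ℝ g) (fderiv ℝ (fderiv ℝ g) (L x)) (L (x + (0 : ℝ) • u)) := by
      simpa using hgx.fderiv.differentiableAt.hasFDerivAt
    exact h1.comp_hasDerivAt (0 : ℝ) (hasDerivAt_clm_line L x u 0)
  have hev : ∀ Y : E → E, (fun x => lineDeriv ℝ h x (Y x)) =ᶠ[𝓝 x]
      fun x => fderiv ℝ g (L x) (L (Y x)) := fun Y =>
    eventually_of_mem (hW.mem_nhds hx) fun y hy => (hd y hy (Y y)).lineDeriv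
  have h1 : HasLineDerivAt ℝ (fun x => lineDeriv ℝ h x (X x))
      (fderiv ℝ (fderiv ℝ g) (L x) (L v) (L (X x)) + fderiv ℝ g (L x) (L w)) x v := by
    refine hasLineDerivAt_congr_nhds ?_ (hev X)
    have := (key v).clm_apply (hw F L)
    simpa [HasLineDerivAt] using this
  have h2 : HasLineDerivAt ℝ (fun x => lineDeriv ℝ h x v)
      (fderiv ℝ (fderiv ℝ g) (L x) (L (X x)) (L v)) x (X x) := by
    refine hasLineDerivAt_congr_nhds ?_ (hev fun _ => v)
    have := (key (X x)).clm_apply (hasDerivAt_const (0 : ℝ) (L v))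
    simpa [HasLineDerivAt] using this
  have hs : IsSymmSndFDerivAt ℝ g (L x) :=
    (hgx.contDiffAt (n := 2)).isSymmSndFDerivAt (by simp)
  rw [h1.lineDeriv, h2.lineDeriv, (hd x hx w).lineDeriv, hs.eq]

end CylAnOn

end Cyl

/-! ## Analytic implicit functions -/

theorem exists_analytic_implicit {E₁ E₂ F : Type*}
    [NormedAddCommGroup E₁] [NormedSpace ℝ E₁] [CompleteSpace E₁]
    [NormedAddCommGroup E₂] [NormedSpace ℝ E₂] [CompleteSpace E₂]
    [NormedAddCommGroup F] [NormedSpace ℝ F] [CompleteSpace F]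
    {f : E₁ × E₂ → F} {u : E₁ × E₂} (hf : AnalyticAt ℝ f u)
    (hi : (fderiv ℝ f u ∘L .inr ℝ E₁ E₂).IsInvertible) :
    ∃ ψ : E₁ → E₂, AnalyticAt ℝ ψ u.1 ∧ ψ u.1 = u.2 ∧
      (∀ᶠ x in 𝓝 u.1, f (x, ψ x) = f u) ∧ ∀ᶠ v in 𝓝 u, f v = f u ↔ ψ v.1 = v.2 := by
  -- In `WithTop ℕ∞` the exponent `⊤` is `ω`, so the implicit function has analytic regularity.
  have hc : ContDiffAt ℝ ⊤ f u := hf.contDiffAt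
  refine ⟨hc.implicitFunction (by simp) hi, ?_, hc.implicitFunction_apply_self _ hi,
    hc.eventually_apply_implicitFunction _ hi, hc.eventually_apply_eq_iff_implicitFunction _ hi⟩
  exact (hc.contDiffAt_implicitFunction _ hi).analyticAt

/-- The factor `p` makes the right-hand side of `c = B (N (P (p, c))) p` vanish for `p = 0`, so the
partial derivative in `c` of the difference of the two sides is the identity at the origin, and the
implicit function theorem applies without any smallness condition. With `N` a superposition operator
and `B` an integration, this gives analytic dependence of the solutions of a differential equation
on the parameter `p`. -/
theorem exists_bilinear_fixed_family {E C A Γ : Type*}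
    [NormedAddCommGroup E] [NormedSpace ℝ E] [CompleteSpace E]
    [NormedAddCommGroup C] [NormedSpace ℝ C] [CompleteSpace C]
    [NormedAddCommGroup A] [NormedSpace ℝ A] [NormedAddCommGroup Γ] [NormedSpace ℝ Γ]
    (B : A →L[ℝ] E →L[ℝ] C) (P : E × C →L[ℝ] Γ) {N : Γ → A} {V : Set Γ} (hV : IsOpen V)
    (h0 : (0 : Γ) ∈ V) (hN : AnalyticOnNhd ℝ N V) :
    ∃ ψ : E → C, AnalyticAt ℝ ψ 0 ∧ ψ 0 = 0 ∧ ∀ᶠ p in 𝓝 (0 : E),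
      P (p, ψ p) ∈ V ∧ ψ p = B (N (P (p, ψ p))) p ∧ AnalyticAt ℝ ψ p ∧
      ∀ a, fderiv ℝ ψ p a = B (fderiv ℝ N (P (p, ψ p)) (P (a, fderiv ℝ ψ p a))) p +
        B (N (P (p, ψ p))) a := by
  let Φ : E × C → C := fun z => z.2 - B (N (P z)) z.1
  have hP0 : P (0, 0) = 0 := map_zero P
  have hF0 : AnalyticAt ℝ Φ (0, 0) := by
    have h1 : AnalyticAt ℝ (fun z => N (P z)) ((0 : E), (0 : C)) :=
      (hN _ (by rwa [hP0])).comp_of_eq (P.analyticAt _) rfl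
    have h2 := h1.prod (analyticAt_fst (𝕜 := ℝ) (p := ((0 : E), (0 : C))))
    exact analyticAt_snd.sub (AnalyticAt.comp_of_eq (g := fun q : A × E => B q.1 q.2)
      (B.analyticAt_bilinear _) h2 rfl)
  have hd0 : fderiv ℝ Φ (0, 0) ∘L .inr ℝ E C = .id ℝ _ := by
    have h1 : HasFDerivAt Φ (fderiv ℝ Φ (0, 0)) (ContinuousLinearMap.inr ℝ E C 0) := by
      simpa using hF0.differentiableAt.hasFDerivAt
    have h2 := h1.comp (0 : C) (ContinuousLinearMap.inr ℝ E C).hasFDerivAt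
    refine h2.unique ?_
    have : Φ ∘ (ContinuousLinearMap.inr ℝ E C) = id := by
      funext z; simp [Φ]
    rw [this]
    exact hasFDerivAt_id _
  obtain ⟨ψ, hψa, hψ0, hψ, -⟩ := exists_analytic_implicit (u := ((0 : E), (0 : C))) hF0
    (by rw [hd0]; exact ContinuousLinearMap.isInvertible_equiv (f := .refl ℝ _))
  refine ⟨ψ, hψa, hψ0, ?_⟩
  have hF00 : Φ (0, 0) = 0 := by simp [Φ]
  have hcont : Tendsto (fun p => P (p, ψ p)) (𝓝 0) (𝓝 0) := by
    have h1 : ContinuousAt (fun p : E => P (p, ψ p)) 0 :=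
      ContinuousAt.comp (g := P) P.continuous.continuousAt
        (continuousAt_id.prodMk hψa.continuousAt)
    have := h1.tendsto
    simpa only [show ψ 0 = 0 from hψ0, hP0] using this
  filter_upwards [hψ.eventually_nhds, hψa.eventually_analyticAt,
    hcont.eventually (hV.mem_nhds h0)] with p hp hpa hpr
  have heq : ψ =ᶠ[𝓝 p] fun q => B (N (P (q, ψ q))) q := by
    filter_upwards [hp] with q hq
    have : Φ (q, ψ q) = 0 := by rw [hq]; exact hF00
    exact sub_eq_zero.1 this
  refine ⟨hpr, heq.self_of_nhds, hpa, fun a => ?_⟩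
  have hline : HasFDerivAt (fun q : E => (q, ψ q)) ((ContinuousLinearMap.id ℝ E).prod
      (fderiv ℝ ψ p)) p := (hasFDerivAt_id p).prodMk hpa.differentiableAt.hasFDerivAt
  have hBline : HasFDerivAt (fun q : E => P (q, ψ q)) (P ∘L ((ContinuousLinearMap.id ℝ E).prod
      (fderiv ℝ ψ p))) p := P.hasFDerivAt.comp p hline
  have hNd : HasFDerivAt N (fderiv ℝ N (P (p, ψ p))) (P (p, ψ p)) :=
    (hN _ hpr).differentiableAt.hasFDerivAt
  have hNline := hNd.comp p hBline
  have hprod := B.hasFDerivAt_of_bilinear hNline (hasFDerivAt_id p)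
  have hfd := (hprod.congr_of_eventuallyEq heq).fderiv
  conv_lhs => rw [hfd]
  simp [add_comm]

/-! ## The superposition operator of an analytic map -/

section Superposition

variable {K : Type*} [TopologicalSpace K] [CompactSpace K]
variable {E F : Type*} [NormedAddCommGroup E] [NormedSpace ℝ E]
  [NormedAddCommGroup F] [NormedSpace ℝ F]

/-- The power series `p` applied pointwise to continuous functions. -/
def superpositionSeries (K : Type*) [TopologicalSpace K] [CompactSpace K]
    (p : FormalMultilinearSeries ℝ E F) : FormalMultilinearSeries ℝ C(K, E) C(K, F) := fun k =>
  MultilinearMap.mkContinuous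
    { toFun := fun m => ⟨fun t => p k (fun i => m i t), by fun_prop⟩
      map_update_add' := by
        intro _ m i x y
        ext t
        have : ∀ z : C(K, E), (fun j => Function.update m i z j t) =
            Function.update (fun j => m j t) i (z t) := by
          intro z; funext j
          by_cases h : j = i
          · subst h; simp
          · simp [h]
        simp [this]
      map_update_smul' := by
        intro _ m i c x
        ext t
        have : ∀ z : C(K, E), (fun j => Function.update m i z j t) =
            Function.update (fun j => m j t) i (z t) := by
          intro z; funext j
          by_cases h : j = i
          · subst h; simp
          · simp [h]
        simp [this] }
    ‖p k‖ (by
      intro m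
      rw [ContinuousMap.norm_le _ (by positivity)]
      intro t
      refine (ContinuousMultilinearMap.le_opNorm _ _).trans ?_
      gcongr with i
      exact (m i).norm_coe_le_norm t)

theorem radius_le_superpositionSeries (p : FormalMultilinearSeries ℝ E F) :
    p.radius ≤ (superpositionSeries K p).radius := by
  refine ENNReal.le_of_forall_nnreal_lt fun r hr => ?_
  refine FormalMultilinearSeries.le_radius_of_summable _
    ((p.summable_norm_mul_pow hr).of_nonneg_of_le (fun _ => by positivity) fun k => ?_)
  gcongr
  exact MultilinearMap.mkContinuous_norm_le _ (norm_nonneg _) _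

variable [CompleteSpace F]

/-- The superposition operator `γ ↦ f ∘ (x + γ)` is analytic near `0`. -/
theorem exists_superposition {f : E → F} {p : FormalMultilinearSeries ℝ E F} {x : E}
    {r : ENNReal} (hf : HasFPowerSeriesOnBall f p x r) :
    ∃ N : C(K, E) → C(K, F), AnalyticOnNhd ℝ N (Metric.eball 0 r) ∧
      ∀ γ ∈ Metric.eball (0 : C(K, E)) r, ∀ t, N γ t = f (x + γ t) := by
  have hr : r ≤ (superpositionSeries K p).radius :=
    hf.r_le.trans (radius_le_superpositionSeries p)
  have hN := ((superpositionSeries K p).hasFPowerSeriesOnBall (hf.r_pos.trans_le hr)).mono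
    hf.r_pos hr
  refine ⟨_, hN.analyticOnNhd, fun γ hγ t => ?_⟩
  have h1 := (ContinuousMap.evalCLM ℝ t).hasSum (hN.hasSum hγ)
  have ht : γ t ∈ Metric.eball (0 : E) r := by
    rw [Metric.mem_eball, edist_zero_right] at hγ ⊢
    refine lt_of_le_of_lt ?_ hγ
    rw [← ofReal_norm, ← ofReal_norm]
    exact ENNReal.ofReal_le_ofReal (γ.norm_coe_le_norm t)
  have h2 := hf.hasSum ht
  simp only [zero_add] at h1
  exact HasSum.unique h1 h2

end Superposition

/-! ## First integrals of an analytic integrable hyperplane field -/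

section FirstIntegral

open unitInterval

variable {E : Type*} [NormedAddCommGroup E] [NormedSpace ℝ E]

/-- `(ϕ, p) ↦ (t ↦ ∫₀ᵗ ϕ(s) p ds)`. -/
def primitiveB (E : Type*) [NormedAddCommGroup E] [NormedSpace ℝ E] :
    C(I, E →L[ℝ] ℝ) →L[ℝ] E →L[ℝ] C(I, ℝ) :=
  LinearMap.mkContinuous₂
    (LinearMap.mk₂ ℝ (fun (ϕ : C(I, E →L[ℝ] ℝ)) (p : E) =>
      (⟨fun t => ∫ s in (0 : ℝ)..t, ϕ (projIcc 0 1 zero_le_one s) p, by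
        have : Continuous fun t : ℝ => ∫ s in (0 : ℝ)..t, ϕ (projIcc 0 1 zero_le_one s) p :=
          intervalIntegral.continuous_primitive (fun a b => Continuous.intervalIntegrable
            (((map_continuous ϕ).comp continuous_projIcc).clm_apply continuous_const) _ _) _
        exact this.comp continuous_subtype_val⟩ : C(I, ℝ)))
      (by
        intro ϕ ϕ' p; ext t
        simp only [ContinuousMap.coe_mk, ContinuousMap.add_apply, add_apply]
        exact intervalIntegral.integral_add
          (Continuous.intervalIntegrable
            (((map_continuous ϕ).comp continuous_projIcc).clm_apply continuous_const) _ _)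
          (Continuous.intervalIntegrable
            (((map_continuous ϕ').comp continuous_projIcc).clm_apply continuous_const) _ _))
      (by
        intro c ϕ p; ext t
        simp)
      (by
        intro ϕ p p'; ext t
        simp only [ContinuousMap.coe_mk, ContinuousMap.add_apply, map_add]
        exact intervalIntegral.integral_add
          (Continuous.intervalIntegrable
            (((map_continuous ϕ).comp continuous_projIcc).clm_apply continuous_const) _ _)
          (Continuous.intervalIntegrable
            (((map_continuous ϕ).comp continuous_projIcc).clm_apply continuous_const) _ _))
      (by
        intro c ϕ p; ext t
        simp))
    1 (by
      intro ϕ p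
      rw [ContinuousMap.norm_le _ (by positivity)]
      intro t
      have h := intervalIntegral.norm_integral_le_of_norm_le_const (a := (0 : ℝ)) (b := t)
        (f := fun s => ϕ (projIcc 0 1 zero_le_one s) p) (C := ‖ϕ‖ * ‖p‖) (fun s _ =>
          (ContinuousLinearMap.le_opNorm _ _).trans (by gcongr; exact ϕ.norm_coe_le_norm _))
      have ht : |(t : ℝ) - 0| ≤ 1 := by
        rw [sub_zero, abs_of_nonneg t.2.1]; exact t.2.2
      refine h.trans ?_
      calc ‖ϕ‖ * ‖p‖ * |(t : ℝ) - 0| ≤ ‖ϕ‖ * ‖p‖ * 1 := by gcongr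
        _ = 1 * ‖ϕ‖ * ‖p‖ := by ring)

theorem primitiveB_apply (ϕ : C(I, E →L[ℝ] ℝ)) (p : E) (t : I) :
    primitiveB E ϕ p t = ∫ s in (0 : ℝ)..t, ϕ (projIcc 0 1 zero_le_one s) p := rfl

/-- `(p, σ) ↦ (t ↦ (1 - t) p + σ(t) e)`. -/
def backPath (e : E) : E × C(I, ℝ) →L[ℝ] C(I, E) :=
  LinearMap.mkContinuous
    { toFun := fun z => ⟨fun t => (1 - (t : ℝ)) • z.1 + z.2 t • e, by fun_prop⟩
      map_add' := by intro z z'; ext t; simp; module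
      map_smul' := by intro c z; ext t; simp; module }
    (1 + ‖e‖) (by
      intro z
      rw [ContinuousMap.norm_le _ (by positivity)]
      intro t
      have h1 : ‖(1 - (t : ℝ)) • z.1‖ ≤ ‖z‖ := by
        rw [norm_smul]
        have : ‖(1 - (t : ℝ))‖ ≤ 1 := by
          rw [Real.norm_eq_abs, abs_le]; constructor <;> linarith [t.2.1, t.2.2]
        calc _ ≤ 1 * ‖z.1‖ := by gcongr
          _ ≤ ‖z‖ := by rw [one_mul]; exact norm_fst_le z
      have h2 : ‖z.2 t • e‖ ≤ ‖z‖ * ‖e‖ := by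
        rw [norm_smul]
        gcongr
        exact (z.2.norm_coe_le_norm t).trans (norm_snd_le z)
      calc ‖(1 - (t : ℝ)) • z.1 + z.2 t • e‖ ≤ _ := norm_add_le _ _
        _ ≤ ‖z‖ + ‖z‖ * ‖e‖ := add_le_add h1 h2
        _ = (1 + ‖e‖) * ‖z‖ := by ring)

theorem backPath_apply (e p : E) (s : C(I, ℝ)) (t : I) :
    backPath e (p, s) t = (1 - (t : ℝ)) • p + s t • e := rfl

variable [CompleteSpace E]

/-- Analytic dependence on `p` of the solution of `s' = θ(x₀ + (1 - t) p + s e) p`, `s(0) = 0`,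
together with the variational equation. -/
theorem exists_path_family {θ : E → E →L[ℝ] ℝ} {x₀ : E} (hθ : AnalyticAt ℝ θ x₀) (e : E)
    {U : Set E} (hU : U ∈ 𝓝 x₀) :
    ∃ ψ : E → C(I, ℝ), AnalyticAt ℝ ψ 0 ∧ ψ 0 = 0 ∧ ∀ᶠ p in 𝓝 (0 : E),
      (∀ t, x₀ + backPath e (p, ψ p) t ∈ U) ∧
      (∀ t : I, ψ p t = ∫ s in (0 : ℝ)..t,
        θ (x₀ + backPath e (p, ψ p) (projIcc 0 1 zero_le_one s)) p) ∧
      AnalyticAt ℝ ψ p ∧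
      ∀ a, ∀ t : I, fderiv ℝ ψ p a t = ∫ s in (0 : ℝ)..t,
        (fderiv ℝ θ (x₀ + backPath e (p, ψ p) (projIcc 0 1 zero_le_one s))
          (backPath e (a, fderiv ℝ ψ p a) (projIcc 0 1 zero_le_one s)) p +
        θ (x₀ + backPath e (p, ψ p) (projIcc 0 1 zero_le_one s)) a) := by
  obtain ⟨P, r, hP⟩ := hθ
  obtain ⟨N, hN, hNe⟩ := exists_superposition (K := I) hP
  have h0 : (0 : C(I, E)) ∈ Metric.eball (0 : C(I, E)) r := Metric.mem_eball_self hP.r_pos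
  obtain ⟨ε, hε, hεU⟩ := Metric.mem_nhds_iff.1 hU
  -- The differential equation becomes a fixed-point equation in `C(I, ℝ)`: superposition with `θ`,
  -- then integration. The time interval stays `[0, 1]`; smallness is carried by `p` alone.
  obtain ⟨ψ, hψa, hψ0, hψ⟩ := exists_bilinear_fixed_family (primitiveB E) (backPath e)
    (V := Metric.eball 0 r ∩ Metric.ball 0 ε) (Metric.isOpen_eball.inter Metric.isOpen_ball)
    ⟨h0, Metric.mem_ball_self hε⟩ (hN.mono inter_subset_left)
  refine ⟨ψ, hψa, hψ0, ?_⟩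
  filter_upwards [hψ] with p ⟨⟨hpr, hpε⟩, hψeq, hpa, hfd⟩
  refine ⟨fun t => hεU ?_, fun t => ?_, hpa, fun a t => ?_⟩
  · have h1 : ‖backPath e (p, ψ p) t‖ < ε := by
      rw [mem_ball_zero_iff] at hpε
      exact ((backPath e (p, ψ p)).norm_coe_le_norm t).trans_lt hpε
    simpa [Metric.mem_ball, dist_eq_norm] using h1
  · conv_lhs => rw [hψeq]
    rw [primitiveB_apply]
    simp_rw [hNe _ hpr]
  · have hNd : HasFDerivAt N (fderiv ℝ N (backPath e (p, ψ p))) (backPath e (p, ψ p)) :=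
      (hN _ hpr).differentiableAt.hasFDerivAt
    have hNev : ∀ (η : C(I, E)) (s : I), fderiv ℝ N (backPath e (p, ψ p)) η s =
        fderiv ℝ θ (x₀ + backPath e (p, ψ p) s) (η s) := by
      intro η s
      have h1 := (ContinuousMap.evalCLM ℝ s : C(I, E →L[ℝ] ℝ) →L[ℝ] _).hasFDerivAt.comp _ hNd
      have hin : x₀ + backPath e (p, ψ p) s ∈ Metric.eball x₀ r := by
        rw [Metric.mem_eball, edist_eq_enorm_sub]
        rw [Metric.mem_eball, edist_zero_right] at hpr
        refine lt_of_le_of_lt ?_ hpr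
        rw [add_sub_cancel_left, ← ofReal_norm, ← ofReal_norm]
        exact ENNReal.ofReal_le_ofReal ((backPath e (p, ψ p)).norm_coe_le_norm s)
      have h3 : HasFDerivAt (fun γ : C(I, E) => x₀ + γ s)
          (ContinuousMap.evalCLM ℝ s : C(I, E) →L[ℝ] E) (backPath e (p, ψ p)) :=
        (ContinuousMap.evalCLM ℝ s : C(I, E) →L[ℝ] E).hasFDerivAt.const_add x₀
      have h2 : HasFDerivAt (fun γ : C(I, E) => θ (x₀ + γ s))
          (fderiv ℝ θ (x₀ + backPath e (p, ψ p) s) ∘L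
            (ContinuousMap.evalCLM ℝ s : C(I, E) →L[ℝ] E)) (backPath e (p, ψ p)) :=
        HasFDerivAt.comp (g := θ) (f := fun γ : C(I, E) => x₀ + γ s) _
          (hP.analyticAt_of_mem hin).differentiableAt.hasFDerivAt h3
      have h4 : (fun γ => N γ s) =ᶠ[𝓝 (backPath e (p, ψ p))] fun γ : C(I, E) => θ (x₀ + γ s) :=
        eventually_of_mem (Metric.isOpen_eball.mem_nhds hpr) fun γ hγ => hNe γ hγ s
      exact congrArg (fun T => T η) (h1.unique (h2.congr_of_eventuallyEq h4))
    conv_lhs => rw [hfd a]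
    rw [ContinuousMap.add_apply, primitiveB_apply, primitiveB_apply,
      ← intervalIntegral.integral_add]
    · simp_rw [hNev, hNe _ hpr]
    · exact Continuous.intervalIntegrable
        (((map_continuous _).comp continuous_projIcc).clm_apply continuous_const) _ _
    · exact Continuous.intervalIntegrable
        (((map_continuous _).comp continuous_projIcc).clm_apply continuous_const) _ _

/-- An analytic hyperplane field `ker θ` that is integrable has an analytic first integral. -/
theorem exists_first_integral {θ : E → E →L[ℝ] ℝ} {x₀ e : E} (hθ : AnalyticAt ℝ θ x₀)
    (he : ∀ᶠ x in 𝓝 x₀, θ x e = 1)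
    (hc : ∀ᶠ x in 𝓝 x₀, ∀ a b, θ x a = 0 → θ x b = 0 → fderiv ℝ θ x a b = fderiv ℝ θ x b a) :
    ∃ y : E → ℝ, AnalyticAt ℝ y x₀ ∧ ∀ᶠ x in 𝓝 x₀, ∃ μ : ℝ, μ ≠ 0 ∧ fderiv ℝ y x = μ • θ x := by
  have hU := (hθ.eventually_analyticAt.and (he.eventually_nhds.and hc))
  obtain ⟨ψ, hψa, hψ0, hψ⟩ := exists_path_family hθ e hU
  let ev : C(I, ℝ) →L[ℝ] ℝ := ContinuousMap.evalCLM ℝ (1 : I)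
  have hsub : ∀ x, AnalyticAt ℝ (fun x => x - x₀) x := fun x => analyticAt_id.sub analyticAt_const
  -- Let `X(t) = x₀ + (1 - t) p + s(t) e` with `s = ψ p`. Since `s' = θ(X) p` and `θ(X) e = 1`, the
  -- velocity `-p + s' e` is in `ker θ`: the path follows the leaf of `x = x₀ + p` until it meets
  -- the transversal line at `x₀ + s(1) e`. The number `s(1)` therefore labels the leaf.
  refine ⟨fun x => ev (ψ (x - x₀)), ?_, ?_⟩
  · exact (ev.analyticAt _).comp_of_eq (hψa.comp_of_eq (hsub _) (sub_self x₀)) rfl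
  have ht : Tendsto (fun x => x - x₀) (𝓝 x₀) (𝓝 0) := by
    have := (hsub x₀).continuousAt.tendsto; rwa [sub_self] at this
  filter_upwards [ht.eventually hψ] with x hx
  set p := x - x₀ with hp
  obtain ⟨hxU, hint, hpa, hvar⟩ := hx
  set path := backPath e (p, ψ p) with hpath
  have hUan : ∀ t, AnalyticAt ℝ θ (x₀ + path t) := fun t => (hxU t).1
  have hUe : ∀ t, ∀ᶠ x in 𝓝 (x₀ + path t), θ x e = 1 := fun t => (hxU t).2.1
  have hUc := fun t => (hxU t).2.2
  let pr : ℝ → I := projIcc 0 1 zero_le_one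
  have hpr : Continuous pr := continuous_projIcc
  have hpr' : ∀ t : I, pr t = t := fun t => projIcc_val zero_le_one t
  have hcx : Continuous fun s : ℝ => x₀ + path (pr s) :=
    continuous_const.add ((map_continuous path).comp hpr)
  have hcθ : Continuous fun s : ℝ => θ (x₀ + path (pr s)) :=
    continuous_iff_continuousAt.2 fun s =>
      ContinuousAt.comp (g := θ) (hUan _).continuousAt hcx.continuousAt
  have hcDθ : Continuous fun s : ℝ => fderiv ℝ θ (x₀ + path (pr s)) :=
    continuous_iff_continuousAt.2 fun s =>
      ContinuousAt.comp (g := fderiv ℝ θ) (hUan _).fderiv.continuousAt hcx.continuousAt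
  let k : ℝ → ℝ := fun s => fderiv ℝ θ (x₀ + path (pr s)) e p
  have hk : Continuous k := (hcDθ.clm_apply continuous_const).clm_apply continuous_const
  let K : ℝ → ℝ := fun t => ∫ s in (0 : ℝ)..t, k s
  have hK : ∀ t, HasDerivAt K (k t) t := fun t => hk.integral_hasStrictDerivAt 0 t |>.hasDerivAt
  let S : ℝ → ℝ := fun t => ∫ s in (0 : ℝ)..t, θ (x₀ + path (pr s)) p
  have hS : ∀ t, HasDerivAt S (θ (x₀ + path (pr t)) p) t := fun t =>
    (hcθ.clm_apply continuous_const).integral_hasStrictDerivAt 0 t |>.hasDerivAt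
  have hSψ : ∀ t : I, S t = ψ p t := fun t => (hint t).symm
  let X : ℝ → E := fun t => x₀ + ((1 - t) • p + S t • e)
  have hXI : ∀ t : I, X t = x₀ + path t := fun t => by
    simp [X, hpath, backPath_apply, hSψ]
  have key : ∀ a, fderiv ℝ ψ p a 1 = Real.exp (K 1) * θ x a := by
    intro a
    set δ := fderiv ℝ ψ p a with hδ
    let κ : ℝ → ℝ := fun s => fderiv ℝ θ (x₀ + path (pr s)) (backPath e (a, δ) (pr s)) p +
      θ (x₀ + path (pr s)) a
    have hκ : Continuous κ := by
      refine Continuous.add ?_ (hcθ.clm_apply continuous_const)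
      exact (hcDθ.clm_apply ((map_continuous (backPath e (a, δ))).comp hpr)).clm_apply
        continuous_const
    let Δ : ℝ → ℝ := fun t => ∫ s in (0 : ℝ)..t, κ s
    have hΔ : ∀ t, HasDerivAt Δ (κ t) t := fun t =>
      hκ.integral_hasStrictDerivAt 0 t |>.hasDerivAt
    have hΔδ : ∀ t : I, Δ t = δ t := fun t => (hvar a t).symm
    -- This is `θ` evaluated on the variation `(1 - t) a + δ(t) e` of the path. It starts at `θ x a`
    -- and ends at `δ 1`. Integrability turns the variational equation into `w' = k w`, so the two
    -- values differ by a positive factor independent of `a`.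
    let w : ℝ → ℝ := fun t => Δ t + (1 - t) * θ (X t) a
    have hw : ∀ t : I, HasDerivAt w (k t * w t) t := by
      intro t
      have hX : HasDerivAt X (-p + θ (x₀ + path t) p • e) t := by
        have h1 : HasDerivAt (fun t : ℝ => (1 - t) • p) (-p) t := by
          simpa using ((hasDerivAt_id (t : ℝ)).const_sub 1).smul_const p
        have h2 := (hS t).smul_const e
        rw [hpr' t] at h2
        exact (h1.add h2).const_add x₀
      have hθX : HasFDerivAt θ (fderiv ℝ θ (x₀ + path t)) (X t) := by
        rw [hXI]; exact (hUan t).differentiableAt.hasFDerivAt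
      have h3 := ((hθX.comp_hasDerivAt (t : ℝ) hX).clm_apply (hasDerivAt_const (t : ℝ) a))
      have h4 := ((hasDerivAt_id (t : ℝ)).const_sub 1).mul h3
      have h5 := (hΔ t).add h4
      refine h5.congr_deriv ?_
      simp only [κ, k, w, hpr', hXI, backPath_apply, hΔδ, Function.comp, id]
      set D := fderiv ℝ θ (x₀ + path t)
      set θt := θ (x₀ + path t)
      have hθe : θt e = 1 := (hUe t).self_of_nhds
      have hDe : ∀ v, D v e = 0 := by
        intro v
        have h6 : HasFDerivAt (fun x => θ x e) (D.flip e) (x₀ + path t) :=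
          ((ContinuousLinearMap.apply ℝ ℝ e : (E →L[ℝ] ℝ) →L[ℝ] ℝ).hasFDerivAt).comp _
            (hUan t).differentiableAt.hasFDerivAt
        have h7 : HasFDerivAt (fun x => θ x e) (0 : E →L[ℝ] ℝ) (x₀ + path t) :=
          (hasFDerivAt_const (1 : ℝ) _).congr_of_eventuallyEq (hUe t)
        exact congrArg (fun T => T v) (h6.unique h7)
      -- Subtracting multiples of `e` projects `a` and `p` into `ker θ`, the only place where the
      -- symmetry of the derivative is assumed.
      have hcab := hUc t (a - θt a • e) (p - θt p • e)
        (by simp [θt, hθe] ) (by simp [θt, hθe])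
      simp only [map_sub, map_smul, map_add, map_neg, sub_apply, add_apply, smul_apply,
        neg_apply, smul_eq_mul] at hcab ⊢
      rw [hDe, hDe] at hcab
      simp only [map_zero]

      linear_combination (1 - (t : ℝ)) * hcab - (1 - (t : ℝ)) * θt a * hDe p
    have hc0 : ∀ t ∈ Icc (0 : ℝ) 1, w t * Real.exp (-K t) = w 0 * Real.exp (-K 0) := by
      have hd : ∀ t ∈ Icc (0 : ℝ) 1, HasDerivAt (fun t => w t * Real.exp (-K t)) 0 t := by
        intro t ht
        refine ((hw ⟨t, ht⟩).mul ((hK t).neg.exp)).congr_deriv ?_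
        simp only []
        ring
      exact constant_of_has_deriv_right_zero
        (fun t ht => (hd t ht).continuousAt.continuousWithinAt)
        (fun t ht => (hd t (Ico_subset_Icc_self ht)).hasDerivWithinAt)
    have h1 := hc0 1 (right_mem_Icc.2 zero_le_one)
    have hK0 : K 0 = 0 := by simp [K]
    have hX0 : X 0 = x := by simp [X, S, hp]
    have hw0 : w 0 = θ x a := by simp [w, Δ, hX0]
    have hw1 : w 1 = δ 1 := by
      have := hΔδ 1
      simp only [Icc.coe_one] at this
      simp [w, this]
    rw [hw0, hw1, hK0, neg_zero, Real.exp_zero, mul_one] at h1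
    rw [← h1, mul_comm, mul_assoc, ← Real.exp_add]
    simp
  refine ⟨Real.exp (K 1), (Real.exp_pos _).ne', ?_⟩
  have h1 : HasFDerivAt (fun x => ev (ψ (x - x₀))) (ev ∘L (fderiv ℝ ψ p)) x := by
    have h2 : HasFDerivAt (fun x => x - x₀) (ContinuousLinearMap.id ℝ E) x :=
      (hasFDerivAt_id x).sub_const x₀
    have h3 : HasFDerivAt ψ (fderiv ℝ ψ p) (x - x₀) := hpa.differentiableAt.hasFDerivAt
    exact ev.hasFDerivAt.comp x (h3.comp x h2)
  rw [h1.fderiv]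
  ext a
  exact key a

end FirstIntegral
/-! ## Differential modules of single-input systems -/

/-- The 1-forms of a single-input control system with `n` states, over a ring `R` of functions with
derivation `δ`: `D` is the Lie derivative, `e i` are the differentials of the states, `ε` is the
differential of the control, and `c k` is the coefficient of the differential of the `k`-th
derivative of the control. -/
structure ControlModule (R M : Type*) [CommRing R] [AddCommGroup M] [Module R M] (n : ℕ) where
  δ : R → R
  D : M →+ M
  e : Fin n → M
  ε : M
  c : ℕ → M →ₗ[R] R
  D_smul : ∀ r m, D (r • m) = δ r • m + r • D m
  e_indep : LinearIndependent R e
  c_e : ∀ k i, c k (e i) = 0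
  c_ε : c 0 ε = 1
  c_succ_ε : ∀ k, c (k + 1) ε = 0
  -- Only positive indices get a rule: `c 0 (D m)` also involves `∂f/∂u`, through the derivatives of
  -- the `e i`.
  c_D : ∀ k m, c (k + 1) (D m) = δ (c (k + 1) m) + c k m
  c_fin : ∀ m, ∃ K, ∀ k ≥ K, c k m = 0
  ker : ∀ m, (∀ k, c k m = 0) → m ∈ Submodule.span R (range e)
  -- The control is a linear function of `ẋ`, so its differential belongs to every `D`-stable
  -- submodule that contains those of the states.
  ε_mem : ∀ P : Submodule R M, (∀ m ∈ P, D m ∈ P) → (∀ i, e i ∈ P) → ε ∈ P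

namespace ControlModule

variable {R M : Type*} [CommRing R] [AddCommGroup M] [Module R M] {n : ℕ}
  (C : ControlModule R M n)

/-- The span of `ω, Dω, …, D^{J-1}ω`. -/
def filt (ω : M) (J : ℕ) : Submodule R M := Submodule.span R ((fun j => C.D^[j] ω) '' Iio J)

/-- `ω` generates the module over the polynomials in `D`. -/
def Generates (ω : M) : Prop := ∀ i, ∃ J, C.e i ∈ C.filt ω J

variable {C} {ω η : M}

/-- No additivity of `δ` is assumed; the value is read off by applying `c 0` to `D (0 • ε)`. -/
theorem δ_zero : C.δ 0 = 0 := by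
  have h := congrArg (C.c 0) (C.D_smul 0 C.ε)
  simpa [C.c_ε] using h.symm

theorem filt_mono {J K : ℕ} (h : J ≤ K) : C.filt ω J ≤ C.filt ω K :=
  Submodule.span_mono (image_mono (Iio_subset_Iio h))

theorem iterate_mem_filt {j J : ℕ} (h : j < J) : C.D^[j] ω ∈ C.filt ω J :=
  Submodule.subset_span ⟨j, h, rfl⟩

theorem filt_zero : C.filt ω 0 = ⊥ := by simp [filt]

theorem mem_filt_succ {J : ℕ} {m : M} :
    m ∈ C.filt ω (J + 1) ↔ ∃ a : R, m - a • C.D^[J] ω ∈ C.filt ω J := by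
  have : (fun j => C.D^[j] ω) '' Iio (J + 1) = insert (C.D^[J] ω) ((fun j => C.D^[j] ω) '' Iio J) := by
    rw [Set.Iio_add_one_eq_Iic, ← Iio_insert, image_insert_eq]
  rw [filt, this, Submodule.mem_span_insert']
  constructor
  · rintro ⟨a, h⟩
    exact ⟨-a, by simpa [filt] using h⟩
  · rintro ⟨a, h⟩
    exact ⟨-a, by simpa [filt, sub_eq_add_neg] using h⟩

theorem D_mem_filt {J : ℕ} {m : M} (h : m ∈ C.filt ω J) : C.D m ∈ C.filt ω (J + 1) := by
  induction h using Submodule.span_induction with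
  | mem x hx =>
    obtain ⟨j, hj, rfl⟩ := hx
    simp only
    rw [← Function.iterate_succ_apply' C.D]
    exact iterate_mem_filt (Nat.succ_lt_succ hj)
  | zero => simp
  | add x y _ _ hx hy => rw [map_add]; exact add_mem hx hy
  | smul a x hx' hx =>
    rw [C.D_smul]
    exact add_mem (Submodule.smul_mem _ _ (filt_mono (Nat.le_succ J) hx'))
      (Submodule.smul_mem _ _ hx)

/-- The leading coefficient is unchanged by `D`. -/
theorem iterate_sub_mem_filt {J : ℕ} {m : M} {a : R} (h : m - a • C.D^[J] ω ∈ C.filt ω J) (i : ℕ) :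
    C.D^[i] m - a • C.D^[J + i] ω ∈ C.filt ω (J + i) := by
  induction i with
  | zero => simpa using h
  | succ i ih =>
    have h1 := D_mem_filt ih
    rw [map_sub, C.D_smul, ← Function.iterate_succ_apply' C.D,
      ← Function.iterate_succ_apply' C.D] at h1
    have h2 : C.δ a • C.D^[J + i] ω ∈ C.filt ω (J + i + 1) :=
      Submodule.smul_mem _ _ (iterate_mem_filt (Nat.lt_succ_self _))
    have h3 := add_mem h1 h2
    convert h3 using 1
    rw [Nat.add_succ]
    abel

theorem c_filt_eq_zero {J k : ℕ} (h : ∀ j < J, C.c k (C.D^[j] ω) = 0) {m : M}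
    (hm : m ∈ C.filt ω J) : C.c k m = 0 := by
  have : C.filt ω J ≤ LinearMap.ker (C.c k) := by
    rw [filt, Submodule.span_le]
    rintro _ ⟨j, hj, rfl⟩
    exact h j hj
  exact this hm

theorem c_eq_of_sub_mem {J k : ℕ} (h : ∀ j < J, C.c k (C.D^[j] ω) = 0) {m : M} {a : R}
    (hm : m - a • C.D^[J] ω ∈ C.filt ω J) : C.c k m = a * C.c k (C.D^[J] ω) := by
  have := c_filt_eq_zero h hm
  rw [map_sub, map_smul, smul_eq_mul, sub_eq_zero] at this
  exact this

/-- The leading term of `m` is found by descending the filtration as far as possible, since the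
independence of the `D^j ω` is not available at this stage. -/
theorem exists_leading {m : M} (hm : m ≠ 0) {K : ℕ} (h : m ∈ C.filt ω K) :
    ∃ J < K, ∃ a : R, a ≠ 0 ∧ m - a • C.D^[J] ω ∈ C.filt ω J ∧ m ∈ C.filt ω (J + 1) := by
  induction K with
  | zero => rw [filt_zero] at h; exact absurd (by simpa using h) hm
  | succ K ih =>
    by_cases hK : m ∈ C.filt ω K
    · obtain ⟨J, hJ, r⟩ := ih hK
      exact ⟨J, hJ.trans (Nat.lt_succ_self _), r⟩
    · obtain ⟨a, ha⟩ := mem_filt_succ.1 h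
      refine ⟨K, Nat.lt_succ_self _, a, ?_, ha, h⟩
      rintro rfl
      exact hK (by simpa using ha)

/-- If `m` has order at most `s` in the control, each `D` shifts the top coefficient up by one
index. The `δ` terms act on coefficients that already vanish, so that coefficient is not altered. -/
theorem order_iterate {m : M} {s : ℕ} (h : ∀ l > s, C.c l m = 0) (j : ℕ) :
    C.c (s + j) (C.D^[j] m) = C.c s m ∧ ∀ l > s + j, C.c l (C.D^[j] m) = 0 := by
  induction j with
  | zero => exact ⟨rfl, h⟩
  | succ j ih =>
    rw [Function.iterate_succ_apply']
    refine ⟨?_, fun l hl => ?_⟩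
    · rw [← Nat.add_assoc, C.c_D, ih.2 _ (Nat.lt_succ_self _), ih.1, δ_zero, zero_add]
    · obtain ⟨l, rfl⟩ : ∃ l', l = l' + 1 := ⟨l - 1, by omega⟩
      rw [C.c_D, ih.2 _ (by omega), ih.2 _ (by omega), δ_zero, zero_add]

/-- The union of the filtration is a `D`-stable submodule that contains the `e i`, so `ε_mem`
applies to it. -/
theorem Generates.exists_ε_mem (h : C.Generates ω) : ∃ J, C.ε ∈ C.filt ω J := by
  have hU : ∀ m, m ∈ (⨆ J, C.filt ω J) ↔ ∃ J, m ∈ C.filt ω J := fun m =>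
    Submodule.mem_iSup_of_directed _ (directed_of_isDirected_le fun _ _ => filt_mono)
  refine (hU _).1 (C.ε_mem _ (fun m hm => ?_) fun i => (hU _).2 (h i))
  obtain ⟨J, hJ⟩ := (hU m).1 hm
  exact (hU _).2 ⟨_, D_mem_filt hJ⟩

/-- Modulo `filt ω J`, `D^J (a ω)` equals `a D^J ω`; dividing by `a` recovers the `D^J ω` one after
the other. -/
theorem Generates.of_smul {a : R} (ha : IsUnit a) (hω : C.Generates ω) : C.Generates (a • ω) := by
  have key : ∀ J, C.filt ω J ≤ C.filt (a • ω) J := by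
    intro J
    induction J with
    | zero => rw [filt_zero]; exact bot_le
    | succ J ih =>
      intro m hm
      obtain ⟨r, hr⟩ := mem_filt_succ.1 hm
      have h1 : (a • ω) - a • C.D^[0] ω ∈ C.filt ω 0 := by simp
      have h2 := iterate_sub_mem_filt h1 J
      rw [zero_add] at h2
      obtain ⟨u, rfl⟩ := ha
      refine mem_filt_succ.2 ⟨r * (u⁻¹ : Rˣ), ?_⟩
      have h3 := sub_mem (ih hr) (Submodule.smul_mem _ (r * (u⁻¹ : Rˣ)) (ih h2))
      convert h3 using 1
      rw [smul_sub, smul_smul, mul_assoc, Units.inv_mul, mul_one]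
      abel
  intro i
  obtain ⟨J, hJ⟩ := hω i
  exact ⟨J, key J hJ⟩

variable [IsDomain R]

/-- Suppose `du⁽ˢ⁾` were the highest differential of the control in `ω`, with coefficient `b ≠ 0`. A
state differential with leading term `a D^J ω` would then contain `a b du⁽ˢ⁺ᴶ⁾`, which no lower term
can cancel, whereas state differentials contain no control. In a domain `a b ≠ 0`, a contradiction.
-/
theorem Generates.c_eq_zero (hn : 0 < n) (h : C.Generates ω) (k : ℕ) : C.c k ω = 0 := by
  by_contra hk
  obtain ⟨K, hK⟩ := C.c_fin ω
  obtain ⟨s, hs, hs'⟩ : ∃ s, C.c s ω ≠ 0 ∧ ∀ l > s, C.c l ω = 0 := by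
    classical
    refine ⟨Nat.findGreatest (fun s => C.c s ω ≠ 0) K, ?_, fun l hl => ?_⟩
    · refine Nat.findGreatest_spec (P := fun s => C.c s ω ≠ 0) (m := k) ?_ hk
      by_contra hlt
      exact hk (hK k (by omega))
    · by_contra hl'
      have : l ≤ K := by
        by_contra hlt
        exact hl' (hK l (by omega))
      exact absurd (Nat.le_findGreatest (P := fun s => C.c s ω ≠ 0) this hl') (by omega)
  obtain ⟨J, hJ⟩ := h ⟨0, hn⟩
  obtain ⟨J, -, a, ha, hm, -⟩ := exists_leading (C.e_indep.ne_zero _) hJ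
  have h1 := c_eq_of_sub_mem (k := s + J)
    (fun j hj => (order_iterate hs' j).2 _ (by omega)) hm
  rw [C.c_e, (order_iterate hs' J).1] at h1
  exact mul_ne_zero ha hs h1.symm

/-- Here `r` is the first derivative of `ω` in which the control appears; there is one because `ε`
is a combination of derivatives of `ω`. From then on `D^{r+i} ω` has order exactly `i`, always with
the top coefficient `b = c 0 (D^r ω)`. Comparison of orders shows that `ε`, of order `0`, uses
nothing beyond `D^r ω`, whence `1 = a b`, and that the `e i`, free of the control, use only the
derivatives before `D^r ω`. -/
theorem Generates.structure_aux (hn : 0 < n) (h : C.Generates ω) :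
    ∃ r, (∀ j < r, ∀ l, C.c l (C.D^[j] ω) = 0) ∧ IsUnit (C.c 0 (C.D^[r] ω)) ∧
      (∀ l > 0, C.c l (C.D^[r] ω) = 0) ∧ ∀ i, C.e i ∈ C.filt ω r := by
  classical
  obtain ⟨Jε, hJε⟩ := h.exists_ε_mem
  have hex : ∃ r, ∃ l, C.c l (C.D^[r] ω) ≠ 0 := by
    by_contra hno
    push Not at hno
    have := c_filt_eq_zero (k := 0) (fun j _ => hno j 0) hJε
    rw [C.c_ε] at this
    exact one_ne_zero this
  obtain ⟨r, hr, hlt⟩ : ∃ r, (∃ l, C.c l (C.D^[r] ω) ≠ 0) ∧ ∀ j < r, ∀ l, C.c l (C.D^[j] ω) = 0 :=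
    ⟨Nat.find hex, Nat.find_spec hex, fun j hj l => by
      have := Nat.find_min hex hj
      push Not at this
      exact this l⟩
  have hhigh : ∀ l > 0, C.c l (C.D^[r] ω) = 0 := by
    intro l hl
    obtain ⟨l, rfl⟩ : ∃ l', l = l' + 1 := ⟨l - 1, by omega⟩
    cases r with
    | zero => exact h.c_eq_zero hn _
    | succ r =>
      rw [Function.iterate_succ_apply', C.c_D, hlt r (Nat.lt_succ_self _),
        hlt r (Nat.lt_succ_self _), δ_zero, zero_add]
  have hb : C.c 0 (C.D^[r] ω) ≠ 0 := by
    obtain ⟨l, hl⟩ := hr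
    rcases Nat.eq_zero_or_pos l with rfl | h0
    · exact hl
    · exact absurd (hhigh l h0) hl
  have hord : ∀ i, C.c i (C.D^[r + i] ω) = C.c 0 (C.D^[r] ω) ∧
      ∀ l > i, C.c l (C.D^[r + i] ω) = 0 := by
    intro i
    have := order_iterate hhigh i
    rw [zero_add, ← Function.iterate_add_apply, Nat.add_comm i r] at this
    exact this
  have htop : ∀ {m : M} {a : R} {i : ℕ}, m - a • C.D^[r + i] ω ∈ C.filt ω (r + i) →
      C.c i m = a * C.c 0 (C.D^[r] ω) := by
    intro m a i hm
    rw [c_eq_of_sub_mem (k := i) ?_ hm, (hord i).1]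
    intro j hj
    rcases lt_or_ge j r with hjr | hjr
    · exact hlt j hjr i
    · obtain ⟨j, rfl⟩ := Nat.exists_eq_add_of_le hjr
      exact (hord j).2 i (by omega)
  refine ⟨r, hlt, ?_, hhigh, fun i => ?_⟩
  · have hε0 : C.ε ≠ 0 := by
      intro h0
      have := C.c_ε
      rw [h0, map_zero] at this
      exact zero_ne_one this
    obtain ⟨J, -, a, ha, hm, hm'⟩ := exists_leading hε0 hJε
    have hJr : C.ε ∈ C.filt ω (r + 1) := by
      rcases le_or_gt J r with hJ | hJ
      · exact filt_mono (by omega) hm'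
      · obtain ⟨i, rfl⟩ := Nat.exists_eq_add_of_lt hJ
        have h1 := htop (i := i + 1) hm
        rw [C.c_succ_ε] at h1
        exact absurd h1.symm (mul_ne_zero ha hb)
    obtain ⟨a, ha⟩ := mem_filt_succ.1 hJr
    have h1 := htop (i := 0) ha
    rw [C.c_ε] at h1
    exact IsUnit.of_mul_eq_one a (by rw [mul_comm]; exact h1.symm)
  · obtain ⟨J, hJ⟩ := h i
    obtain ⟨J, -, a, ha, hm, hm'⟩ := exists_leading (C.e_indep.ne_zero i) hJ
    rcases lt_or_ge J r with hJr | hJr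
    · exact filt_mono (by omega) hm'
    · obtain ⟨k, rfl⟩ := Nat.exists_eq_add_of_le hJr
      have h1 := htop hm
      rw [C.c_e] at h1
      exact absurd h1.symm (mul_ne_zero ha hb)

/-- The structure of a generator: `ω, …, D^{n-1}ω` is a basis of the span of the differentials of
the states, and the coefficient of the differential of the control in `D^n ω` is invertible. -/
theorem Generates.structure (hn : 0 < n) (h : C.Generates ω) :
    (∀ j < n, ∀ l, C.c l (C.D^[j] ω) = 0) ∧ IsUnit (C.c 0 (C.D^[n] ω)) ∧
      (∀ l > 0, C.c l (C.D^[n] ω) = 0) ∧ ∀ i, C.e i ∈ C.filt ω n := by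
  obtain ⟨r, hlt, hb, hhigh, he⟩ := h.structure_aux hn
  -- Rank count: the first `r` derivatives of `ω` and the `n` state differentials are two
  -- independent families, each in the span of the other.
  suffices r = n by subst this; exact ⟨hlt, hb, hhigh, he⟩
  have hfr : C.filt ω r = Submodule.span R (range fun j : Fin r => C.D^[j] ω) := by
    rw [filt]
    congr 1
    ext m
    constructor
    · rintro ⟨j, hj, rfl⟩; exact ⟨⟨j, hj⟩, rfl⟩
    · rintro ⟨j, rfl⟩; exact ⟨j, j.2, rfl⟩
  have hind : LinearIndependent R fun j : Fin r => C.D^[j] ω := by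
    rw [Fintype.linearIndependent_iff]
    intro g hg
    by_contra hne
    push Not at hne
    obtain ⟨i₀, hi₀⟩ := hne
    classical
    obtain ⟨i, hi, hmax⟩ := Finset.exists_max_image (Finset.univ.filter fun i => g i ≠ 0) id
      ⟨i₀, by simp [hi₀]⟩
    have hgi : g i ≠ 0 := by simpa using hi
    have hmem : (0 : M) - g i • C.D^[i] ω ∈ C.filt ω i := by
      rw [← hg, ← Finset.add_sum_erase _ _ (Finset.mem_univ i), add_sub_cancel_left]
      refine Submodule.sum_mem _ fun j hj => ?_
      by_cases hgj : g j = 0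
      · simp [hgj]
      · refine Submodule.smul_mem _ _ (iterate_mem_filt ?_)
        have h1 : j ≤ i := hmax j (by simp [hgj])
        exact lt_of_le_of_ne h1 (fun h => (Finset.ne_of_mem_erase hj) (Fin.ext h))
    -- Differentiating the relation `r - i` times moves its top term to `D^r ω`, the first
    -- derivative that sees the control, and leaves the leading coefficient unchanged.
    have h1 := iterate_sub_mem_filt hmem (r - i)
    rw [Nat.add_sub_cancel' i.2.le] at h1
    have h2 := c_eq_of_sub_mem (k := 0) (fun j hj => hlt j hj 0) h1
    have h3 : C.D^[r - i] (0 : M) = 0 := Function.iterate_fixed (map_zero C.D) _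
    rw [h3, map_zero] at h2
    exact mul_ne_zero hgi hb.ne_zero h2.symm
  classical
  apply le_antisymm
  · have := linearIndependent_le_span' _ hind (range C.e) (by
      rintro _ ⟨j, rfl⟩
      exact C.ker _ (hlt j j.2))
    have := this.trans (Nat.cast_le.2 (Fintype.card_range_le C.e))
    simpa using this
  · have := linearIndependent_le_span' _ C.e_indep (range fun j : Fin r => C.D^[j] ω) (by
      rintro _ ⟨i, rfl⟩
      simp only [SetLike.mem_coe]
      rw [← hfr]
      exact he i)
    have := this.trans (Nat.cast_le.2 (Fintype.card_range_le fun j : Fin r => C.D^[j] ω))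
    simpa using this

theorem Generates.mem_filt (hn : 0 < n) (h : C.Generates ω) {m : M} (hm : ∀ k, C.c k m = 0) :
    m ∈ C.filt ω n := by
  have : Submodule.span R (range C.e) ≤ C.filt ω n := by
    rw [Submodule.span_le]
    rintro _ ⟨i, rfl⟩
    exact (h.structure hn).2.2.2 i
  exact this (C.ker m hm)

/-- Torsion would propagate: `a ω = 0` gives `a D^n ω ∈ filt ω n`, where the coefficient of the
control vanishes, while that of `D^n ω` is invertible. -/
theorem Generates.eq_zero_of_smul (hn : 0 < n) (h : C.Generates ω) {a : R} (ha : a • ω = 0) :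
    a = 0 := by
  have h1 : (0 : M) - a • C.D^[0] ω ∈ C.filt ω 0 := by simp [ha]
  have h2 := iterate_sub_mem_filt h1 n
  rw [zero_add] at h2
  have h3 := c_eq_of_sub_mem (k := 0) (fun j hj => (h.structure hn).1 j hj 0) h2
  rw [Function.iterate_fixed (map_zero C.D), map_zero] at h3
  exact (mul_eq_zero.1 h3.symm).resolve_right (h.structure hn).2.1.ne_zero

/-- `η` is a combination of `ω, …, D^{n-1} ω`. If its leading derivative were `D^J ω` with `J > 0`,
the control would appear already in `D^{n-J} η`, too early for a generator. -/
theorem Generates.exists_eq_smul (hn : 0 < n) (hω : C.Generates ω) (hη : C.Generates η) :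
    ∃ a : R, η = a • ω := by
  have hη0 : η ≠ 0 := by
    rintro rfl
    exact one_ne_zero (hη.eq_zero_of_smul hn (a := 1) (by simp))
  obtain ⟨J, hJ, a, ha, hm, -⟩ := exists_leading hη0 (hω.mem_filt hn (hη.c_eq_zero hn))
  rcases Nat.eq_zero_or_pos J with rfl | hJ0
  · rw [filt_zero, Submodule.mem_bot, sub_eq_zero] at hm
    exact ⟨a, hm⟩
  · exfalso
    have h1 := iterate_sub_mem_filt hm (n - J)
    rw [Nat.add_sub_cancel' hJ.le] at h1
    have h2 := c_eq_of_sub_mem (k := 0) (fun j hj => (hω.structure hn).1 j hj 0) h1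
    rw [(hη.structure hn).1 _ (by omega)] at h2
    exact mul_ne_zero ha (hω.structure hn).2.1.ne_zero h2.symm

/-- Two generators differ by an invertible function. -/
theorem Generates.exists_eq_unit_smul (hn : 0 < n) (hω : C.Generates ω) (hη : C.Generates η) :
    ∃ a : R, IsUnit a ∧ η = a • ω := by
  obtain ⟨a, ha⟩ := hω.exists_eq_smul hn hη
  obtain ⟨b, hb⟩ := hη.exists_eq_smul hn hω
  refine ⟨a, IsUnit.of_mul_eq_one b ?_, ha⟩
  have : (1 - b * a) • ω = 0 := by rw [sub_smul, one_smul, mul_smul, ← ha, ← hb, sub_self]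
  have := hω.eq_zero_of_smul hn this
  rw [mul_comm]
  exact (sub_eq_zero.1 this).symm

end ControlModule
/-! ## Finite dependence of continuous linear maps on sequence spaces -/

section Sequences

variable {V : Type*} [AddCommGroup V] [Module ℝ V] [TopologicalSpace V]
variable {F : Type*} [NormedAddCommGroup F] [NormedSpace ℝ F]

/-- A neighborhood of `0` in the product topology restricts only finitely many coordinates. On the
subspace where these vanish `L` is bounded, hence zero. -/
theorem exists_finite_dependence (L : (ℕ → V) →L[ℝ] F) :
    ∃ r : ℕ, ∀ v : ℕ → V, (∀ k < r, v k = 0) → L v = 0 := by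
  have h1 : L ⁻¹' Metric.ball 0 1 ∈ 𝓝 (0 : ℕ → V) :=
    L.continuous.continuousAt.preimage_mem_nhds (by
      rw [map_zero]; exact Metric.ball_mem_nhds _ one_pos)
  rw [nhds_pi, Filter.mem_pi] at h1
  obtain ⟨I, hI, t, ht, hsub⟩ := h1
  obtain ⟨r, hr⟩ := hI.bddAbove
  refine ⟨r + 1, fun v hv => ?_⟩
  have hball : ∀ c : ℝ, ‖L (c • v)‖ < 1 := by
    intro c
    have : c • v ∈ I.pi t := by
      intro k hk
      have : (c • v) k = 0 := by
        rw [Pi.smul_apply, hv k (Nat.lt_succ_of_le (hr hk)), smul_zero]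
      rw [this]
      exact mem_of_mem_nhds (ht k)
    simpa using hsub this
  by_contra hne
  have h2 := hball (‖L v‖⁻¹)
  rw [map_smul, norm_smul, norm_inv, norm_norm, inv_mul_cancel₀ (norm_ne_zero_iff.2 hne)] at h2
  exact lt_irrefl _ h2

/-- Extension of a finite sequence by `0`. -/
def extendL (V : Type*) [AddCommGroup V] [Module ℝ V] [TopologicalSpace V] (r : ℕ) :
    (Fin r → V) →L[ℝ] (ℕ → V) :=
  ContinuousLinearMap.pi fun k => if h : k < r then ContinuousLinearMap.proj ⟨k, h⟩ else 0

theorem extendL_apply_lt (r : ℕ) (v : Fin r → V) {k : ℕ} (h : k < r) :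
    extendL V r v k = v ⟨k, h⟩ := by simp [extendL, h]

/-- The shift of sequences. -/
def shiftL (V : Type*) [AddCommGroup V] [Module ℝ V] [TopologicalSpace V] :
    (ℕ → V) →L[ℝ] (ℕ → V) :=
  ContinuousLinearMap.pi fun k => ContinuousLinearMap.proj (k + 1)

@[simp] theorem shiftL_apply (v : ℕ → V) (k : ℕ) : shiftL V v k = v (k + 1) := rfl

theorem exists_factor_trunc [IsTopologicalAddGroup V] (L : (ℕ → V) →L[ℝ] F) :
    ∃ (r : ℕ) (L' : (Fin r → V) →L[ℝ] F), ∀ v, L v = L' (fun k => v k) := by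
  obtain ⟨r, hr⟩ := exists_finite_dependence L
  refine ⟨r, L.comp (extendL V r), fun v => ?_⟩
  rw [← sub_eq_zero, ContinuousLinearMap.comp_apply, ← map_sub]
  refine hr _ fun k hk => ?_
  rw [Pi.sub_apply, extendL_apply_lt r _ hk, sub_self]

end Sequences

/-! ## Analytic functions on jet spaces -/

section Jets

/-- The truncation of jets as a continuous linear map. -/
def truncL (n r : ℕ) : Jet n →L[ℝ] (Fin r → Fin n → ℝ) :=
  ContinuousLinearMap.pi fun k => ContinuousLinearMap.proj (k : ℕ)

/-- The truncations in the definition of analyticity may be replaced by arbitrary continuous linear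
maps to normed spaces, because these factor through truncations. The second form also makes sense on
the chart `(x, u, u̇, …)`, where most of the calculus takes place. -/
theorem jetAnalyticOn_iff {n : ℕ} {N : Set (Jet n)} {f : Jet n → ℝ} :
    JetAnalyticOn N f ↔ CylAnOn N f := by
  constructor
  · rintro ⟨r, g, hg, e⟩
    exact ⟨Fin r → Fin n → ℝ, _, _, truncL n r, g, hg, e⟩
  · rintro ⟨F, _, _, L, g, hg, e⟩
    obtain ⟨r, L', hL⟩ := exists_factor_trunc L
    refine ⟨r, g ∘ L', ?_, fun x hx => by rw [e x hx, hL]; rfl⟩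
    rintro _ ⟨x, hx, rfl⟩
    exact AnalyticAt.comp (hg _ ⟨x, hx, hL x⟩) (L'.analyticAt _)

variable {E : Type*} [AddCommGroup E] [Module ℝ E] [TopologicalSpace E] {n : ℕ} {W : Set E}
  {Φ : E → Jet n}

theorem cylMapOn_jet (h : ∀ k i, CylAnOn W (fun x => Φ x k i)) : CylMapOn W Φ := by
  intro F _ _ L
  obtain ⟨r, L', hL⟩ := exists_factor_trunc L
  have h1 : CylAnOn W (fun x (k : Fin r) (i : Fin n) => Φ x k i) :=
    CylAnOn.pi fun k => CylAnOn.pi fun i => h k i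
  exact (h1.clm_comp L').congr fun x _ => hL _

theorem CylMapOn.apply {Φ : E → Jet n} (h : CylMapOn W Φ) (k : ℕ) (i : Fin n) :
    CylAnOn W (fun x => Φ x k i) :=
  h ℝ ((ContinuousLinearMap.proj i : (Fin n → ℝ) →L[ℝ] ℝ).comp
    (ContinuousLinearMap.proj k : Jet n →L[ℝ] (Fin n → ℝ)))

theorem hasCylDeriv_jet {w : Jet n} {x v : E}
    (h : ∀ k i, HasLineDerivAt ℝ (fun x => Φ x k i) (w k i) x v) : HasCylDeriv Φ w x v := by
  intro F _ _ L
  obtain ⟨r, L', hL⟩ := exists_factor_trunc L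
  have h1 : HasDerivAt (fun (t : ℝ) (k : Fin r) (i : Fin n) => Φ (x + t • v) k i)
      (fun (k : Fin r) (i : Fin n) => w k i) 0 :=
    hasDerivAt_pi.2 fun k => hasDerivAt_pi.2 fun i => h k i
  have h2 := L'.hasFDerivAt.comp_hasDerivAt (0 : ℝ) h1
  rw [HasLineDerivAt, hL]
  simp_rw [hL]
  exact h2

theorem cylMapOn_cartanField (N : Set (Jet n)) : CylMapOn N (cartanField (n := n)) :=
  CylMapOn.of_clm N (shiftL (Fin n → ℝ))

end Jets

/-! ## Lie derivatives of functions and prolongations -/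

section Lie

variable {E : Type*} [AddCommGroup E] [Module ℝ E] [TopologicalSpace E]
variable {n : ℕ} {W : Set E} {X : E → E}

/-- The Lie derivative of a function along the field `X`. -/
def lieD (X : E → E) (h : E → ℝ) : E → ℝ := fun x => lineDeriv ℝ h x (X x)

theorem ddt_eq_lieD : (ddt : (Jet n → ℝ) → _) = lieD cartanField := rfl

/-- The prolongation of `φ` along the field `X`: the jet of derivatives of `φ`. -/
def prolong (X : E → E) (φ : E → Fin n → ℝ) : E → Jet n :=
  fun x k i => (lieD X)^[k] (fun z => φ z i) x

theorem lieD_prolong (X : E → E) (φ : E → Fin n → ℝ) (x : E) (k : ℕ) (i : Fin n) :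
    lieD X (fun z => prolong X φ z k i) x = prolong X φ x (k + 1) i := by
  simp only [prolong, Function.iterate_succ_apply']

variable [IsTopologicalAddGroup E] [ContinuousSMul ℝ E]

theorem lieD_congr (hW : IsOpen W) {h k : E → ℝ} (e : EqOn h k W) :
    EqOn (lieD X h) (lieD X k) W := fun _ hx =>
  lineDeriv_congr_nhds (eventually_of_mem (hW.mem_nhds hx) e) _

theorem iterate_lieD_congr (hW : IsOpen W) {h k : E → ℝ} (e : EqOn h k W) (j : ℕ) :
    EqOn ((lieD X)^[j] h) ((lieD X)^[j] k) W := by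
  induction j with
  | zero => exact e
  | succ j ih =>
    rw [Function.iterate_succ_apply', Function.iterate_succ_apply']
    exact lieD_congr hW ih

theorem CylAnOn.lieD (hW : IsOpen W) (hX : CylMapOn W X) {h : E → ℝ} (hh : CylAnOn W h) :
    CylAnOn W (lieD X h) := hh.lineDeriv_field hW hX

theorem CylAnOn.iterate_lieD (hW : IsOpen W) (hX : CylMapOn W X) {h : E → ℝ} (hh : CylAnOn W h)
    (j : ℕ) : CylAnOn W ((Flatness.lieD X)^[j] h) := by
  induction j with
  | zero => exact hh
  | succ j ih => rw [Function.iterate_succ_apply']; exact ih.lieD hW hX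

theorem cylMapOn_prolong (hW : IsOpen W) (hX : CylMapOn W X) {φ : E → Fin n → ℝ}
    (hφ : ∀ i, CylAnOn W (fun z => φ z i)) : CylMapOn W (prolong X φ) :=
  cylMapOn_jet fun k i => (hφ i).iterate_lieD hW hX k

/-- `Φ` maps the field `X` to the Cartan field at the points of `W`. -/
def RelatedOn (W : Set E) (X : E → E) (Φ : E → Jet n) : Prop :=
  ∀ x ∈ W, ∀ k i, lieD X (fun z => Φ z k i) x = Φ x (k + 1) i

theorem RelatedOn.apply_eq (hW : IsOpen W) {Φ : E → Jet n} (hΦ : RelatedOn W X Φ) (k : ℕ)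
    (i : Fin n) : EqOn (fun x => Φ x k i) ((lieD X)^[k] fun z => Φ z 0 i) W := by
  induction k with
  | zero => exact fun _ _ => rfl
  | succ k ih =>
    rw [Function.iterate_succ_apply']
    intro x hx
    exact (hΦ x hx k i).symm.trans (lieD_congr hW ih hx)

theorem relatedOn_prolong (W : Set E) (X : E → E) (φ : E → Fin n → ℝ) :
    RelatedOn W X (prolong X φ) := fun x _ k i => lieD_prolong X φ x k i

/-- The derivative of a map to a jet space. -/
def jetDeriv (Φ : E → Jet n) (x v : E) : Jet n := fun k i => lineDeriv ℝ (fun z => Φ z k i) x v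

theorem hasCylDeriv_jetDeriv (hW : IsOpen W) {Φ : E → Jet n} (hΦ : CylMapOn W Φ) {x : E}
    (hx : x ∈ W) (v : E) : HasCylDeriv Φ (jetDeriv Φ x v) x v :=
  hasCylDeriv_jet fun k i => (hΦ.apply k i).hasLineDerivAt hW hx v

theorem lineDeriv_comp_jet (hW : IsOpen W) {Φ : E → Jet n} (hΦ : CylMapOn W Φ) {N : Set (Jet n)}
    (hN : IsOpen N) (hm : MapsTo Φ W N) {h : Jet n → ℝ} (hh : CylAnOn N h) {x : E} (hx : x ∈ W)
    (v : E) : lineDeriv ℝ (fun z => h (Φ z)) x v = lineDeriv ℝ h (Φ x) (jetDeriv Φ x v) :=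
  (hh.hasLineDerivAt_comp_map hN (hasCylDeriv_jetDeriv hW hΦ hx v)
    (eventually_of_mem (hW.mem_nhds hx) hm)).lineDeriv

theorem RelatedOn.lieD_comp (hW : IsOpen W) {Φ : E → Jet n} (hΦ : CylMapOn W Φ)
    (hr : RelatedOn W X Φ) {N : Set (Jet n)} (hN : IsOpen N) (hm : MapsTo Φ W N) {h : Jet n → ℝ}
    (hh : CylAnOn N h) {x : E} (hx : x ∈ W) : lieD X (fun z => h (Φ z)) x = ddt h (Φ x) := by
  have : jetDeriv Φ x (X x) = cartanField (Φ x) := by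
    funext k i; exact hr x hx k i
  rw [lieD, lineDeriv_comp_jet hW hΦ hN hm hh hx, this]
  rfl

theorem RelatedOn.iterate_lieD_comp (hW : IsOpen W) {Φ : E → Jet n} (hΦ : CylMapOn W Φ)
    (hr : RelatedOn W X Φ) {N : Set (Jet n)} (hN : IsOpen N) (hm : MapsTo Φ W N) {h : Jet n → ℝ}
    (hh : CylAnOn N h) (j : ℕ) {x : E} (hx : x ∈ W) :
    (lieD X)^[j] (fun z => h (Φ z)) x = (ddt^[j] h) (Φ x) := by
  induction j generalizing x with
  | zero => rfl
  | succ j ih =>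
    rw [Function.iterate_succ_apply', Function.iterate_succ_apply']
    have h1 : CylAnOn N (ddt^[j] h) := by
      rw [ddt_eq_lieD]
      exact hh.iterate_lieD hN (cylMapOn_cartanField N) j
    rw [← hr.lieD_comp hW hΦ hN hm h1 hx]
    exact lieD_congr hW (fun z hz => ih hz) hx

end Lie

/-! ## Local explicit form of a single-input implicit system -/

/-- The kernel of `A` is a line, and `ℓ` is a coordinate that does not vanish on it. The value
`ℓ(ẋ)` will serve as control. -/
theorem exists_transverse_functional {n : ℕ} (hn : 1 ≤ n)
    (A : (Fin n → ℝ) →L[ℝ] (Fin (n - 1) → ℝ))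
    (hA : (Matrix.of fun i j => A (Pi.single j 1) i).rank = n - 1) :
    ∃ ℓ : (Fin n → ℝ) →L[ℝ] ℝ, ∀ v, A v = 0 → ℓ v = 0 → v = 0 := by
  have hM : LinearMap.toMatrix' (A : (Fin n → ℝ) →ₗ[ℝ] (Fin (n - 1) → ℝ)) =
      Matrix.of fun i j => A (Pi.single j 1) i := by
    ext i j
    simp [LinearMap.toMatrix'_apply]
  have hr : Module.finrank ℝ (LinearMap.range (A : (Fin n → ℝ) →ₗ[ℝ] (Fin (n - 1) → ℝ))) = n - 1 := by
    refine Eq.trans ?_ hA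
    rw [← hM, Matrix.rank, ← Matrix.toLin'_apply', Matrix.toLin'_toMatrix']
  have hk := LinearMap.finrank_range_add_finrank_ker
    (A : (Fin n → ℝ) →ₗ[ℝ] (Fin (n - 1) → ℝ))
  rw [hr, Module.finrank_fin_fun] at hk
  have hk1 : Module.finrank ℝ
      (LinearMap.ker (A : (Fin n → ℝ) →ₗ[ℝ] (Fin (n - 1) → ℝ))) = 1 := by omega
  obtain ⟨⟨v₀, hv₀⟩, hne, hspan⟩ := finrank_eq_one_iff'.1 hk1
  have hv0 : v₀ ≠ 0 := fun h => hne (by ext1; exact h)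
  obtain ⟨i, hi⟩ := Function.ne_iff.1 hv0
  refine ⟨ContinuousLinearMap.proj i, fun v hv hl => ?_⟩
  obtain ⟨c, hc⟩ := hspan ⟨v, hv⟩
  have hc' : c • v₀ = v := congrArg Subtype.val hc
  have : c * v₀ i = 0 := by rw [← hc'] at hl; exact hl
  rw [← hc', (mul_eq_zero.1 this).resolve_right hi, zero_smul]

/-- The equation `F(x, ẋ) = 0` near `a`, solved as `ẋ = f(x, u)` with `u = ℓ(ẋ)`. -/
structure LocalForm {n : ℕ} (S : ImplicitSystem n 1) (a : (Fin n → ℝ) × (Fin n → ℝ)) where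
  ℓ : (Fin n → ℝ) →L[ℝ] ℝ
  f : (Fin n → ℝ) × ℝ → Fin n → ℝ
  O : Set ((Fin n → ℝ) × ℝ)
  O₂ : Set ((Fin n → ℝ) × (Fin n → ℝ))
  isOpen_O : IsOpen O
  mem_O : (a.1, ℓ a.2) ∈ O
  isOpen_O₂ : IsOpen O₂
  mem_O₂ : a ∈ O₂
  subset_dom : O₂ ⊆ S.dom
  analytic : AnalyticOnNhd ℝ f O
  f_base : f (a.1, ℓ a.2) = a.2
  graph : ∀ p ∈ O, (p.1, f p) ∈ O₂ ∧ S.F (p.1, f p) = 0 ∧ ℓ (f p) = p.2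
  unique : ∀ q ∈ O₂, S.F q = 0 → (q.1, ℓ q.2) ∈ O ∧ f (q.1, ℓ q.2) = q.2
  inj : ∀ q ∈ O₂, ∀ v, fderiv ℝ S.F q (0, v) = 0 → ℓ v = 0 → v = 0

/-- Implicit function theorem for `((x, u), w) ↦ (F(x, w), ℓ w - u)`, whose partial derivative in
`w` is the isomorphism `(∂F/∂ẋ, ℓ)`. Invertibility is an open condition, so injectivity persists on
a neighborhood of `a`. -/
theorem exists_localForm {n : ℕ} (S : ImplicitSystem n 1) {a : (Fin n → ℝ) × (Fin n → ℝ)}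
    (ha : a ∈ S.dom) (hF : S.F a = 0) : Nonempty (LocalForm S a) := by
  set Fw : (Fin n → ℝ) × (Fin n → ℝ) → (Fin n → ℝ) →L[ℝ] (Fin (n - 1) → ℝ) :=
    fun q => fderiv ℝ S.F q ∘L .inr ℝ _ _ with hFw
  obtain ⟨ℓ, hℓ⟩ := exists_transverse_functional S.le (Fw a) (by
    have := S.regular a ha
    simpa [hFw] using this)
  let T : (Fin n → ℝ) × (Fin n → ℝ) → (Fin n → ℝ) →L[ℝ] (Fin (n - 1) → ℝ) × ℝ :=
    fun q => (Fw q).prod ℓ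
  have hTinj : Function.Injective (T a) := by
    rw [injective_iff_map_eq_zero]
    intro v hv
    exact hℓ v (congrArg Prod.fst hv) (congrArg Prod.snd hv)
  have hfr : Module.finrank ℝ (Fin n → ℝ) = Module.finrank ℝ ((Fin (n - 1) → ℝ) × ℝ) := by
    have := S.le
    simp; omega
  let e : (Fin n → ℝ) ≃L[ℝ] (Fin (n - 1) → ℝ) × ℝ :=
    (LinearEquiv.ofInjectiveOfFinrankEq (T a : (Fin n → ℝ) →ₗ[ℝ] (Fin (n - 1) → ℝ) × ℝ)
      hTinj hfr).toContinuousLinearEquiv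
  have he : (e : (Fin n → ℝ) →L[ℝ] (Fin (n - 1) → ℝ) × ℝ) = T a := by
    ext v <;> rfl
  let G : ((Fin n → ℝ) × ℝ) × (Fin n → ℝ) → (Fin (n - 1) → ℝ) × ℝ :=
    fun z => (S.F (z.1.1, z.2), ℓ z.2 - z.1.2)
  let b : ((Fin n → ℝ) × ℝ) × (Fin n → ℝ) := ((a.1, ℓ a.2), a.2)
  have hGb : G b = 0 := by
    change (S.F a, ℓ a.2 - ℓ a.2) = 0
    rw [hF, sub_self]; rfl
  have hFa := S.analytic a ha
  have hG : AnalyticAt ℝ G b := by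
    refine AnalyticAt.prod ?_ ?_
    · refine AnalyticAt.comp_of_eq (g := S.F) (y := a) hFa ?_ rfl
      exact (analyticAt_fst.comp analyticAt_fst).prod analyticAt_snd
    · exact ((ℓ.analyticAt _).comp analyticAt_snd).sub (analyticAt_snd.comp analyticAt_fst)
  have hGd : fderiv ℝ G b ∘L .inr ℝ ((Fin n → ℝ) × ℝ) (Fin n → ℝ) = T a := by
    have h1 : HasFDerivAt (fun w : Fin n → ℝ => ((a.1, ℓ a.2), w))
        (ContinuousLinearMap.inr ℝ ((Fin n → ℝ) × ℝ) (Fin n → ℝ)) a.2 :=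
      (hasFDerivAt_const _ _).prodMk (hasFDerivAt_id _)
    have h2 := HasFDerivAt.comp (g := G) a.2 hG.differentiableAt.hasFDerivAt h1
    refine h2.unique ?_
    have h3 : HasFDerivAt (fun w : Fin n → ℝ => (a.1, w))
        (ContinuousLinearMap.inr ℝ (Fin n → ℝ) (Fin n → ℝ)) a.2 :=
      (hasFDerivAt_const _ _).prodMk (hasFDerivAt_id _)
    have h4 : HasFDerivAt (fun w : Fin n → ℝ => S.F (a.1, w)) (Fw a) a.2 :=
      HasFDerivAt.comp (g := S.F) a.2 hFa.differentiableAt.hasFDerivAt h3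
    exact h4.prodMk (ℓ.hasFDerivAt.sub_const _)
  obtain ⟨f, hfa, hfb, hfG, hfu⟩ := exists_analytic_implicit hG (by
    rw [hGd, ← he]; exact ContinuousLinearMap.isInvertible_equiv)
  simp only [hGb] at hfG hfu
  have hcT : ContinuousAt T a := by
    have h1 : ContinuousAt Fw a := by
      have := hFa.fderiv.continuousAt
      exact (((ContinuousLinearMap.compL ℝ _ _ _).flip
        (ContinuousLinearMap.inr ℝ (Fin n → ℝ) (Fin n → ℝ))).continuous.continuousAt).comp this
    exact ((ContinuousLinearMap.prodₗᵢ ℝ).continuous.continuousAt).comp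
      (h1.prodMk (continuousAt_const (y := ℓ)))
  have hinj : ∀ᶠ q in 𝓝 a, ∀ v, fderiv ℝ S.F q (0, v) = 0 → ℓ v = 0 → v = 0 := by
    have h1 := hcT.eventually (he ▸ ContinuousLinearEquiv.nhds e)
    filter_upwards [h1] with q ⟨e', he'⟩ v hv hl
    have : e' v = 0 := by
      have h2 : (e' : (Fin n → ℝ) →L[ℝ] (Fin (n - 1) → ℝ) × ℝ) v = T q v := by rw [he']
      have h3 : T q v = 0 := Prod.ext hv hl
      exact h2.trans h3
    exact (map_eq_zero_iff e' e'.injective).1 this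
  have hℓc : Continuous fun q : (Fin n → ℝ) × (Fin n → ℝ) => (((q.1, ℓ q.2), q.2) :
      ((Fin n → ℝ) × ℝ) × (Fin n → ℝ)) := by fun_prop
  have hO2 : ∀ᶠ q in 𝓝 a, q ∈ S.dom ∧
      (∀ v, fderiv ℝ S.F q (0, v) = 0 → ℓ v = 0 → v = 0) ∧
      (G ((q.1, ℓ q.2), q.2) = 0 ↔ f (q.1, ℓ q.2) = q.2) :=
    (S.isOpen_dom.eventually_mem ha).and (hinj.and ((hℓc.tendsto a).eventually hfu))
  obtain ⟨O2, hO2s, hO2o, haO2⟩ := eventually_nhds_iff.1 hO2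
  have hfc : Tendsto (fun p : (Fin n → ℝ) × ℝ => (p.1, f p)) (𝓝 (a.1, ℓ a.2)) (𝓝 a) := by
    have h1 : ContinuousAt (fun p : (Fin n → ℝ) × ℝ => (p.1, f p)) (a.1, ℓ a.2) :=
      continuousAt_fst.prodMk hfa.continuousAt
    have h2 := h1.tendsto
    rwa [show f (a.1, ℓ a.2) = a.2 from hfb] at h2
  have hO1 : ∀ᶠ p in 𝓝 (a.1, ℓ a.2), AnalyticAt ℝ f p ∧ G (p, f p) = 0 ∧ (p.1, f p) ∈ O2 :=
    hfa.eventually_analyticAt.and (hfG.and (hfc.eventually (hO2o.mem_nhds haO2)))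
  obtain ⟨O1, hO1s, hO1o, haO1⟩ := eventually_nhds_iff.1 hO1
  have hG' : ∀ p ∈ O1, S.F (p.1, f p) = 0 ∧ ℓ (f p) = p.2 := fun p hp =>
    ⟨congrArg Prod.fst (hO1s p hp).2.1, sub_eq_zero.1 (congrArg Prod.snd (hO1s p hp).2.1)⟩
  have hproj : Continuous fun q : (Fin n → ℝ) × (Fin n → ℝ) => (q.1, ℓ q.2) := by fun_prop
  exact ⟨{
    ℓ := ℓ
    f := f
    O := O1
    O₂ := O2 ∩ (fun q => (q.1, ℓ q.2)) ⁻¹' O1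
    isOpen_O := hO1o
    mem_O := haO1
    isOpen_O₂ := hO2o.inter (hO1o.preimage hproj)
    mem_O₂ := ⟨haO2, haO1⟩
    subset_dom := fun q hq => (hO2s q hq.1).1
    analytic := fun p hp => (hO1s p hp).1
    f_base := hfb
    graph := fun p hp => ⟨⟨(hO1s p hp).2.2, by
      change (p.1, ℓ (f p)) ∈ O1
      rw [(hG' p hp).2]; exact hp⟩, hG' p hp⟩
    unique := fun q hq hFq => ⟨hq.2, (hO2s q hq.1).2.2.1 (by
      change (S.F q, ℓ q.2 - ℓ q.2) = 0
      rw [hFq, sub_self]; rfl)⟩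
    inj := fun q hq => (hO2s q hq.1).2.1 }⟩

/-! ## Local coordinates on the solution jets -/

/-- The states, the control, and all the derivatives of the control. -/
abbrev Chart (n : ℕ) := (Fin n → ℝ) × (ℕ → ℝ)

theorem lineDeriv_clm {E F : Type*} [AddCommGroup E] [Module ℝ E] [TopologicalSpace E]
    [NormedAddCommGroup F] [NormedSpace ℝ F] (L : E →L[ℝ] F) (x v : E) :
    lineDeriv ℝ (fun y => L y) x v = L v :=
  HasLineDerivAt.lineDeriv (hasDerivAt_clm_line L x v 0)

namespace ImplicitSystem

variable {n : ℕ} (S : ImplicitSystem n 1)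

/-- The jets whose first two components belong to `O`. -/
def jetsOver (O : Set ((Fin n → ℝ) × (Fin n → ℝ))) : Set (Jet n) := {x | (x 0, x 1) ∈ O}

theorem isOpen_jetsOver {O : Set ((Fin n → ℝ) × (Fin n → ℝ))} (hO : IsOpen O) :
    IsOpen (jetsOver O) :=
  hO.preimage (by fun_prop : Continuous fun x : Jet n => (x 0, x 1))

/-- The projection of jets to their first two components. -/
def jetPairL (n : ℕ) : Jet n →L[ℝ] (Fin n → ℝ) × (Fin n → ℝ) :=
  (ContinuousLinearMap.proj 0).prod (ContinuousLinearMap.proj 1)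

theorem cylAnOn_jetF (i : Fin (n - 1)) : CylAnOn (jetsOver S.dom) (S.jetF i) :=
  (((CylAnOn.of_clm (jetPairL n)).comp S.analytic (fun _ hx => hx)).clm_comp
    (ContinuousLinearMap.proj i : (Fin (n - 1) → ℝ) →L[ℝ] ℝ)).congr fun _ _ => rfl

theorem cylAnOn_iterate_jetF (k : ℕ) (i : Fin (n - 1)) :
    CylAnOn (jetsOver S.dom) (ddt^[k] (S.jetF i)) := by
  rw [ddt_eq_lieD]
  exact (S.cylAnOn_jetF i).iterate_lieD (isOpen_jetsOver S.isOpen_dom) (cylMapOn_cartanField _) k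

theorem hasLineDerivAt_jetF {x : Jet n} (hx : x ∈ jetsOver S.dom) (v : Jet n) (i : Fin (n - 1)) :
    HasLineDerivAt ℝ (S.jetF i) (fderiv ℝ S.F (x 0, x 1) (v 0, v 1) i) x v := by
  have h := hasLineDerivAt_comp_clm (L := jetPairL n) (x := x) (S.analytic _ hx) v
  exact hasDerivAt_pi.1 h i

/-- The highest derivatives enter affinely in the derivatives of the equations. -/
theorem iterate_jetF_sub (k : ℕ) (i : Fin (n - 1)) {x y : Jet n} (hx : x ∈ jetsOver S.dom)
    (hxy : ∀ j ≤ k + 1, x j = y j) :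
    (ddt^[k + 1] (S.jetF i)) x - (ddt^[k + 1] (S.jetF i)) y =
      fderiv ℝ S.F (x 0, x 1) (0, x (k + 2) - y (k + 2)) i := by
  have hy : y ∈ jetsOver S.dom := by
    change (y 0, y 1) ∈ S.dom
    rw [← hxy 0 (by omega), ← hxy 1 (by omega)]
    exact hx
  induction k generalizing x y with
  | zero =>
    have e1 : (ddt^[0 + 1] (S.jetF i)) x = fderiv ℝ S.F (x 0, x 1) (x 1, x 2) i :=
      (S.hasLineDerivAt_jetF hx (cartanField x) i).lineDeriv
    have e2 : (ddt^[0 + 1] (S.jetF i)) y = fderiv ℝ S.F (y 0, y 1) (y 1, y 2) i :=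
      (S.hasLineDerivAt_jetF hy (cartanField y) i).lineDeriv
    rw [e1, e2, ← hxy 0 (by omega), ← hxy 1 (by omega), ← Pi.sub_apply, ← map_sub, Prod.mk_sub_mk,
      sub_self]
  | succ k ih =>
    set h := ddt^[k + 1] (S.jetF i) with hh
    have hd : ∀ x ∈ jetsOver S.dom, HasDerivAt (fun t : ℝ => h (x + t • cartanField x))
        ((ddt^[k + 1 + 1] (S.jetF i)) x) 0 := by
      intro x hx
      rw [Function.iterate_succ_apply']
      exact (S.cylAnOn_iterate_jetF (k + 1) i).hasLineDerivAt (isOpen_jetsOver S.isOpen_dom) hx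
        (cartanField x)
    have h1 := (hd x hx).sub (hd y hy)
    set d := x (k + 1 + 2) - y (k + 1 + 2) with hdd
    have h2 : HasDerivAt (fun t : ℝ => fderiv ℝ S.F
        ((x + t • cartanField x) 0, (x + t • cartanField x) 1) (0, d) i)
        (fderiv ℝ (fderiv ℝ S.F) (x 0, x 1) (x 1, x 2) (0, d) i) 0 := by
      have h3 := hasLineDerivAt_comp_clm (L := jetPairL n) (x := x) (S.analytic _ hx).fderiv
        (cartanField x)
      have h4 := HasDerivAt.clm_apply h3 (hasDerivAt_const (0 : ℝ) ((0, d) : _ × (Fin n → ℝ)))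
      have h5 := hasDerivAt_pi.1 h4 i
      refine HasDerivAt.congr_deriv h5 ?_
      simp only [map_zero, Pi.add_apply, Pi.zero_apply, add_zero]
      rfl
    have h3 := (hasDerivAt_id (0 : ℝ)).mul h2
    -- Moved for a time `t` along their Cartan vectors, `x` and `y` still agree up to order `k + 1`
    -- and now differ by `t d` in order `k + 2`. The induction hypothesis evaluates the difference
    -- of the values of `h` as `t` times a smooth factor, and its derivative at `t = 0` is the value
    -- of that factor.
    have hev : (fun t : ℝ => h (x + t • cartanField x)) - (fun t : ℝ => h (y + t • cartanField y))
        =ᶠ[𝓝 0] (id * fun t : ℝ => fderiv ℝ S.F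
        ((x + t • cartanField x) 0, (x + t • cartanField x) 1) (0, d) i) := by
      have hN : ∀ x ∈ jetsOver S.dom, ∀ᶠ t in 𝓝 (0 : ℝ),
          x + t • cartanField x ∈ jetsOver S.dom := fun x hx =>
        eventually_add_smul ((isOpen_jetsOver S.isOpen_dom).mem_nhds hx) _
      filter_upwards [hN x hx, hN y hy] with t ht hty
      have hlow : ∀ j ≤ k + 1, (x + t • cartanField x) j = (y + t • cartanField y) j := by
        intro j hj
        simp only [Pi.add_apply, Pi.smul_apply, cartanField]
        rw [hxy j (by omega), hxy (j + 1) (by omega)]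
      have h4 := ih ht hlow hty
      have h5 : (x + t • cartanField x) (k + 2) - (y + t • cartanField y) (k + 2) = t • d := by
        simp only [Pi.add_apply, Pi.smul_apply, cartanField]
        rw [hxy (k + 2) (by omega), hdd, smul_sub]
        abel
      have h6 : ((0, t • d) : (Fin n → ℝ) × (Fin n → ℝ)) = t • (0, d) := by simp
      rw [h5, h6, map_smul] at h4
      exact h4
    have h4 := h1.unique (h3.congr_of_eventuallyEq hev)
    rw [h4]
    simp

end ImplicitSystem

namespace LocalForm

open ImplicitSystem

variable {n : ℕ} {S : ImplicitSystem n 1} {a : (Fin n → ℝ) × (Fin n → ℝ)} (Λ : LocalForm S a)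

/-- The control system `ẋ = f(x, u)` as a vector field. -/
def field (z : Chart n) : Chart n := (Λ.f (z.1, z.2 0), shiftL ℝ z.2)

def dom : Set (Chart n) := {z | (z.1, z.2 0) ∈ Λ.O}

/-- The jet with given state and derivatives of the control. -/
def param : Chart n → Jet n := prolong Λ.field Prod.fst

/-- The state and the derivatives of the control of a jet. -/
def coord : Jet n →L[ℝ] Chart n :=
  (ContinuousLinearMap.proj 0).prod (ContinuousLinearMap.pi fun k =>
    Λ.ℓ.comp (ContinuousLinearMap.proj (k + 1)))

theorem coord_apply (x : Jet n) : Λ.coord x = (x 0, fun k => Λ.ℓ (x (k + 1))) := rfl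

theorem isOpen_dom : IsOpen Λ.dom :=
  Λ.isOpen_O.preimage (by fun_prop : Continuous fun z : Chart n => (z.1, z.2 0))

/-- The state and the control. -/
def stateControlL (n : ℕ) : Chart n →L[ℝ] (Fin n → ℝ) × ℝ :=
  (ContinuousLinearMap.fst ℝ _ _).prod
    ((ContinuousLinearMap.proj 0).comp (ContinuousLinearMap.snd ℝ _ _))

/-- The coordinate `xᵢ`. -/
def stateL (n : ℕ) (i : Fin n) : Chart n →L[ℝ] ℝ :=
  (ContinuousLinearMap.proj i).comp (ContinuousLinearMap.fst ℝ _ _)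

/-- The coordinate `u⁽ᵏ⁾`. -/
def controlL (n : ℕ) (k : ℕ) : Chart n →L[ℝ] ℝ :=
  (ContinuousLinearMap.proj k).comp (ContinuousLinearMap.snd ℝ _ _)

theorem cylAnOn_f : CylAnOn Λ.dom (fun z => Λ.f (z.1, z.2 0)) :=
  (CylAnOn.of_clm (stateControlL n)).comp Λ.analytic (fun _ hz => hz)

theorem cylMapOn_field : CylMapOn Λ.dom Λ.field := by
  intro F _ _ L
  have h1 : CylAnOn Λ.dom (fun z => L.comp (.inl ℝ _ _) (Λ.f (z.1, z.2 0))) :=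
    Λ.cylAnOn_f.clm_comp _
  have h2 : CylAnOn Λ.dom (fun z => (L.comp (.inr ℝ _ _)).comp ((shiftL ℝ).comp (.snd ℝ _ _)) z) :=
    CylAnOn.of_clm _
  refine (h1.add h2).congr fun z _ => ?_
  simp [field, ← map_add]

theorem cylAnOn_state (W : Set (Chart n)) (i : Fin n) : CylAnOn W (fun z : Chart n => z.1 i) :=
  CylAnOn.of_clm (stateL n i)

theorem cylAnOn_control (W : Set (Chart n)) (k : ℕ) : CylAnOn W (fun z : Chart n => z.2 k) :=
  CylAnOn.of_clm (controlL n k)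

theorem lineDeriv_state (z v : Chart n) (i : Fin n) :
    lineDeriv ℝ (fun z : Chart n => z.1 i) z v = v.1 i :=
  lineDeriv_clm (stateL n i) z v

theorem lineDeriv_control (z v : Chart n) (k : ℕ) :
    lineDeriv ℝ (fun z : Chart n => z.2 k) z v = v.2 k :=
  lineDeriv_clm (controlL n k) z v

theorem cylMapOn_param : CylMapOn Λ.dom Λ.param :=
  cylMapOn_prolong Λ.isOpen_dom Λ.cylMapOn_field fun i => cylAnOn_state _ i

theorem relatedOn_param : RelatedOn Λ.dom Λ.field Λ.param := relatedOn_prolong _ _ _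

theorem param_zero (z : Chart n) : Λ.param z 0 = z.1 := rfl

theorem param_one (z : Chart n) : Λ.param z 1 = Λ.f (z.1, z.2 0) := by
  funext i
  exact lineDeriv_state z (Λ.field z) i

theorem param_mem_jetsOver {z : Chart n} (hz : z ∈ Λ.dom) : Λ.param z ∈ jetsOver Λ.O₂ := by
  change (Λ.param z 0, Λ.param z 1) ∈ Λ.O₂
  rw [param_zero, param_one]
  exact (Λ.graph _ hz).1

theorem param_mapsTo : MapsTo Λ.param Λ.dom (jetsOver S.dom) := fun _ hz =>
  Λ.subset_dom (Λ.param_mem_jetsOver hz)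

/-- Along the parametrization `F` vanishes identically, and `param` carries the control field to the
Cartan field, so all the iterated derivatives vanish too. -/
theorem iterate_jetF_param (k : ℕ) (i : Fin (n - 1)) {z : Chart n} (hz : z ∈ Λ.dom) :
    (ddt^[k] (S.jetF i)) (Λ.param z) = 0 := by
  rw [← Λ.relatedOn_param.iterate_lieD_comp Λ.isOpen_dom Λ.cylMapOn_param
    (isOpen_jetsOver S.isOpen_dom) Λ.param_mapsTo (S.cylAnOn_jetF i) k hz]
  have h0 : EqOn (fun z => S.jetF i (Λ.param z)) (fun _ => 0) Λ.dom := by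
    intro z hz
    simp only [jetF, param_zero, param_one, (Λ.graph _ hz).2.1]
    rfl
  rw [iterate_lieD_congr Λ.isOpen_dom h0 k hz]
  have : ∀ k, ((lieD Λ.field)^[k] fun _ => (0 : ℝ)) = fun _ => 0 := by
    intro k
    induction k with
    | zero => rfl
    | succ k ih =>
      rw [Function.iterate_succ_apply', ih]
      funext z
      simp [lieD, lineDeriv]
  rw [this]

theorem param_mem_prolonged {z : Chart n} (hz : z ∈ Λ.dom) : Λ.param z ∈ S.prolonged :=
  ⟨Λ.param_mapsTo hz, fun k i => Λ.iterate_jetF_param k i hz⟩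

theorem ℓ_param (k : ℕ) {z : Chart n} (hz : z ∈ Λ.dom) : Λ.ℓ (Λ.param z (k + 1)) = z.2 k := by
  induction k generalizing z with
  | zero => rw [zero_add, param_one, (Λ.graph _ hz).2.2]
  | succ k ih =>
    let L : Jet n →L[ℝ] ℝ := Λ.ℓ.comp (ContinuousLinearMap.proj (k + 1))
    have h1 := Λ.relatedOn_param.lieD_comp Λ.isOpen_dom Λ.cylMapOn_param isOpen_univ
      (mapsTo_univ _ _) (CylAnOn.of_clm L) hz
    have h2 : ddt (fun x => L x) (Λ.param z) = Λ.ℓ (Λ.param z (k + 1 + 1)) := by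
      rw [ddt, lineDeriv_clm]; rfl
    rw [← h2, ← h1, lieD_congr (h := fun z => L (Λ.param z)) (k := fun z : Chart n => z.2 k) Λ.isOpen_dom (fun z hz => ih hz) hz]
    exact lineDeriv_control _ _ _

theorem coord_param {z : Chart n} (hz : z ∈ Λ.dom) : Λ.coord (Λ.param z) = z := by
  rw [coord_apply, param_zero]
  exact Prod.ext rfl (funext fun k => Λ.ℓ_param k hz)

theorem coord_mem_dom {x : Jet n} (hx : x ∈ S.prolonged) (hO : x ∈ jetsOver Λ.O₂) :
    Λ.coord x ∈ Λ.dom := (Λ.unique _ hO (funext fun i => hx.2 0 i)).1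

/-- A solution jet is determined by its state and controls, order by order: the equation
`(d/dt)^{k+1} F = 0` fixes `∂F/∂ẋ · x⁽ᵏ⁺²⁾` in terms of lower orders, and the control fixes
`ℓ(x⁽ᵏ⁺²⁾)`; together these are injective in `x⁽ᵏ⁺²⁾`. -/
theorem param_coord {x : Jet n} (hx : x ∈ S.prolonged) (hO : x ∈ jetsOver Λ.O₂) :
    Λ.param (Λ.coord x) = x := by
  have hz := Λ.coord_mem_dom hx hO
  set y := Λ.param (Λ.coord x) with hy
  have hyp := Λ.param_mem_prolonged hz
  have h0 : y 0 = x 0 := rfl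
  have h1 : y 1 = x 1 := by
    rw [hy, param_one]
    exact (Λ.unique _ hO (funext fun i => hx.2 0 i)).2
  have key : ∀ k, ∀ j ≤ k + 1, x j = y j := by
    intro k
    induction k with
    | zero =>
      intro j hj
      rcases Nat.le_one_iff_eq_zero_or_eq_one.1 hj with rfl | rfl
      · exact h0.symm
      · exact h1.symm
    | succ k ih =>
      intro j hj
      rcases Nat.lt_or_ge j (k + 2) with hlt | hge
      · exact ih j (by omega)
      obtain rfl : j = k + 2 := by omega
      rw [← sub_eq_zero]
      refine Λ.inj _ hO _ (funext fun i => ?_) ?_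
      · rw [← S.iterate_jetF_sub k i hx.1 ih, hx.2, hyp.2, sub_self]; rfl
      · have : Λ.coord y = Λ.coord x := Λ.coord_param hz
        have := congrFun (congrArg Prod.snd this) (k + 1)
        rw [map_sub, sub_eq_zero]
        exact this.symm
  funext j
  exact (key j j (by omega)).symm

theorem isTangent_jetDeriv {z : Chart n} (hz : z ∈ Λ.dom) (w : Chart n) :
    S.IsTangent (Λ.param z) (jetDeriv Λ.param z w) := by
  intro k i
  rw [← lineDeriv_comp_jet Λ.isOpen_dom Λ.cylMapOn_param (isOpen_jetsOver S.isOpen_dom)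
    Λ.param_mapsTo (S.cylAnOn_iterate_jetF k i) hz w]
  rw [lineDeriv_congr_nhds (k := fun _ => (0 : ℝ)) (eventually_of_mem (Λ.isOpen_dom.mem_nhds hz)
    fun z hz => Λ.iterate_jetF_param k i hz)]
  simp [lineDeriv]

theorem coord_jetDeriv {z : Chart n} (hz : z ∈ Λ.dom) (w : Chart n) :
    Λ.coord (jetDeriv Λ.param z w) = w := by
  refine Prod.ext (funext fun i => lineDeriv_state z w i) (funext fun k => ?_)
  let L : Jet n →L[ℝ] ℝ := Λ.ℓ.comp (ContinuousLinearMap.proj (k + 1))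
  have h1 := lineDeriv_comp_jet Λ.isOpen_dom Λ.cylMapOn_param isOpen_univ (mapsTo_univ _ _)
    (CylAnOn.of_clm L) hz w
  rw [lineDeriv_clm, lineDeriv_congr_nhds (h := fun z => L (Λ.param z)) (k := fun z : Chart n => z.2 k)
    (eventually_of_mem (Λ.isOpen_dom.mem_nhds hz) fun z hz => Λ.ℓ_param k hz),
    lineDeriv_control] at h1
  exact h1.symm

/-- This is the linearization of `param_coord`, by the same induction on the order. It makes the
derivative of `param` surjective onto the tangent vectors of `𝔛₀`. -/
theorem eq_zero_of_isTangent {x v : Jet n} (hO : x ∈ jetsOver Λ.O₂) (hv : S.IsTangent x v)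
    (h : Λ.coord v = 0) : v = 0 := by
  have hx : x ∈ jetsOver S.dom := Λ.subset_dom hO
  have h0 : v 0 = 0 := congrArg Prod.fst h
  have hl : ∀ k, Λ.ℓ (v (k + 1)) = 0 := fun k => congrFun (congrArg Prod.snd h) k
  have key : ∀ k, ∀ j ≤ k + 1, v j = 0 := by
    intro k
    induction k with
    | zero =>
      intro j hj
      rcases Nat.le_one_iff_eq_zero_or_eq_one.1 hj with rfl | rfl
      · exact h0
      · refine Λ.inj _ hO _ (funext fun i => ?_) (hl 0)
        have := (S.hasLineDerivAt_jetF hx v i).lineDeriv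
        rw [h0] at this
        exact this.symm.trans (hv 0 i)
    | succ k ih =>
      intro j hj
      rcases Nat.lt_or_ge j (k + 2) with hlt | hge
      · exact ih j (by omega)
      obtain rfl : j = k + 2 := by omega
      refine Λ.inj _ hO _ (funext fun i => ?_) (hl (k + 1))
      -- The components of `v` up to order `k + 1` vanish, so the equation is exactly affine along
      -- this line.
      have h1 : ∀ t : ℝ, (ddt^[k + 1] (S.jetF i)) (x + t • v) = (ddt^[k + 1] (S.jetF i)) x +
          t * fderiv ℝ S.F (x 0, x 1) (0, v (k + 2)) i := by
        intro t
        have h2 := S.iterate_jetF_sub k i (x := x) (y := x + t • v) hx (by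
          intro j hj
          simp [ih j hj])
        have h3 : ((0, x (k + 2) - (x + t • v) (k + 2)) : (Fin n → ℝ) × (Fin n → ℝ)) =
            (-t) • (0, v (k + 2)) := by simp
        rw [h3, map_smul, Pi.smul_apply, smul_eq_mul] at h2
        linarith
      have h2 : HasLineDerivAt ℝ (ddt^[k + 1] (S.jetF i))
          (fderiv ℝ S.F (x 0, x 1) (0, v (k + 2)) i) x v := by
        have := ((hasDerivAt_id (0 : ℝ)).mul_const
          (fderiv ℝ S.F (x 0, x 1) (0, v (k + 2)) i)).const_add ((ddt^[k + 1] (S.jetF i)) x)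
        simp only [HasLineDerivAt, h1]
        simpa using this
      exact h2.lineDeriv.symm.trans (hv (k + 1) i)
  funext j
  exact key j j (by omega)

theorem eq_jetDeriv_of_isTangent {z : Chart n} (hz : z ∈ Λ.dom) {v : Jet n}
    (hv : S.IsTangent (Λ.param z) v) : v = jetDeriv Λ.param z (Λ.coord v) := by
  rw [← sub_eq_zero]
  refine Λ.eq_zero_of_isTangent (Λ.param_mem_jetsOver hz) (fun k i => ?_) ?_
  · rw [(S.cylAnOn_iterate_jetF k i).lineDeriv_sub_dir (isOpen_jetsOver S.isOpen_dom)
      (Λ.param_mapsTo hz), hv k i, Λ.isTangent_jetDeriv hz _ k i, sub_zero]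
  · rw [map_sub, Λ.coord_jetDeriv hz, sub_self]

end LocalForm

/-! ## The ring of germs of analytic functions -/

section Germs

variable {E : Type*} [AddCommGroup E] [Module ℝ E] [TopologicalSpace E]

/-- `h` is analytic on a neighborhood of `z₀`. -/
def CylAt (z₀ : E) (h : E → ℝ) : Prop := ∃ W, IsOpen W ∧ z₀ ∈ W ∧ CylAnOn W h

variable {z₀ : E} {h k : E → ℝ}

theorem CylAt.const (z₀ : E) (c : ℝ) : CylAt z₀ (fun _ => c) :=
  ⟨univ, isOpen_univ, mem_univ _, CylAnOn.const c⟩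

theorem CylAt.exists_common (hh : CylAt z₀ h) (hk : CylAt z₀ k) :
    ∃ W, IsOpen W ∧ z₀ ∈ W ∧ CylAnOn W h ∧ CylAnOn W k := by
  obtain ⟨W, hW, hz, h1⟩ := hh
  obtain ⟨W', hW', hz', h2⟩ := hk
  exact ⟨W ∩ W', hW.inter hW', ⟨hz, hz'⟩, h1.mono inter_subset_left, h2.mono inter_subset_right⟩

theorem CylAt.add (hh : CylAt z₀ h) (hk : CylAt z₀ k) : CylAt z₀ (fun z => h z + k z) := by
  obtain ⟨W, hW, hz, h1, h2⟩ := hh.exists_common hk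
  exact ⟨W, hW, hz, h1.add h2⟩

theorem CylAt.mul (hh : CylAt z₀ h) (hk : CylAt z₀ k) : CylAt z₀ (fun z => h z * k z) := by
  obtain ⟨W, hW, hz, h1, h2⟩ := hh.exists_common hk
  exact ⟨W, hW, hz, h1.mul h2⟩

theorem CylAt.neg (hh : CylAt z₀ h) : CylAt z₀ (fun z => -h z) := by
  obtain ⟨W, hW, hz, h1⟩ := hh
  exact ⟨W, hW, hz, h1.neg⟩

theorem CylAt.inv (hh : CylAt z₀ h) (h0 : h z₀ ≠ 0) : CylAt z₀ (fun z => (h z)⁻¹) := by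
  obtain ⟨W, hW, hz, h1⟩ := hh
  exact ⟨W ∩ h ⁻¹' {0}ᶜ, h1.continuousOn.isOpen_inter_preimage hW isOpen_compl_singleton,
    ⟨hz, h0⟩, (h1.mono inter_subset_left).inv fun x hx => hx.2⟩

theorem CylAt.sum {ι : Type*} (s : Finset ι) {h : ι → E → ℝ} (hh : ∀ i ∈ s, CylAt z₀ (h i)) :
    CylAt z₀ (fun z => ∑ i ∈ s, h i z) := by
  classical
  induction s using Finset.induction_on with
  | empty => simpa using CylAt.const z₀ 0
  | insert a s ha ih =>
    simp only [Finset.sum_insert ha]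
    exact (hh a (by simp)).add (ih fun i hi => hh i (by simp [hi]))

theorem CylAt.congr (hh : CylAt z₀ h) (e : k =ᶠ[𝓝 z₀] h) : CylAt z₀ k := by
  obtain ⟨W, hW, hz, h1⟩ := hh
  obtain ⟨W', hs, hW', hz'⟩ := eventually_nhds_iff.1 e
  exact ⟨W ∩ W', hW.inter hW', ⟨hz, hz'⟩,
    (h1.mono inter_subset_left).congr fun x hx => hs x hx.2⟩

theorem CylAt.continuousAt (hh : CylAt z₀ h) : ContinuousAt h z₀ := by
  obtain ⟨W, hW, hz, h1⟩ := hh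
  exact h1.continuousOn.continuousAt (hW.mem_nhds hz)

/-- The germs at `z₀` of the functions that are analytic near `z₀`. -/
def cylRing (z₀ : E) : Subring (Germ (𝓝 z₀) ℝ) where
  carrier := {g | ∃ h, CylAt z₀ h ∧ (h : Germ (𝓝 z₀) ℝ) = g}
  mul_mem' := by
    rintro _ _ ⟨h, hh, rfl⟩ ⟨k, hk, rfl⟩
    exact ⟨_, hh.mul hk, rfl⟩
  one_mem' := ⟨_, CylAt.const z₀ 1, rfl⟩
  add_mem' := by
    rintro _ _ ⟨h, hh, rfl⟩ ⟨k, hk, rfl⟩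
    exact ⟨_, hh.add hk, rfl⟩
  zero_mem' := ⟨_, CylAt.const z₀ 0, rfl⟩
  neg_mem' := by
    rintro _ ⟨h, hh, rfl⟩
    exact ⟨_, hh.neg, rfl⟩

open Classical in
/-- The germ of an analytic function (`0` for other functions). -/
def germ (z₀ : E) (h : E → ℝ) : cylRing z₀ :=
  if hh : CylAt z₀ h then ⟨(h : Germ (𝓝 z₀) ℝ), h, hh, rfl⟩ else 0

theorem coe_germ (hh : CylAt z₀ h) : (germ z₀ h : Germ (𝓝 z₀) ℝ) = h := by
  rw [germ, dif_pos hh]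

theorem germ_eq_iff (hh : CylAt z₀ h) (hk : CylAt z₀ k) :
    germ z₀ h = germ z₀ k ↔ h =ᶠ[𝓝 z₀] k := by
  rw [← Subtype.coe_inj, coe_germ hh, coe_germ hk, Germ.coe_eq]

theorem germ_congr (e : h =ᶠ[𝓝 z₀] k) : germ z₀ h = germ z₀ k := by
  by_cases hk : CylAt z₀ k
  · exact (germ_eq_iff (hk.congr e) hk).2 e
  · have hh : ¬ CylAt z₀ h := fun hh => hk (hh.congr e.symm)
    rw [germ, germ, dif_neg hh, dif_neg hk]

theorem exists_germ_eq (r : cylRing z₀) : ∃ h, CylAt z₀ h ∧ germ z₀ h = r := by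
  obtain ⟨_, h, hh, rfl⟩ := r
  exact ⟨h, hh, Subtype.ext (coe_germ hh)⟩

theorem germ_add (hh : CylAt z₀ h) (hk : CylAt z₀ k) :
    germ z₀ (fun z => h z + k z) = germ z₀ h + germ z₀ k := by
  apply Subtype.ext
  rw [coe_germ (hh.add hk), Subring.coe_add, coe_germ hh, coe_germ hk]
  rfl

theorem germ_mul (hh : CylAt z₀ h) (hk : CylAt z₀ k) :
    germ z₀ (fun z => h z * k z) = germ z₀ h * germ z₀ k := by
  apply Subtype.ext
  rw [coe_germ (hh.mul hk), Subring.coe_mul, coe_germ hh, coe_germ hk]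
  rfl

theorem germ_zero : germ z₀ (fun _ => 0) = 0 := by
  apply Subtype.ext
  rw [coe_germ (CylAt.const z₀ 0)]
  rfl

theorem germ_one : germ z₀ (fun _ => 1) = 1 := by
  apply Subtype.ext
  rw [coe_germ (CylAt.const z₀ 1)]
  rfl

theorem germ_neg (hh : CylAt z₀ h) : germ z₀ (fun z => -h z) = -germ z₀ h := by
  apply Subtype.ext
  rw [coe_germ hh.neg, Subring.coe_neg, coe_germ hh]
  rfl

theorem germ_sum {ι : Type*} (s : Finset ι) {h : ι → E → ℝ} (hh : ∀ i ∈ s, CylAt z₀ (h i)) :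
    germ z₀ (fun z => ∑ i ∈ s, h i z) = ∑ i ∈ s, germ z₀ (h i) := by
  classical
  induction s using Finset.induction_on with
  | empty => simpa using germ_zero
  | insert a s ha ih =>
    simp only [Finset.sum_insert ha]
    rw [germ_add (hh a (by simp)) (CylAt.sum s fun i hi => hh i (by simp [hi])),
      ih fun i hi => hh i (by simp [hi])]

theorem isUnit_germ_iff (hh : CylAt z₀ h) : IsUnit (germ z₀ h) ↔ h z₀ ≠ 0 := by
  constructor
  · rintro ⟨u, hu⟩ h0
    obtain ⟨k, hk, hku⟩ := exists_germ_eq (↑u⁻¹ : cylRing z₀)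
    have h1 : germ z₀ (fun z => h z * k z) = germ z₀ (fun _ => 1) := by
      rw [germ_mul hh hk, ← hu, hku, germ_one, Units.mul_inv]
    have h2 := ((germ_eq_iff (hh.mul hk) (CylAt.const z₀ 1)).1 h1).self_of_nhds
    simp only [h0, zero_mul] at h2
    exact zero_ne_one h2
  · intro h0
    refine IsUnit.of_mul_eq_one (germ z₀ fun z => (h z)⁻¹) ?_
    rw [← germ_mul hh (hh.inv h0), ← germ_one]
    refine germ_congr ?_
    filter_upwards [hh.continuousAt.eventually_ne h0] with z hz
    exact mul_inv_cancel₀ hz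

variable [IsTopologicalAddGroup E] [ContinuousSMul ℝ E]

theorem CylAnOn.analyticAt_line {W : Set E} (hW : IsOpen W) (hh : CylAnOn W h) {z v : E} {t : ℝ}
    (ht : z + t • v ∈ W) : AnalyticAt ℝ (fun s : ℝ => h (z + s • v)) t := by
  obtain ⟨F, _, _, L, g, hg, e⟩ := hh
  have h1 : AnalyticAt ℝ (fun s : ℝ => L z + s • L v) t :=
    analyticAt_const.add (analyticAt_id.smul analyticAt_const)
  have h2 : AnalyticAt ℝ (fun s : ℝ => g (L z + s • L v)) t :=
    AnalyticAt.comp_of_eq (hg _ ⟨_, ht, rfl⟩) h1 (by simp)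
  refine h2.congr ?_
  have hc : Continuous fun s : ℝ => z + s • v := by fun_prop
  filter_upwards [hc.continuousAt.eventually_mem (hW.mem_nhds ht)] with s hs
  rw [e _ hs]
  simp

/-- Identity theorem along segments. In a convex neighborhood where `h k = 0`, let `h z₁ ≠ 0`; then
`k` vanishes near `z₁`, and, being analytic on every segment issued from `z₁`, it vanishes on the
whole neighborhood. Only analyticity in one real variable is needed. -/
instance [LocallyConvexSpace ℝ E] : IsDomain (cylRing z₀) := by
  have : Nontrivial (cylRing z₀) := by
    refine ⟨germ z₀ (fun _ => 0), germ z₀ (fun _ => 1), fun h => ?_⟩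
    have := ((germ_eq_iff (CylAt.const z₀ 0) (CylAt.const z₀ 1)).1 h).self_of_nhds
    exact zero_ne_one this
  have : NoZeroDivisors (cylRing z₀) := by
    refine ⟨fun {r s} hrs => ?_⟩
    obtain ⟨h, hh, rfl⟩ := exists_germ_eq r
    obtain ⟨k, hk, rfl⟩ := exists_germ_eq s
    rw [← germ_mul hh hk, ← germ_zero, germ_eq_iff (hh.mul hk) (CylAt.const z₀ 0)] at hrs
    rw [← germ_zero, germ_eq_iff hh (CylAt.const z₀ 0), germ_eq_iff hk (CylAt.const z₀ 0)]
    by_contra hne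
    push Not at hne
    obtain ⟨hne, hnk⟩ := hne
    obtain ⟨W, hW, hz, h1, h2⟩ := hh.exists_common hk
    obtain ⟨W', hs, hW', hz'⟩ := eventually_nhds_iff.1 hrs
    obtain ⟨S, ⟨hS, hSc⟩, hSW⟩ := (LocallyConvexSpace.convex_basis (𝕜 := ℝ) z₀).mem_iff.1
      ((hW.inter hW').mem_nhds ⟨hz, hz'⟩)
    have hfr : ∃ᶠ z in 𝓝 z₀, h z ≠ 0 := fun hf => hne (by
      filter_upwards [hf] with z hz using not_not.1 hz)
    obtain ⟨z₁, hz₁, hz₁S⟩ := (hfr.and_eventually hS).exists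
    refine hnk (eventually_of_mem hS fun z hzS => ?_)
    have hseg : ∀ t ∈ Icc (0 : ℝ) 1, z₁ + t • (z - z₁) ∈ W ∩ W' := fun t ht =>
      hSW (hSc.add_smul_sub_mem hz₁S hzS ht)
    have han : AnalyticOnNhd ℝ (fun t : ℝ => k (z₁ + t • (z - z₁))) (Icc 0 1) := fun t ht =>
      h2.analyticAt_line hW (hseg t ht).1
    have h0 : (fun t : ℝ => k (z₁ + t • (z - z₁))) =ᶠ[𝓝 0] 0 := by
      have hz1W : z₁ ∈ W ∩ W' := hSW hz₁S
      have e1 := eventually_add_smul ((hW.inter hW').mem_nhds hz1W) (z - z₁)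
      have e2 := eventually_add_smul ((h1.continuousOn.continuousAt
        (hW.mem_nhds hz1W.1)).eventually_ne hz₁) (z - z₁)
      filter_upwards [e1, e2] with t ht1 ht2
      exact (mul_eq_zero.1 (hs _ ht1.2)).resolve_left ht2
    have := han.eqOn_zero_of_preconnected_of_eventuallyEq_zero isPreconnected_Icc
      (left_mem_Icc.2 zero_le_one) h0 (right_mem_Icc.2 zero_le_one)
    simpa using this
  exact NoZeroDivisors.to_isDomain _

/-- The derivative of germs along a field. -/
def germD (z₀ : E) (X : E → E) (r : cylRing z₀) : cylRing z₀ :=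
  germ z₀ (lieD X (exists_germ_eq r).choose)

/-- The field `X` is analytic near `z₀`. -/
def CylFieldAt (z₀ : E) (X : E → E) : Prop := ∃ W, IsOpen W ∧ z₀ ∈ W ∧ CylMapOn W X

theorem CylFieldAt.const (z₀ v : E) : CylFieldAt z₀ (fun _ => v) :=
  ⟨univ, isOpen_univ, mem_univ _, fun _ _ _ L => CylAnOn.const (L v)⟩

variable {X : E → E}

theorem CylAt.lieD (hX : CylFieldAt z₀ X) (hh : CylAt z₀ h) : CylAt z₀ (lieD X h) := by
  obtain ⟨W, hW, hz, h1⟩ := hh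
  obtain ⟨W', hW', hz', hX⟩ := hX
  exact ⟨W ∩ W', hW.inter hW', ⟨hz, hz'⟩, (h1.mono inter_subset_left).lieD (hW.inter hW')
    (hX.mono inter_subset_right)⟩

theorem CylAt.lineDeriv (hh : CylAt z₀ h) (v : E) : CylAt z₀ (fun z => lineDeriv ℝ h z v) :=
  hh.lieD (CylFieldAt.const z₀ v)

theorem lieD_eventuallyEq (e : h =ᶠ[𝓝 z₀] k) : lieD X h =ᶠ[𝓝 z₀] lieD X k := by
  filter_upwards [e.eventually_nhds] with z hz
  exact lineDeriv_congr_nhds hz _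

theorem germD_germ (hh : CylAt z₀ h) : germD z₀ X (germ z₀ h) = germ z₀ (lieD X h) := by
  have hs := (exists_germ_eq (germ z₀ h)).choose_spec
  exact germ_congr (lieD_eventuallyEq ((germ_eq_iff hs.1 hh).1 hs.2))

theorem CylAt.eventually_hasLineDerivAt (hh : CylAt z₀ h) :
    ∀ᶠ z in 𝓝 z₀, ∀ v, HasLineDerivAt ℝ h (Flatness.lieD (fun _ => v) h z) z v := by
  obtain ⟨W, hW, hz, h1⟩ := hh
  filter_upwards [hW.mem_nhds hz] with z hz v using h1.hasLineDerivAt hW hz v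

theorem germD_add (hX : CylFieldAt z₀ X) (r s : cylRing z₀) :
    germD z₀ X (r + s) = germD z₀ X r + germD z₀ X s := by
  obtain ⟨h, hh, rfl⟩ := exists_germ_eq r
  obtain ⟨k, hk, rfl⟩ := exists_germ_eq s
  rw [← germ_add hh hk, germD_germ (hh.add hk), germD_germ hh, germD_germ hk,
    ← germ_add (hh.lieD hX) (hk.lieD hX)]
  refine germ_congr ?_
  filter_upwards [hh.eventually_hasLineDerivAt, hk.eventually_hasLineDerivAt] with z h1 h2
  exact HasLineDerivAt.lineDeriv (HasDerivAt.add (h1 (X z)) (h2 (X z)))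

theorem germD_mul (hX : CylFieldAt z₀ X) (r s : cylRing z₀) :
    germD z₀ X (r * s) = germD z₀ X r * s + r * germD z₀ X s := by
  obtain ⟨h, hh, rfl⟩ := exists_germ_eq r
  obtain ⟨k, hk, rfl⟩ := exists_germ_eq s
  rw [← germ_mul hh hk, germD_germ (hh.mul hk), germD_germ hh, germD_germ hk,
    ← germ_mul (hh.lieD hX) hk, ← germ_mul hh (hk.lieD hX),
    ← germ_add ((hh.lieD hX).mul hk) (hh.mul (hk.lieD hX))]
  refine germ_congr ?_
  filter_upwards [hh.eventually_hasLineDerivAt, hk.eventually_hasLineDerivAt] with z h1 h2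
  have h3 : HasLineDerivAt ℝ (fun z => h z * k z) (lieD X h z * k z + h z * lieD X k z) z (X z) := by
    refine HasDerivAt.congr_deriv (HasDerivAt.mul (h1 (X z)) (h2 (X z))) ?_
    simp [lieD]
  exact h3.lineDeriv

theorem germD_const (c : ℝ) : germD z₀ X (germ z₀ fun _ => c) = 0 := by
  rw [germD_germ (CylAt.const z₀ c), ← germ_zero]
  refine germ_congr (Eventually.of_forall fun z => ?_)
  simp [lieD, lineDeriv]

theorem germD_zero : germD z₀ X 0 = 0 := by rw [← germ_zero, germD_const, germ_zero]

end Germs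

/-! ## Germs of 1-forms on the coordinate space -/

section Forms

variable {n : ℕ} {z₀ : Chart n}

/-- The coordinate vector of `xᵢ`. -/
def stateV (i : Fin n) : Chart n := (Pi.single i 1, 0)

/-- The coordinate vector of `u⁽ᵏ⁾`. -/
def controlV (n k : ℕ) : Chart n := (0, Pi.single k 1)

/-- The germs of 1-forms, as functions of a constant vector. -/
def formModule (z₀ : Chart n) : Submodule (cylRing z₀) (Chart n → cylRing z₀) where
  carrier := {α | (∀ v w, α (v + w) = α v + α w) ∧
    (∀ (c : ℝ) v, α (c • v) = germ z₀ (fun _ => c) * α v) ∧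
    -- Finiteness of the sum: only the `du⁽ᵏ⁾` with `k < K` occur.
    ∃ K : ℕ, ∀ v : Chart n, v.1 = 0 → (∀ k < K, v.2 k = 0) → α v = 0}
  add_mem' := by
    rintro α β ⟨h1, h2, K, h3⟩ ⟨h1', h2', K', h3'⟩
    refine ⟨fun v w => ?_, fun c v => ?_, max K K', fun v hv hk => ?_⟩
    · simp only [Pi.add_apply, h1, h1']; abel
    · simp only [Pi.add_apply, h2, h2', mul_add]
    · rw [Pi.add_apply, h3 v hv fun k h => hk k (lt_max_of_lt_left h),
        h3' v hv fun k h => hk k (lt_max_of_lt_right h), add_zero]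
  zero_mem' := ⟨by simp, by simp, 0, by simp⟩
  smul_mem' := by
    rintro r α ⟨h1, h2, K, h3⟩
    refine ⟨fun v w => ?_, fun c v => ?_, K, fun v hv hk => ?_⟩
    · simp only [Pi.smul_apply, h1, smul_add]
    · simp only [Pi.smul_apply, h2, smul_eq_mul]; ring
    · rw [Pi.smul_apply, h3 v hv hk, smul_zero]

theorem form_add (α : formModule z₀) (v w : Chart n) : α.1 (v + w) = α.1 v + α.1 w := α.2.1 v w

theorem form_smul (α : formModule z₀) (c : ℝ) (v : Chart n) :
    α.1 (c • v) = germ z₀ (fun _ => c) * α.1 v := α.2.2.1 c v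

theorem form_zero (α : formModule z₀) : α.1 0 = 0 := by
  have := form_smul α 0 0
  rwa [smul_zero, germ_zero, zero_mul] at this

theorem form_sum (α : formModule z₀) {ι : Type*} (s : Finset ι) (v : ι → Chart n) :
    α.1 (∑ i ∈ s, v i) = ∑ i ∈ s, α.1 (v i) := by
  classical
  induction s using Finset.induction_on with
  | empty => simpa using form_zero α
  | insert a s ha ih => rw [Finset.sum_insert ha, Finset.sum_insert ha, form_add, ih]

theorem state_decomp (x : Fin n → ℝ) : ((x, 0) : Chart n) = ∑ i, x i • stateV i := by
  refine Prod.ext ?_ ?_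
  · rw [Prod.fst_sum]
    funext j
    simp [stateV, Finset.sum_apply, Pi.single_apply]
  · rw [Prod.snd_sum]
    simp [stateV]

theorem exists_form_eq (α : formModule z₀) : ∃ K : ℕ, (∀ k ≥ K, α.1 (controlV n k) = 0) ∧
    ∀ v, α.1 v = ∑ i, germ z₀ (fun _ => v.1 i) * α.1 (stateV i) +
      ∑ k ∈ Finset.range K, germ z₀ (fun _ => v.2 k) * α.1 (controlV n k) := by
  obtain ⟨K, hK⟩ := α.2.2.2
  refine ⟨K, fun k hk => hK _ rfl fun j hj => ?_, fun v => ?_⟩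
  · simp [controlV, (hj.trans_le hk).ne]
  have h1 : v = (v.1, 0) + (∑ k ∈ Finset.range K, v.2 k • controlV n k +
      (v - (v.1, 0) - ∑ k ∈ Finset.range K, v.2 k • controlV n k)) := by abel
  have h2 : α.1 (v - (v.1, 0) - ∑ k ∈ Finset.range K, v.2 k • controlV n k) = 0 := by
    refine hK _ ?_ fun k hk => ?_
    · simp [Prod.fst_sum, controlV]
    · simp only [Prod.snd_sub, Prod.snd_sum, Prod.smul_snd, sub_zero, Pi.sub_apply,
        Finset.sum_apply, Pi.smul_apply, controlV, Pi.single_apply, smul_eq_mul, mul_ite, mul_one,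
        mul_zero, Finset.sum_ite_eq, Finset.mem_range]
      simp [hk]
  conv_lhs => rw [h1, form_add, form_add, h2, add_zero, state_decomp, form_sum, form_sum]
  simp only [form_smul]

theorem form_ext {α β : formModule z₀} (h1 : ∀ i, α.1 (stateV i) = β.1 (stateV i))
    (h2 : ∀ k, α.1 (controlV n k) = β.1 (controlV n k)) : α = β := by
  rw [← sub_eq_zero]
  obtain ⟨K, -, hK⟩ := exists_form_eq (α - β)
  refine Subtype.ext (funext fun v => ?_)
  rw [hK v]
  simp [h1, h2]

theorem germD_dir_add (v w : Chart n) (r : cylRing z₀) :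
    germD z₀ (fun _ => v + w) r = germD z₀ (fun _ => v) r + germD z₀ (fun _ => w) r := by
  obtain ⟨h, hh, rfl⟩ := exists_germ_eq r
  rw [germD_germ hh, germD_germ hh, germD_germ hh,
    ← germ_add (hh.lieD (CylFieldAt.const z₀ v)) (hh.lieD (CylFieldAt.const z₀ w))]
  obtain ⟨W, hW, hz, h1⟩ := hh
  exact germ_congr (eventually_of_mem (hW.mem_nhds hz) fun z hz => h1.lineDeriv_add_dir hW hz v w)

theorem germD_dir_smul (c : ℝ) (v : Chart n) (r : cylRing z₀) :
    germD z₀ (fun _ => c • v) r = germ z₀ (fun _ => c) * germD z₀ (fun _ => v) r := by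
  obtain ⟨h, hh, rfl⟩ := exists_germ_eq r
  rw [germD_germ hh, germD_germ hh, ← germ_mul (CylAt.const z₀ c) (hh.lieD (CylFieldAt.const z₀ v))]
  obtain ⟨W, hW, hz, h1⟩ := hh
  exact germ_congr (eventually_of_mem (hW.mem_nhds hz) fun z hz => h1.lineDeriv_smul_dir hW hz c v)

/-- The factorization of `h` through a continuous linear map makes `K` uniform in the point `z`. -/
theorem exists_lineDeriv_eq_zero {W : Set (Chart n)} (hW : IsOpen W) {h : Chart n → ℝ}
    (hh : CylAnOn W h) : ∃ K : ℕ, ∀ z ∈ W, ∀ v : Chart n, v.1 = 0 → (∀ k < K, v.2 k = 0) →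
      lineDeriv ℝ h z v = 0 := by
  obtain ⟨F, _, _, L, g, hg, e, hd⟩ := hh.exists_deriv hW
  obtain ⟨K, hK⟩ := exists_finite_dependence (L.comp (.inr ℝ _ _))
  refine ⟨K, fun z hz v hv hk => ?_⟩
  have h1 : L v = 0 := by
    have : v = ContinuousLinearMap.inr ℝ (Fin n → ℝ) (ℕ → ℝ) v.2 := Prod.ext hv rfl
    rw [this]
    exact hK _ hk
  rw [(hd z hz v).lineDeriv, h1, map_zero]

/-- The differential of a germ. -/
def dGerm (r : cylRing z₀) : formModule z₀ :=
  ⟨fun v => germD z₀ (fun _ => v) r, fun v w => germD_dir_add v w r,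
    fun c v => germD_dir_smul c v r, by
      obtain ⟨h, ⟨W, hW, hz, h1⟩, rfl⟩ := exists_germ_eq r
      obtain ⟨K, hK⟩ := exists_lineDeriv_eq_zero hW h1
      refine ⟨K, fun v hv hk => ?_⟩
      beta_reduce
      rw [germD_germ ⟨W, hW, hz, h1⟩, ← germ_zero]
      exact germ_congr (eventually_of_mem (hW.mem_nhds hz) fun z hz => hK z hz v hv hk)⟩

theorem dGerm_germ {h : Chart n → ℝ} (hh : CylAt z₀ h) (v : Chart n) :
    (dGerm (germ z₀ h)).1 v = germ z₀ (fun z => lineDeriv ℝ h z v) := germD_germ hh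

theorem dGerm_add (r s : cylRing z₀) : dGerm (r + s) = dGerm r + dGerm s :=
  Subtype.ext (funext fun v => germD_add (CylFieldAt.const z₀ v) r s)

theorem dGerm_mul (r s : cylRing z₀) : dGerm (r * s) = s • dGerm r + r • dGerm s :=
  Subtype.ext (funext fun v => (germD_mul (CylFieldAt.const z₀ v) r s).trans (by
    rw [mul_comm _ s]; rfl))

theorem dGerm_const (c : ℝ) : dGerm (germ z₀ fun _ => c) = 0 :=
  Subtype.ext (funext fun _ => germD_const c)

end Forms

namespace LocalForm

variable {n : ℕ} {S : ImplicitSystem n 1} {a : (Fin n → ℝ) × (Fin n → ℝ)} (Λ : LocalForm S a)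
variable {z₀ : Chart n}

theorem cylFieldAt (hz₀ : z₀ ∈ Λ.dom) : CylFieldAt z₀ Λ.field :=
  ⟨Λ.dom, Λ.isOpen_dom, hz₀, Λ.cylMapOn_field⟩

theorem cylAt_f (hz₀ : z₀ ∈ Λ.dom) (i : Fin n) : CylAt z₀ (fun z => Λ.f (z.1, z.2 0) i) :=
  ⟨Λ.dom, Λ.isOpen_dom, hz₀, Λ.cylAnOn_f.clm_comp
    (ContinuousLinearMap.proj i : (Fin n → ℝ) →L[ℝ] ℝ)⟩

theorem cylAt_state (z₀ : Chart n) (i : Fin n) : CylAt z₀ (fun z : Chart n => z.1 i) :=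
  ⟨univ, isOpen_univ, mem_univ _, cylAnOn_state _ i⟩

theorem cylAt_control (z₀ : Chart n) (k : ℕ) : CylAt z₀ (fun z : Chart n => z.2 k) :=
  ⟨univ, isOpen_univ, mem_univ _, cylAnOn_control _ k⟩

theorem dGerm_state (i : Fin n) (v : Chart n) :
    (dGerm (germ z₀ fun z : Chart n => z.1 i)).1 v = germ z₀ fun _ => v.1 i := by
  rw [dGerm_germ (cylAt_state z₀ i)]
  simp only [lineDeriv_state]

theorem dGerm_control (k : ℕ) (v : Chart n) :
    (dGerm (germ z₀ fun z : Chart n => z.2 k)).1 v = germ z₀ fun _ => v.2 k := by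
  rw [dGerm_germ (cylAt_control z₀ k)]
  simp only [lineDeriv_control]

/-- The part of the Lie derivative of a 1-form that only involves the derivatives of its
coefficients. -/
def coeffLie (hz₀ : z₀ ∈ Λ.dom) (α : formModule z₀) : formModule z₀ :=
  ⟨fun v => germD z₀ Λ.field (α.1 v),
    fun v w => by
      beta_reduce
      rw [form_add, germD_add (Λ.cylFieldAt hz₀)],
    fun c v => by
      beta_reduce
      rw [form_smul, germD_mul (Λ.cylFieldAt hz₀), germD_const, zero_mul, zero_add], by
      obtain ⟨K, hK⟩ := α.2.2.2
      exact ⟨K, fun v hv hk => by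
        beta_reduce
        rw [hK v hv hk, germD_zero]⟩⟩

/-- The form `v ↦ α(0, shift v)`. -/
def shiftForm (α : formModule z₀) : formModule z₀ :=
  ⟨fun v => α.1 (0, shiftL ℝ v.2),
    fun v w => (congrArg α.1 (by simp)).trans (form_add α _ _),
    fun c v => (congrArg α.1 (by simp)).trans (form_smul α _ _), by
      obtain ⟨K, hK⟩ := α.2.2.2
      exact ⟨K + 1, fun v hv hk => hK _ rfl fun k h => hk (k + 1) (by omega)⟩⟩

/-- The Lie derivative of 1-forms along the control system. -/
def lieForm (hz₀ : z₀ ∈ Λ.dom) : formModule z₀ →+ formModule z₀ where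
  -- For `α = ∑ aᵢ dxᵢ + ∑ bₖ du⁽ᵏ⁾`, the three terms are the differentiation of the coefficients,
  -- `∑ aᵢ dfᵢ`, and `∑ bₖ du⁽ᵏ⁺¹⁾`.
  toFun α := Λ.coeffLie hz₀ α +
    ∑ i, α.1 (stateV i) • dGerm (germ z₀ fun z => Λ.f (z.1, z.2 0) i) + shiftForm α
  map_zero' := by
    refine Subtype.ext (funext fun v => ?_)
    simp [coeffLie, shiftForm, germD_zero]
  map_add' α β := by
    refine Subtype.ext (funext fun v => ?_)
    simp only [coeffLie, shiftForm, Submodule.coe_add, Pi.add_apply, add_smul,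
      Finset.sum_add_distrib, germD_add (Λ.cylFieldAt hz₀)]
    abel

theorem lieForm_apply (hz₀ : z₀ ∈ Λ.dom) (α : formModule z₀) (v : Chart n) :
    (Λ.lieForm hz₀ α).1 v = germD z₀ Λ.field (α.1 v) +
      ∑ i, α.1 (stateV i) * (dGerm (germ z₀ fun z => Λ.f (z.1, z.2 0) i)).1 v +
      α.1 (0, shiftL ℝ v.2) := by
  simp [lieForm, coeffLie, shiftForm, Finset.sum_apply]

theorem hasCylDeriv_field {z : Chart n} (hz : z ∈ Λ.dom) (v : Chart n) :
    HasCylDeriv Λ.field (fun i => lineDeriv ℝ (fun z => Λ.f (z.1, z.2 0) i) z v, shiftL ℝ v.2)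
      z v := by
  intro F _ _ L
  have h1 : HasDerivAt (fun t : ℝ => Λ.f ((z + t • v).1, (z + t • v).2 0))
      (fun i => lineDeriv ℝ (fun z => Λ.f (z.1, z.2 0) i) z v) 0 := by
    refine hasDerivAt_pi.2 fun i => ?_
    exact (Λ.cylAnOn_f.clm_comp (ContinuousLinearMap.proj i : (Fin n → ℝ) →L[ℝ] ℝ)).hasLineDerivAt
      Λ.isOpen_dom hz v
  have h2 := (L.comp (.inl ℝ _ _)).hasFDerivAt.comp_hasDerivAt (0 : ℝ) h1
  have h3 := hasDerivAt_clm_line ((L.comp (.inr ℝ _ _)).comp ((shiftL ℝ).comp (.snd ℝ _ _))) z v 0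
  have h4 := h2.add h3
  have e : ∀ (x : Fin n → ℝ) (u : ℕ → ℝ), L (x, u) =
      (L.comp (.inl ℝ _ _)) x + (L.comp (.inr ℝ _ _)) u := fun x u => by simp [← map_add]
  rw [HasLineDerivAt, e]
  simp only [field, e]
  exact h4

/-- The Lie derivative commutes with the differential. -/
theorem lieForm_dGerm (hz₀ : z₀ ∈ Λ.dom) (r : cylRing z₀) :
    Λ.lieForm hz₀ (dGerm r) = dGerm (germD z₀ Λ.field r) := by
  obtain ⟨h, hh, rfl⟩ := exists_germ_eq r
  have hX := Λ.cylFieldAt hz₀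
  refine Subtype.ext (funext fun v => ?_)
  rw [lieForm_apply, germD_germ hh, dGerm_germ (hh.lieD hX)]
  simp only [dGerm_germ hh, dGerm_germ (Λ.cylAt_f hz₀ _)]
  rw [germD_germ (hh.lineDeriv v)]
  simp only [← germ_mul (hh.lineDeriv _) ((Λ.cylAt_f hz₀ _).lineDeriv v)]
  rw [← germ_sum _ fun i _ => (hh.lineDeriv _).mul ((Λ.cylAt_f hz₀ i).lineDeriv v),
    ← germ_add ((hh.lineDeriv v).lieD hX)
      (CylAt.sum _ fun i _ => (hh.lineDeriv _).mul ((Λ.cylAt_f hz₀ i).lineDeriv v)),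
    ← germ_add (((hh.lineDeriv v).lieD hX).add
      (CylAt.sum _ fun i _ => (hh.lineDeriv _).mul ((Λ.cylAt_f hz₀ i).lineDeriv v)))
      (hh.lineDeriv _)]
  obtain ⟨W, hW, hz, h1⟩ := hh
  refine germ_congr ?_
  filter_upwards [hW.mem_nhds hz, Λ.isOpen_dom.mem_nhds hz₀] with z hz hzd
  -- With `X` the control field, `∂ᵥ(X h) = X(∂ᵥ h) + (∂ᵥ X) h` and `∂ᵥ X = (∂ᵥ f, shift v)`; these
  -- are the three terms of `lieForm`.
  have h2 := h1.lineDeriv_comm hW hz (Λ.hasCylDeriv_field hzd v)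
  have h3 : ((fun i => lineDeriv ℝ (fun z => Λ.f (z.1, z.2 0) i) z v, shiftL ℝ v.2) : Chart n) =
      (∑ i, lineDeriv ℝ (fun z => Λ.f (z.1, z.2 0) i) z v • stateV i) + (0, shiftL ℝ v.2) := by
    rw [← state_decomp fun i => lineDeriv ℝ (fun z => Λ.f (z.1, z.2 0) i) z v]; simp
  have h4 : ∀ (s : Finset (Fin n)) (c : Fin n → ℝ), lineDeriv ℝ h z (∑ i ∈ s, c i • stateV i) =
      ∑ i ∈ s, lineDeriv ℝ h z (stateV i) * c i := by
    classical
    intro s c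
    induction s using Finset.induction_on with
    | empty => simp [lineDeriv_zero]
    | insert b s hb ih =>
      rw [Finset.sum_insert hb, Finset.sum_insert hb, h1.lineDeriv_add_dir hW hz,
        h1.lineDeriv_smul_dir hW hz, ih, smul_eq_mul, mul_comm]
  rw [h3, h1.lineDeriv_add_dir hW hz, h4] at h2
  change _ = lineDeriv ℝ (fun z => lineDeriv ℝ h z (Λ.field z)) z v
  rw [h2]
  simp only [lieD]
  ring

theorem shift_controlV_succ (n k : ℕ) :
    ((0, shiftL ℝ (controlV n (k + 1)).2) : Chart n) = controlV n k := by
  refine Prod.ext rfl (funext fun j => ?_)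
  simp [controlV, Pi.single_apply]

theorem dGerm_f_controlV_succ (hz₀ : z₀ ∈ Λ.dom) (i : Fin n) (k : ℕ) :
    (dGerm (germ z₀ fun z => Λ.f (z.1, z.2 0) i)).1 (controlV n (k + 1)) = 0 := by
  rw [dGerm_germ (Λ.cylAt_f hz₀ i), ← germ_zero]
  refine germ_congr (eventually_of_mem (Λ.isOpen_dom.mem_nhds hz₀) fun z hz => ?_)
  have h1 : ∀ t : ℝ, Λ.f ((z + t • controlV n (k + 1)).1, (z + t • controlV n (k + 1)).2 0) i =
      Λ.f (z.1, z.2 0) i := fun t => by simp [controlV]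
  simp only [lineDeriv, h1, deriv_const]

theorem germD_state (i : Fin n) : germD z₀ Λ.field (germ z₀ fun z : Chart n => z.1 i) =
    germ z₀ fun z => Λ.f (z.1, z.2 0) i := by
  rw [germD_germ (cylAt_state z₀ i)]
  congr 1
  funext z
  exact lineDeriv_state z _ i

/-- This is the differential of the identity `ℓ(f(x, u)) = u`. -/
theorem sum_ℓ_smul_dGerm_f (hz₀ : z₀ ∈ Λ.dom) :
    ∑ i, germ z₀ (fun _ => Λ.ℓ (Pi.single i 1)) • dGerm (germ z₀ fun z => Λ.f (z.1, z.2 0) i) =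
      dGerm (germ z₀ fun z : Chart n => z.2 0) := by
  have h1 : germ z₀ (fun z : Chart n => z.2 0) =
      ∑ i, germ z₀ (fun _ => Λ.ℓ (Pi.single i 1)) * germ z₀ (fun z => Λ.f (z.1, z.2 0) i) := by
    simp only [← germ_mul (CylAt.const z₀ _) (Λ.cylAt_f hz₀ _)]
    rw [← germ_sum _ fun i _ => (CylAt.const z₀ _).mul (Λ.cylAt_f hz₀ i)]
    refine germ_congr (eventually_of_mem (Λ.isOpen_dom.mem_nhds hz₀) fun z hz => ?_)
    have h2 := (Λ.graph _ hz).2.2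
    rw [← Finset.univ_sum_single (Λ.f (z.1, z.2 0)), map_sum] at h2
    simp only at h2
    beta_reduce
    refine h2.symm.trans (Finset.sum_congr rfl fun i _ => ?_)
    have : Pi.single i (Λ.f (z.1, z.2 0) i) = Λ.f (z.1, z.2 0) i • (Pi.single i 1 : Fin n → ℝ) := by
      rw [← Pi.single_smul, smul_eq_mul, mul_one]
    rw [this, map_smul, smul_eq_mul, mul_comm]
  have hsum : ∀ (s : Finset (Fin n)) (r : Fin n → cylRing z₀),
      dGerm (∑ i ∈ s, r i) = ∑ i ∈ s, dGerm (r i) := by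
    classical
    intro s r
    induction s using Finset.induction_on with
    | empty =>
      rw [Finset.sum_empty, Finset.sum_empty, ← germ_zero, dGerm_const]
    | insert b s hb ih => rw [Finset.sum_insert hb, Finset.sum_insert hb, dGerm_add, ih]
  rw [h1, hsum]
  refine Finset.sum_congr rfl fun i _ => ?_
  rw [dGerm_mul, dGerm_const, smul_zero, zero_add]

/-- The 1-forms on the solution jets, as a differential module. -/
def controlModule (hz₀ : z₀ ∈ Λ.dom) : ControlModule (cylRing z₀) (formModule z₀) n where
  δ := germD z₀ Λ.field
  D := Λ.lieForm hz₀
  e i := dGerm (germ z₀ fun z : Chart n => z.1 i)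
  ε := dGerm (germ z₀ fun z : Chart n => z.2 0)
  c k :=
    { toFun := fun α => α.1 (controlV n k)
      map_add' := fun _ _ => rfl
      map_smul' := fun _ _ => rfl }
  D_smul r α := by
    refine Subtype.ext (funext fun v => ?_)
    simp only [lieForm_apply, Submodule.coe_add, Submodule.coe_smul, Pi.add_apply, Pi.smul_apply,
      smul_eq_mul, germD_mul (Λ.cylFieldAt hz₀), mul_add, Finset.mul_sum, mul_assoc]
    abel
  e_indep := by
    rw [Fintype.linearIndependent_iff]
    intro g hg j
    have h1 := congrArg (fun α : formModule z₀ => α.1 (stateV j)) hg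
    simp only [Submodule.coe_sum, Finset.sum_apply, Submodule.coe_smul, Pi.smul_apply, dGerm_state,
      smul_eq_mul, stateV] at h1
    rw [Finset.sum_eq_single j] at h1
    · simpa [germ_one] using h1
    · intro i _ hij
      simp [hij, germ_zero]
    · simp
  c_e k i := by
    change (dGerm (germ z₀ fun z : Chart n => z.1 i)).1 (controlV n k) = 0
    rw [dGerm_state]
    exact germ_zero
  c_ε := by
    change (dGerm (germ z₀ fun z : Chart n => z.2 0)).1 (controlV n 0) = 1
    rw [dGerm_control]
    simp [controlV, germ_one]
  c_succ_ε k := by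
    change (dGerm (germ z₀ fun z : Chart n => z.2 0)).1 (controlV n (k + 1)) = 0
    rw [dGerm_control]
    simp [controlV, germ_zero]
  c_D k α := by
    change (Λ.lieForm hz₀ α).1 (controlV n (k + 1)) =
      germD z₀ Λ.field (α.1 (controlV n (k + 1))) + α.1 (controlV n k)
    rw [lieForm_apply, shift_controlV_succ]
    simp [Λ.dGerm_f_controlV_succ hz₀]
  c_fin α := by
    obtain ⟨K, hK, -⟩ := exists_form_eq α
    exact ⟨K, hK⟩
  ker α hα := by
    have : α = ∑ i, α.1 (stateV i) • dGerm (germ z₀ fun z : Chart n => z.1 i) := by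
      obtain ⟨K, -, hK⟩ := exists_form_eq α
      refine Subtype.ext (funext fun v => ?_)
      rw [hK v, Finset.sum_eq_zero (s := Finset.range K) fun k _ => by
        rw [show α.1 (controlV n k) = 0 from hα k, mul_zero], add_zero]
      simp [Finset.sum_apply, dGerm_state, mul_comm]
    rw [this]
    exact Submodule.sum_mem _ fun i _ =>
      Submodule.smul_mem _ _ (Submodule.subset_span ⟨i, rfl⟩)
  ε_mem P hP he := by
    rw [← Λ.sum_ℓ_smul_dGerm_f hz₀]
    refine Submodule.sum_mem _ fun i _ => Submodule.smul_mem _ _ ?_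
    have := hP _ (he i)
    rwa [lieForm_dGerm, germD_state] at this

end LocalForm

/-! ## The action of polynomials in `d/dt` on 1-forms -/

namespace DiffOp

variable {n : ℕ} {x₀ : Jet n}

/-- The coefficients are analytic near `x₀`. -/
def AnalyticAt (x₀ : Jet n) (p : DiffOp n) : Prop := ∀ k, CylAt x₀ (p k)

theorem AnalyticAt.add {p q : DiffOp n} (hp : p.AnalyticAt x₀) (hq : q.AnalyticAt x₀) :
    DiffOp.AnalyticAt x₀ (p + q) := fun k => (hp k).add (hq k)

theorem AnalyticAt.zero : DiffOp.AnalyticAt x₀ 0 := fun _ => CylAt.const x₀ 0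

theorem AnalyticAt.sum {ι : Type*} (s : Finset ι) {p : ι → DiffOp n}
    (hp : ∀ i ∈ s, (p i).AnalyticAt x₀) : DiffOp.AnalyticAt x₀ (∑ i ∈ s, p i) := by
  classical
  induction s using Finset.induction_on with
  | empty => exact AnalyticAt.zero
  | insert a s ha ih =>
    rw [Finset.sum_insert ha]
    exact (hp a (by simp)).add (ih fun i hi => hp i (by simp [hi]))

theorem AnalyticAt.smul {a : Jet n → ℝ} (ha : CylAt x₀ a) {q : DiffOp n}
    (hq : q.AnalyticAt x₀) : DiffOp.AnalyticAt x₀ (a • q) := fun k => ha.mul (hq k)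

theorem cylFieldAt_cartanField (x₀ : Jet n) : CylFieldAt x₀ (cartanField (n := n)) :=
  ⟨univ, isOpen_univ, mem_univ _, cylMapOn_cartanField _⟩

theorem AnalyticAt.mapRange_ddt {q : DiffOp n} (hq : q.AnalyticAt x₀) :
    DiffOp.AnalyticAt x₀ (q.mapRange ddt ddt_zero) := fun k => by
  rw [Finsupp.mapRange_apply]
  exact (hq k).lieD (cylFieldAt_cartanField x₀)

theorem AnalyticAt.mapDomain_succ {q : DiffOp n} (hq : q.AnalyticAt x₀) :
    DiffOp.AnalyticAt x₀ (q.mapDomain fun k => k + 1) := fun k => by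
  cases k with
  | zero =>
    rw [Finsupp.mapDomain_of_notMem_range _ _ (by simp)]
    exact CylAt.const x₀ 0
  | succ k =>
    rw [Finsupp.mapDomain_apply (add_left_injective 1)]
    exact hq k

theorem AnalyticAt.ddtMul {q : DiffOp n} (hq : q.AnalyticAt x₀) :
    q.ddtMul.AnalyticAt x₀ := hq.mapRange_ddt.add hq.mapDomain_succ

theorem AnalyticAt.iterate_ddtMul {q : DiffOp n} (hq : q.AnalyticAt x₀) (k : ℕ) :
    (DiffOp.ddtMul^[k] q).AnalyticAt x₀ := by
  induction k with
  | zero => exact hq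
  | succ k ih => rw [Function.iterate_succ_apply']; exact ih.ddtMul

theorem AnalyticAt.mul {p q : DiffOp n} (hp : p.AnalyticAt x₀) (hq : q.AnalyticAt x₀) :
    (p.mul q).AnalyticAt x₀ :=
  AnalyticAt.sum _ fun k _ => (hq.iterate_ddtMul k).smul (hp k)

theorem AnalyticAt.of_analyticOn {N : Set (Jet n)} (hN : IsOpen N) (hx : x₀ ∈ N) {p : DiffOp n}
    (hp : ∀ k, JetAnalyticOn N (p k)) : p.AnalyticAt x₀ :=
  fun k => ⟨N, hN, hx, jetAnalyticOn_iff.1 (hp k)⟩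

end DiffOp

namespace OneForm

theorem eval_eq_sum {n : ℕ} {θ : OneForm n} {s : Finset ℕ} (hs : ∀ j, (θ j).support ⊆ s) (x v : Jet n) :
    θ.eval x v = ∑ j, ∑ k ∈ s, θ j k x * v k j :=
  Finset.sum_congr rfl fun j _ => Finsupp.sum_of_support_subset _ (hs j) _ fun k _ => by simp

end OneForm

namespace LocalForm

variable {n : ℕ} {S : ImplicitSystem n 1} {a : (Fin n → ℝ) × (Fin n → ℝ)} (Λ : LocalForm S a)
variable {z₀ : Chart n} (hz₀ : z₀ ∈ Λ.dom)

theorem continuousOn_param : ContinuousOn Λ.param Λ.dom :=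
  continuousOn_pi.2 fun k => continuousOn_pi.2 fun i => (Λ.cylMapOn_param.apply k i).continuousOn

include hz₀

theorem eventually_param {N : Set (Jet n)} (hN : IsOpen N) (hx : Λ.param z₀ ∈ N) :
    ∀ᶠ z in 𝓝 z₀, z ∈ Λ.dom ∧ Λ.param z ∈ N := by
  have hd := Λ.isOpen_dom.mem_nhds hz₀
  filter_upwards [hd, (Λ.continuousOn_param.continuousAt hd).eventually_mem (hN.mem_nhds hx)]
    with z h1 h2 using ⟨h1, h2⟩

theorem eventually_hasLineDerivAt_comp_param {h : Jet n → ℝ} (hh : CylAt (Λ.param z₀) h) :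
    ∀ᶠ z in 𝓝 z₀, ∀ v, HasLineDerivAt ℝ (fun z => h (Λ.param z))
      (lineDeriv ℝ h (Λ.param z) (jetDeriv Λ.param z v)) z v := by
  obtain ⟨N, hN, hx, h1⟩ := hh
  filter_upwards [(Λ.eventually_param hz₀ hN hx).eventually_nhds] with z hz v
  exact h1.hasLineDerivAt_comp_map hN (hasCylDeriv_jetDeriv Λ.isOpen_dom Λ.cylMapOn_param
    hz.self_of_nhds.1 v) (hz.mono fun _ h => h.2)

theorem cylAt_comp_param {h : Jet n → ℝ} (hh : CylAt (Λ.param z₀) h) :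
    CylAt z₀ (fun z => h (Λ.param z)) := by
  obtain ⟨N, hN, hx, h1⟩ := hh
  exact ⟨Λ.dom ∩ Λ.param ⁻¹' N, Λ.continuousOn_param.isOpen_inter_preimage Λ.isOpen_dom hN,
    ⟨hz₀, hx⟩, h1.comp_map (Λ.cylMapOn_param.mono inter_subset_left) fun z hz => hz.2⟩

theorem germD_comp_param {h : Jet n → ℝ} (hh : CylAt (Λ.param z₀) h) :
    germD z₀ Λ.field (germ z₀ fun z => h (Λ.param z)) = germ z₀ fun z => ddt h (Λ.param z) := by
  rw [germD_germ (Λ.cylAt_comp_param hz₀ hh)]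
  refine germ_congr ?_
  filter_upwards [Λ.eventually_hasLineDerivAt_comp_param hz₀ hh, Λ.isOpen_dom.mem_nhds hz₀]
    with z h1 h2
  have : jetDeriv Λ.param z (Λ.field z) = cartanField (Λ.param z) := by
    funext k i; exact Λ.relatedOn_param z h2 k i
  rw [lieD, (h1 (Λ.field z)).lineDeriv, this]
  rfl

/-- The action of a polynomial in `d/dt` on 1-forms. -/
def act (p : DiffOp n) (m : formModule z₀) : formModule z₀ :=
  p.sum fun k h => germ z₀ (fun z => h (Λ.param z)) • (Λ.lieForm hz₀)^[k] m

theorem act_eq_sum {p : DiffOp n} {s : Finset ℕ} (hs : p.support ⊆ s) (m : formModule z₀) :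
    Λ.act hz₀ p m = ∑ k ∈ s, germ z₀ (fun z => p k (Λ.param z)) • (Λ.lieForm hz₀)^[k] m :=
  Finsupp.sum_of_support_subset _ hs _ fun k _ => by
    rw [show (fun z => (0 : Jet n → ℝ) (Λ.param z)) = fun _ => 0 from rfl, germ_zero, zero_smul]

theorem act_zero_op (m : formModule z₀) : Λ.act hz₀ 0 m = 0 := by
  rw [Λ.act_eq_sum hz₀ (s := ∅) (by simp), Finset.sum_empty]

/-- The analyticity hypotheses here and below are needed because `germ` sends every other function
to `0`. -/
theorem act_add {p q : DiffOp n} (hp : p.AnalyticAt (Λ.param z₀)) (hq : q.AnalyticAt (Λ.param z₀))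
    (m : formModule z₀) : Λ.act hz₀ (p + q) m = Λ.act hz₀ p m + Λ.act hz₀ q m := by
  classical
  rw [Λ.act_eq_sum hz₀ Finsupp.support_add, Λ.act_eq_sum hz₀ (Finset.subset_union_left (s₂ := q.support)),
    Λ.act_eq_sum hz₀ (Finset.subset_union_right (s₁ := p.support)), ← Finset.sum_add_distrib]
  refine Finset.sum_congr rfl fun k _ => ?_
  rw [← add_smul, ← germ_add (Λ.cylAt_comp_param hz₀ (hp k)) (Λ.cylAt_comp_param hz₀ (hq k))]
  rfl

theorem act_sum {ι : Type*} (s : Finset ι) {p : ι → DiffOp n}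
    (hp : ∀ i ∈ s, (p i).AnalyticAt (Λ.param z₀)) (m : formModule z₀) :
    Λ.act hz₀ (∑ i ∈ s, p i) m = ∑ i ∈ s, Λ.act hz₀ (p i) m := by
  classical
  induction s using Finset.induction_on with
  | empty => exact Λ.act_zero_op hz₀ m
  | insert a s ha ih =>
    rw [Finset.sum_insert ha, Finset.sum_insert ha, Λ.act_add hz₀ (hp a (by simp))
      (DiffOp.AnalyticAt.sum s fun i hi => hp i (by simp [hi])), ih fun i hi => hp i (by simp [hi])]

theorem act_smul {h : Jet n → ℝ} (hh : CylAt (Λ.param z₀) h) {q : DiffOp n}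
    (hq : q.AnalyticAt (Λ.param z₀)) (m : formModule z₀) :
    Λ.act hz₀ (h • q) m = germ z₀ (fun z => h (Λ.param z)) • Λ.act hz₀ q m := by
  rw [Λ.act_eq_sum hz₀ Finsupp.support_smul, Λ.act_eq_sum hz₀ (Finset.Subset.refl _),
    Finset.smul_sum]
  refine Finset.sum_congr rfl fun k _ => ?_
  rw [smul_smul, ← germ_mul (Λ.cylAt_comp_param hz₀ hh) (Λ.cylAt_comp_param hz₀ (hq k))]
  rfl

theorem lieForm_smul (r : cylRing z₀) (m : formModule z₀) : Λ.lieForm hz₀ (r • m) =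
    germD z₀ Λ.field r • m + r • Λ.lieForm hz₀ m := (Λ.controlModule hz₀).D_smul r m

/-- The rule `(d/dt) a = a (d/dt) + ȧ` is the Leibniz rule of the Lie derivative. It makes products
of polynomials in `d/dt` act as composites of operators. -/
theorem act_ddtMul {q : DiffOp n} (hq : q.AnalyticAt (Λ.param z₀)) (m : formModule z₀) :
    Λ.act hz₀ q.ddtMul m = Λ.lieForm hz₀ (Λ.act hz₀ q m) := by
  have h1 : Λ.act hz₀ (q.mapDomain fun k => k + 1) m =
      ∑ k ∈ q.support, germ z₀ (fun z => q k (Λ.param z)) • (Λ.lieForm hz₀)^[k + 1] m :=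
    Finsupp.sum_mapDomain_index_inj (add_left_injective 1)
  rw [DiffOp.ddtMul, Λ.act_add hz₀ hq.mapRange_ddt hq.mapDomain_succ, h1,
    Λ.act_eq_sum hz₀ Finsupp.support_mapRange, Λ.act_eq_sum hz₀ (Finset.Subset.refl _), map_sum,
    ← Finset.sum_add_distrib]
  refine Finset.sum_congr rfl fun k _ => ?_
  rw [lieForm_smul, Λ.germD_comp_param hz₀ (hq k), Finsupp.mapRange_apply,
    Function.iterate_succ_apply']

theorem act_iterate_ddtMul {q : DiffOp n} (hq : q.AnalyticAt (Λ.param z₀)) (k : ℕ)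
    (m : formModule z₀) :
    Λ.act hz₀ (DiffOp.ddtMul^[k] q) m = (Λ.lieForm hz₀)^[k] (Λ.act hz₀ q m) := by
  induction k with
  | zero => rfl
  | succ k ih =>
    rw [Function.iterate_succ_apply', Λ.act_ddtMul hz₀ (hq.iterate_ddtMul k), ih,
      Function.iterate_succ_apply']

theorem act_mul {p q : DiffOp n} (hp : p.AnalyticAt (Λ.param z₀)) (hq : q.AnalyticAt (Λ.param z₀))
    (m : formModule z₀) : Λ.act hz₀ (p.mul q) m = Λ.act hz₀ p (Λ.act hz₀ q m) := by
  rw [DiffOp.mul, Finsupp.sum,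
    Λ.act_sum hz₀ _ fun k _ => (hq.iterate_ddtMul k).smul (hp k),
    Λ.act_eq_sum hz₀ (Finset.Subset.refl p.support)]
  refine Finset.sum_congr rfl fun k _ => ?_
  rw [Λ.act_smul hz₀ (hp k) (hq.iterate_ddtMul k), Λ.act_iterate_ddtMul hz₀ hq]

theorem iterate_lieForm_zero (k : ℕ) : (Λ.lieForm hz₀)^[k] 0 = 0 := by
  induction k with
  | zero => rfl
  | succ k ih => rw [Function.iterate_succ_apply', ih, map_zero]

theorem iterate_lieForm_add (k : ℕ) (m m' : formModule z₀) :
    (Λ.lieForm hz₀)^[k] (m + m') = (Λ.lieForm hz₀)^[k] m + (Λ.lieForm hz₀)^[k] m' := by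
  induction k with
  | zero => rfl
  | succ k ih => simp only [Function.iterate_succ_apply', ih, map_add]

theorem act_zero (p : DiffOp n) : Λ.act hz₀ p 0 = 0 := by
  simp [act, Λ.iterate_lieForm_zero hz₀]

theorem act_add_form (p : DiffOp n) (m m' : formModule z₀) :
    Λ.act hz₀ p (m + m') = Λ.act hz₀ p m + Λ.act hz₀ p m' := by
  simp only [act, Λ.iterate_lieForm_add hz₀, smul_add, Finsupp.sum_add]

theorem act_sum_form (p : DiffOp n) {ι : Type*} (s : Finset ι) (m : ι → formModule z₀) :
    Λ.act hz₀ p (∑ i ∈ s, m i) = ∑ i ∈ s, Λ.act hz₀ p (m i) := by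
  classical
  induction s using Finset.induction_on with
  | empty => exact Λ.act_zero hz₀ p
  | insert a s ha ih => rw [Finset.sum_insert ha, Finset.sum_insert ha, act_add_form, ih]

theorem act_one (m : formModule z₀) : Λ.act hz₀ (Finsupp.single 0 1) m = m := by
  rw [Λ.act_eq_sum hz₀ (s := {0}) Finsupp.support_single_subset, Finset.sum_singleton,
    Finsupp.single_eq_same, show (fun z => (1 : Jet n → ℝ) (Λ.param z)) = fun _ => 1 from rfl,
    germ_one, one_smul]
  rfl

/-- `param` takes its values in `𝔛₀`, so identities that hold only there suffice for the action on
forms. -/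
theorem act_congr {N : Set (Jet n)} (hN : IsOpen N) (hx : Λ.param z₀ ∈ N) {p q : DiffOp n}
    (h : ∀ k, EqOn (p k) (q k) (N ∩ S.prolonged)) (m : formModule z₀) :
    Λ.act hz₀ p m = Λ.act hz₀ q m := by
  classical
  rw [Λ.act_eq_sum hz₀ (Finset.subset_union_left (s₁ := p.support) (s₂ := q.support)),
    Λ.act_eq_sum hz₀ (Finset.subset_union_right (s₁ := p.support))]
  refine Finset.sum_congr rfl fun k _ => ?_
  congr 1
  refine germ_congr ?_
  filter_upwards [Λ.eventually_param hz₀ hN hx] with z hz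
  exact h k ⟨hz.2, Λ.param_mem_prolonged hz.1⟩

theorem act_mem_filt (p : DiffOp n) (m : formModule z₀) :
    ∃ J, Λ.act hz₀ p m ∈ (Λ.controlModule hz₀).filt m J := by
  refine ⟨p.support.sup id + 1, Submodule.sum_mem _ fun k hk => Submodule.smul_mem _ _ ?_⟩
  exact ControlModule.iterate_mem_filt (Nat.lt_succ_of_le (Finset.le_sup (f := id) hk))

/-- The action of a matrix on a column of 1-forms. -/
def actMatrix {p q : ℕ} (A : OpMatrix n p q) (m : Fin q → formModule z₀) (i : Fin p) :
    formModule z₀ := ∑ j, Λ.act hz₀ (A i j) (m j)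

theorem actMatrix_zero {p q : ℕ} (A : OpMatrix n p q) : Λ.actMatrix hz₀ A 0 = 0 := by
  funext i
  simp [actMatrix, Λ.act_zero hz₀]

theorem actMatrix_mul {p q r : ℕ} {A : OpMatrix n p q} {B : OpMatrix n q r}
    (hA : ∀ i j, (A i j).AnalyticAt (Λ.param z₀)) (hB : ∀ i j, (B i j).AnalyticAt (Λ.param z₀))
    (m : Fin r → formModule z₀) :
    Λ.actMatrix hz₀ (A.mul B) m = Λ.actMatrix hz₀ A (Λ.actMatrix hz₀ B m) := by
  funext i
  simp only [actMatrix, OpMatrix.mul, Λ.act_sum_form hz₀]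
  rw [Finset.sum_comm]
  refine Finset.sum_congr rfl fun j _ => ?_
  rw [Λ.act_sum hz₀ _ fun k _ => (hA i k).mul (hB k j)]
  exact Finset.sum_congr rfl fun k _ => Λ.act_mul hz₀ (hA i k) (hB k j) _

theorem actMatrix_congr {N : Set (Jet n)} (hN : IsOpen N) (hx : Λ.param z₀ ∈ N) {p q : ℕ}
    {A B : OpMatrix n p q} (h : A.EqOn (N ∩ S.prolonged) B) (m : Fin q → formModule z₀) :
    Λ.actMatrix hz₀ A m = Λ.actMatrix hz₀ B m := by
  funext i
  exact Finset.sum_congr rfl fun j _ => Λ.act_congr hz₀ hN hx (h i j) _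

theorem actMatrix_rectOne {p q : ℕ} (m : Fin q → formModule z₀) (i : Fin p) (j : Fin q)
    (hij : (i : ℕ) = j) : Λ.actMatrix hz₀ (OpMatrix.rectOne n p q) m i = m j := by
  rw [actMatrix, Finset.sum_eq_single j]
  · rw [OpMatrix.rectOne, if_pos hij, act_one]
  · intro k _ hk
    rw [OpMatrix.rectOne, if_neg (fun h => hk (Fin.ext (h.symm.trans hij))), act_zero_op]
  · simp

/-- The restriction of a 1-form to the solution jets. -/
def pull (θ : OneForm n) : formModule z₀ :=
  ∑ j, Λ.act hz₀ (θ j) ((Λ.controlModule hz₀).e j)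

theorem iterate_lieForm_e (k : ℕ) (i : Fin n) :
    (Λ.lieForm hz₀)^[k] ((Λ.controlModule hz₀).e i) =
      dGerm (germ z₀ fun z => Λ.param z k i) := by
  induction k with
  | zero => rfl
  | succ k ih =>
    rw [Function.iterate_succ_apply', ih, lieForm_dGerm, germD_germ
      ⟨_, Λ.isOpen_dom, hz₀, Λ.cylMapOn_param.apply k i⟩]
    congr 1
    refine germ_congr (eventually_of_mem (Λ.isOpen_dom.mem_nhds hz₀) fun z hz => ?_)
    exact Λ.relatedOn_param z hz k i

theorem cylAt_param_lineDeriv (v : Chart n) (k : ℕ) (j : Fin n) :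
    CylAt z₀ (fun z => jetDeriv Λ.param z v k j) :=
  CylAt.lineDeriv ⟨_, Λ.isOpen_dom, hz₀, Λ.cylMapOn_param.apply k j⟩ v

theorem cylAt_eval {θ : OneForm n} (hθ : ∀ j, (θ j).AnalyticAt (Λ.param z₀)) (v : Chart n) :
    CylAt z₀ (fun z => θ.eval (Λ.param z) (jetDeriv Λ.param z v)) :=
  CylAt.sum _ fun j _ => CylAt.sum _ fun k _ =>
    (Λ.cylAt_comp_param hz₀ (hθ j k)).mul (Λ.cylAt_param_lineDeriv hz₀ v k j)

/-- Since `D^k dxⱼ` is the differential of `xⱼ⁽ᵏ⁾`, the algebraic action of a row of polynomials and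
the geometric evaluation of the form on tangent vectors coincide. -/
theorem pull_apply {θ : OneForm n} (hθ : ∀ j, (θ j).AnalyticAt (Λ.param z₀)) (v : Chart n) :
    (Λ.pull hz₀ θ).1 v = germ z₀ fun z => θ.eval (Λ.param z) (jetDeriv Λ.param z v) := by
  have h1 : ∀ j k, CylAt z₀ (fun z => θ j k (Λ.param z) * jetDeriv Λ.param z v k j) := fun j k =>
    (Λ.cylAt_comp_param hz₀ (hθ j k)).mul (Λ.cylAt_param_lineDeriv hz₀ v k j)
  simp only [OneForm.eval, Finsupp.sum]
  rw [germ_sum _ fun j _ => CylAt.sum _ fun k _ => h1 j k, pull]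
  simp only [Submodule.coe_sum, Finset.sum_apply]
  refine Finset.sum_congr rfl fun j _ => ?_
  rw [germ_sum _ fun k _ => h1 j k, Λ.act_eq_sum hz₀ (Finset.Subset.refl _)]
  simp only [Submodule.coe_sum, Finset.sum_apply]
  refine Finset.sum_congr rfl fun k _ => ?_
  rw [germ_mul (Λ.cylAt_comp_param hz₀ (hθ j k)) (Λ.cylAt_param_lineDeriv hz₀ v k j),
    Λ.iterate_lieForm_e hz₀, Submodule.coe_smul, Pi.smul_apply, smul_eq_mul,
    dGerm_germ ⟨_, Λ.isOpen_dom, hz₀, Λ.cylMapOn_param.apply k j⟩]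
  rfl

end LocalForm

/-! ## Smith pairs -/

namespace DiffOp

variable {n : ℕ}

theorem ddtMul_single_one (k : ℕ) :
    ddtMul (Finsupp.single k 1 : DiffOp n) = Finsupp.single (k + 1) 1 := by
  have h : ddt (1 : Jet n → ℝ) = 0 := by
    funext x
    change lineDeriv ℝ (fun _ => (1 : ℝ)) x _ = 0
    simp [lineDeriv]
  rw [ddtMul, Finsupp.mapRange_single, h, Finsupp.single_zero, zero_add, Finsupp.mapDomain_single]

theorem mul_one (p : DiffOp n) : p.mul (Finsupp.single 0 1) = p := by
  have h : ∀ k, ddtMul^[k] (Finsupp.single 0 1 : DiffOp n) = Finsupp.single k 1 := by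
    intro k
    induction k with
    | zero => rfl
    | succ k ih => rw [Function.iterate_succ_apply', ih, ddtMul_single_one]
  simp only [mul, h, Finsupp.smul_single, smul_eq_mul, _root_.mul_one]
  exact Finsupp.sum_single p

end DiffOp

namespace OpMatrix

variable {n p q : ℕ}

theorem rectOne_analyticOn (N : Set (Jet n)) : (rectOne n p q).AnalyticOn N := by
  intro i j k
  rw [jetAnalyticOn_iff, rectOne]
  split_ifs
  · rw [Finsupp.single_apply]
    split_ifs
    · exact CylAnOn.const 1
    · exact CylAnOn.const 0
  · exact CylAnOn.const 0

theorem mul_rectOne (A : OpMatrix n p 1) : A.mul (rectOne n 1 1) = A := by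
  funext i j
  rw [mul, Fin.sum_univ_one, rectOne, if_pos (by simp), DiffOp.mul_one]
  congr 1
  exact Subsingleton.elim _ _

end OpMatrix

namespace ImplicitSystem

variable {n : ℕ} (S : ImplicitSystem n 1)

theorem unimodular_rectOne (N : Set (Jet n)) : S.Unimodular N (OpMatrix.rectOne n 1 1) := by
  refine ⟨OpMatrix.rectOne_analyticOn N, _, OpMatrix.rectOne_analyticOn N, ?_, ?_⟩ <;>
  · rw [OpMatrix.mul_rectOne]
    exact fun i j k x _ => rfl

/-- With `B` the inverse of `U`, the column `B Û` is the last column of the identity. Exchanging the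
first and last rows of `B` turns it into `(1, 0, …, 0)ᵀ`, so this permuted `B` serves as `Q`, with
`W = 1`. -/
theorem exists_isSmithPairAt {x₀ : Jet n} (hP : S.HyperRegularAt x₀ S.P) :
    ∃ U Q, S.IsSmithPairAt x₀ U Q := by
  obtain ⟨N, hN, hx, V, U, hV, hU, hVU⟩ := hP
  obtain ⟨hUa, B, hBa, hUB, hBU⟩ := id hU
  have hn : 1 ≤ n := S.le
  let l : Fin n := ⟨n - 1, by omega⟩
  let ρ : Equiv.Perm (Fin n) := Equiv.swap ⟨0, hn⟩ l
  refine ⟨U, fun i j => B (ρ i) j, N, hN, hx, ⟨V, hV, hU, hVU⟩, OpMatrix.rectOne n 1 1,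
    ⟨fun i j k => hBa _ _ k, fun i j => U i (ρ j), fun i j k => hUa _ _ k, ?_, ?_⟩,
    S.unimodular_rectOne N, ?_⟩
  · intro i j k x hxN
    refine (hBU (ρ i) (ρ j) k hxN).trans ?_
    have : ((ρ i : Fin n) : ℕ) = ρ j ↔ (i : ℕ) = j := by
      rw [← Fin.ext_iff, ρ.injective.eq_iff, Fin.ext_iff]
    simp only [OpMatrix.rectOne, this]
  · have h1 : OpMatrix.mul (fun i j => U i (ρ j)) (fun i j => B (ρ i) j) = U.mul B := by
      funext i j
      exact Equiv.sum_comp ρ fun k => (U i k).mul (B k j)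
    rw [h1]
    exact hUB
  · rw [OpMatrix.mul_rectOne]
    intro i j k x hxN
    have hj : j = 0 := Subsingleton.elim _ _
    have h1 : (⟨n - 1 + (j : ℕ), by omega⟩ : Fin n) = l := Fin.ext (by simp [l, hj])
    have h2 : OpMatrix.mul (fun i j => B (ρ i) j) (S.hatU U) i j = (B.mul U) (ρ i) l := by
      simp only [OpMatrix.mul, hatU, h1]
    rw [h2]
    refine (hBU (ρ i) l k hxN).trans ?_
    have h3 : ((ρ i : Fin n) : ℕ) = (l : ℕ) ↔ (i : ℕ) = j := by
      have : l = ρ ⟨0, hn⟩ := (Equiv.swap_apply_left _ _).symm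
      rw [← Fin.ext_iff, this, ρ.injective.eq_iff, Fin.ext_iff, hj]
      rfl
    simp only [OpMatrix.rectOne, h3]

theorem fderiv_apply_eq_sum {p : ℕ} (A : (Fin n → ℝ) × (Fin n → ℝ) →L[ℝ] (Fin p → ℝ))
    (v w : Fin n → ℝ) (i : Fin p) : A (v, w) i =
      ∑ j, (A (Pi.single j 1, 0) i * v j + A (0, Pi.single j 1) i * w j) := by
  have h1 : ((v, w) : (Fin n → ℝ) × (Fin n → ℝ)) =
      ∑ j, (v j • ((Pi.single j 1, 0) : (Fin n → ℝ) × (Fin n → ℝ)) + w j • (0, Pi.single j 1)) := by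
    refine Prod.ext ?_ ?_
    · simpa [Prod.fst_sum] using pi_eq_sum_univ' v
    · simpa [Prod.snd_sum] using pi_eq_sum_univ' w
  rw [h1, map_sum, Finset.sum_apply]
  refine Finset.sum_congr rfl fun j _ => ?_
  rw [map_add, map_smul, map_smul, Pi.add_apply, Pi.smul_apply, Pi.smul_apply, smul_eq_mul,
    smul_eq_mul]
  ring

theorem eval_P (i : Fin (n - 1)) (x v : Jet n) :
    OneForm.eval (S.P i) x v = fderiv ℝ S.F (x 0, x 1) (v 0, v 1) i := by
  rw [fderiv_apply_eq_sum, OneForm.eval_eq_sum (s := {0, 1}) fun j => ?_]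
  · refine Finset.sum_congr rfl fun j _ => ?_
    rw [Finset.sum_pair zero_ne_one]
    simp [P]
  · classical
    refine Finsupp.support_add.trans (Finset.union_subset ?_ ?_)
    · exact Finsupp.support_single_subset.trans (by simp)
    · exact Finsupp.support_single_subset.trans (by simp)

theorem analyticAt_P {x : Jet n} (hx : (x 0, x 1) ∈ S.dom) (i : Fin (n - 1)) (j : Fin n) :
    (S.P i j).AnalyticAt x := by
  have key : ∀ v, CylAt x fun x => fderiv ℝ S.F (x 0, x 1) v i := fun v =>
    ⟨_, isOpen_jetsOver S.isOpen_dom, hx, ((CylAnOn.of_clm (jetPairL n)).comp S.analytic.fderiv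
      fun _ hx => hx).clm_comp ((ContinuousLinearMap.proj i : (Fin (n - 1) → ℝ) →L[ℝ] ℝ).comp
        (ContinuousLinearMap.apply ℝ (Fin (n - 1) → ℝ) v))⟩
  have hs : ∀ k v, DiffOp.AnalyticAt x
      (Finsupp.single k fun x : Jet n => fderiv ℝ S.F (x 0, x 1) v i) := by
    intro k v l
    rw [Finsupp.single_apply]
    split_ifs
    · exact key v
    · exact CylAt.const x 0
  exact (hs 0 _).add (hs 1 _)

end ImplicitSystem

namespace LocalForm

variable {n : ℕ} {S : ImplicitSystem n 1} {a : (Fin n → ℝ) × (Fin n → ℝ)} (Λ : LocalForm S a)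
variable {z₀ : Chart n} (hz₀ : z₀ ∈ Λ.dom)

/-- `P(F) dx` is `dF`, which vanishes on the vectors tangent to `𝔛₀`. -/
theorem actMatrix_P : Λ.actMatrix hz₀ S.P (Λ.controlModule hz₀).e = 0 := by
  funext i
  refine Subtype.ext (funext fun v => ?_)
  refine (Λ.pull_apply hz₀ (fun j => S.analyticAt_P (Λ.param_mapsTo hz₀) i j) v).trans ?_
  change _ = (0 : cylRing z₀)
  rw [← germ_zero]
  refine germ_congr (eventually_of_mem (Λ.isOpen_dom.mem_nhds hz₀) fun z hz => ?_)
  refine (S.eval_P i _ _).trans ?_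
  rw [← Λ.isTangent_jetDeriv hz v 0 i]
  exact (S.hasLineDerivAt_jetF (Λ.param_mapsTo hz) _ i).lineDeriv.symm

/-- The form defined by a Smith pair generates the module of 1-forms. -/
theorem generates_pull_omega {U Q : OpMatrix n n n} (h : S.IsSmithPairAt (Λ.param z₀) U Q) :
    (Λ.controlModule hz₀).Generates (Λ.pull hz₀ (S.omega Q 0)) ∧
      ∀ j, (S.omega Q 0 j).AnalyticAt (Λ.param z₀) := by
  obtain ⟨N, hN, hx, ⟨V, ⟨hVa, -⟩, ⟨hUa, B, hBa, hUB, -⟩, hVU⟩,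
    W, ⟨hQa, -⟩, ⟨hWa, Wi, hWia, hWW, -⟩, hQW⟩ := h
  have hn : 1 ≤ n := S.le
  have han : ∀ {p q : ℕ} {A : OpMatrix n p q}, A.AnalyticOn N →
      ∀ i j, (A i j).AnalyticAt (Λ.param z₀) :=
    fun hA i j => DiffOp.AnalyticAt.of_analyticOn hN hx (hA i j)
  have hPa : ∀ i j, (S.P i j).AnalyticAt (Λ.param z₀) :=
    fun i j => S.analyticAt_P (Λ.param_mapsTo hz₀) i j
  have mul_an : ∀ {p q r : ℕ} {A : OpMatrix n p q} {B : OpMatrix n q r},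
      (∀ i j, (A i j).AnalyticAt (Λ.param z₀)) → (∀ i j, (B i j).AnalyticAt (Λ.param z₀)) →
      ∀ i j, (A.mul B i j).AnalyticAt (Λ.param z₀) := fun hA hB i j =>
    DiffOp.AnalyticAt.sum _ fun k _ => (hA i k).mul (hB k j)
  set e := (Λ.controlModule hz₀).e with he
  -- `w = U⁻¹ dx`. Since `V P U w = V P dx = 0` and `V P U = (I, 0)`, all the entries of `w` except
  -- the last vanish; hence `dx = Û w_l`.
  set w := Λ.actMatrix hz₀ B e with hw
  have hUw : Λ.actMatrix hz₀ U w = e := by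
    rw [hw, ← Λ.actMatrix_mul hz₀ (han hUa) (han hBa), Λ.actMatrix_congr hz₀ hN hx hUB]
    exact funext fun i => Λ.actMatrix_rectOne hz₀ _ i i rfl
  let l : Fin n := ⟨n - 1, by omega⟩
  have hw0 : ∀ j, j ≠ l → w j = 0 := by
    intro j hj
    have hj' : (j : ℕ) < n - 1 := by
      have : (j : ℕ) ≠ n - 1 := fun h => hj (Fin.ext h)
      omega
    have h1 := Λ.actMatrix_congr hz₀ hN hx hVU w
    rw [Λ.actMatrix_mul hz₀ (han hVa) (mul_an hPa (han hUa)),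
      Λ.actMatrix_mul hz₀ hPa (han hUa), hUw, Λ.actMatrix_P hz₀, Λ.actMatrix_zero hz₀] at h1
    exact ((Λ.actMatrix_rectOne hz₀ w ⟨j, hj'⟩ j rfl).symm.trans (congrFun h1 _).symm)
  have hhat : ∀ i, S.hatU U i 0 = U i l := fun i => rfl
  -- `η = W⁻¹ w_l`, so that `dx = Û W η` and `η` generates. As `Q Û W = (1, 0, …, 0)ᵀ`, the first
  -- entry of `Q dx`, which is `ω₁`, equals `η`.
  set η : Fin 1 → formModule z₀ := Λ.actMatrix hz₀ Wi fun _ => w l with hη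
  have hWη : Λ.actMatrix hz₀ W η = fun _ => w l := by
    rw [hη, ← Λ.actMatrix_mul hz₀ (han hWa) (han hWia), Λ.actMatrix_congr hz₀ hN hx hWW]
    exact funext fun i => Λ.actMatrix_rectOne hz₀ _ i i rfl
  have hhata : ∀ i j, (S.hatU U i j).AnalyticAt (Λ.param z₀) := fun i j => han hUa _ _
  have hhate : Λ.actMatrix hz₀ (S.hatU U) (fun _ => w l) = e := by
    rw [← hUw]
    funext i
    rw [actMatrix, Fin.sum_univ_one, hhat, actMatrix, Finset.sum_eq_single l]
    · intro j _ hj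
      rw [hw0 j hj, act_zero]
    · simp
  have hfac : Λ.actMatrix hz₀ ((S.hatU U).mul W) η = e := by
    rw [Λ.actMatrix_mul hz₀ hhata (han hWa), hWη, hhate]
  have hpull : Λ.pull hz₀ (S.omega Q 0) = η 0 := by
    have h1 := Λ.actMatrix_congr hz₀ hN hx hQW η
    rw [Λ.actMatrix_mul hz₀ (han hQa) (mul_an hhata (han hWa)), hfac] at h1
    exact (congrFun h1 (Fin.castLE S.le 0)).trans (Λ.actMatrix_rectOne hz₀ η _ 0 rfl)
  refine ⟨fun i => ?_, fun j => han hQa _ j⟩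
  rw [hpull]
  obtain ⟨J, hJ⟩ := Λ.act_mem_filt hz₀ ((S.hatU U).mul W i 0) (η 0)
  refine ⟨J, ?_⟩
  rw [← he, ← hfac, actMatrix, Fin.sum_univ_one]
  exact hJ

/-! ## Exterior derivatives -/

theorem jetDeriv_comm {z : Chart n} (hz : z ∈ Λ.dom) (v w : Chart n) (k : ℕ) (j : Fin n) :
    lineDeriv ℝ (fun z => jetDeriv Λ.param z v k j) z w =
      lineDeriv ℝ (fun z => jetDeriv Λ.param z w k j) z v := by
  have h0 : HasCylDeriv (fun _ : Chart n => v) (0 : Chart n) z w := fun F _ _ L => by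
    rw [map_zero]
    exact hasDerivAt_const (0 : ℝ) (L v)
  have h1 := (Λ.cylMapOn_param.apply k j).lineDeriv_comm Λ.isOpen_dom hz h0
  rw [lineDeriv_zero, add_zero] at h1
  exact h1

theorem hasLineDerivAt_jetDeriv {z : Chart n} (hz : z ∈ Λ.dom) (v w : Chart n) (k : ℕ)
    (j : Fin n) : HasLineDerivAt ℝ (fun z => jetDeriv Λ.param z v k j)
      (lineDeriv ℝ (fun z => jetDeriv Λ.param z v k j) z w) z w :=
  ((Λ.cylMapOn_param.apply k j).lineDeriv_const Λ.isOpen_dom v).hasLineDerivAt Λ.isOpen_dom hz w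

include hz₀ in
/-- The exterior derivative commutes with the restriction to the solution jets. -/
theorem eventually_extDeriv {θ : OneForm n} (hθ : ∀ j, (θ j).AnalyticAt (Λ.param z₀)) :
    ∀ᶠ z in 𝓝 z₀, ∀ v w, θ.extDeriv (Λ.param z) (jetDeriv Λ.param z v) (jetDeriv Λ.param z w) =
      lineDeriv ℝ (fun z => θ.eval (Λ.param z) (jetDeriv Λ.param z w)) z v -
      lineDeriv ℝ (fun z => θ.eval (Λ.param z) (jetDeriv Λ.param z v)) z w := by
  have hd : ∀ᶠ z in 𝓝 z₀, z ∈ Λ.dom := Λ.isOpen_dom.mem_nhds hz₀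
  have h1 : ∀ j k, ∀ᶠ z in 𝓝 z₀, (∀ v, HasLineDerivAt ℝ (θ j k)
      (lineDeriv ℝ (θ j k) (Λ.param z) v) (Λ.param z) v) ∧
      ∀ v, HasLineDerivAt ℝ (fun z => θ j k (Λ.param z))
      (lineDeriv ℝ (θ j k) (Λ.param z) (jetDeriv Λ.param z v)) z v := by
    intro j k
    refine Eventually.and ?_ (Λ.eventually_hasLineDerivAt_comp_param hz₀ (hθ j k))
    exact (Λ.continuousOn_param.continuousAt (Λ.isOpen_dom.mem_nhds hz₀)).eventually
      (hθ j k).eventually_hasLineDerivAt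
  have h2 : ∀ᶠ z in 𝓝 z₀, ∀ j, ∀ k ∈ (θ j).support, _ :=
    eventually_all.2 fun j => (Finset.eventually_all _).2 fun k _ => h1 j k
  filter_upwards [h2, hd] with z h2 hz v w
  have e1 : ∀ v w, HasLineDerivAt ℝ (fun x => θ.eval x w)
      (∑ j, ∑ k ∈ (θ j).support, lineDeriv ℝ (θ j k) (Λ.param z) v * w k j) (Λ.param z) v :=
    fun v w => HasDerivAt.fun_sum fun j _ => HasDerivAt.fun_sum fun k hk =>
      HasDerivAt.mul_const ((h2 j k hk).1 v) (w k j)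
  have e2 : ∀ v w, HasLineDerivAt ℝ (fun z => θ.eval (Λ.param z) (jetDeriv Λ.param z w))
      (∑ j, ∑ k ∈ (θ j).support,
        (lineDeriv ℝ (θ j k) (Λ.param z) (jetDeriv Λ.param z v) * jetDeriv Λ.param z w k j +
        θ j k (Λ.param z) * lineDeriv ℝ (fun z => jetDeriv Λ.param z w k j) z v)) z v := by
    intro v w
    refine HasDerivAt.fun_sum fun j _ => HasDerivAt.fun_sum fun k hk => ?_
    refine HasDerivAt.congr_deriv
      (HasDerivAt.mul ((h2 j k hk).2 v) (Λ.hasLineDerivAt_jetDeriv hz w v k j)) ?_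
    simp
  rw [OneForm.extDeriv, (e1 _ _).lineDeriv, (e1 _ _).lineDeriv, (e2 _ _).lineDeriv,
    (e2 _ _).lineDeriv]
  -- On the right-hand side the tangent vectors vary with `z`; the resulting second derivatives of
  -- `param` are symmetric and cancel.
  simp only [Finset.sum_add_distrib, Λ.jetDeriv_comm hz w v]
  ring

end LocalForm

/-! ## Generators and coordinates -/

namespace ControlModule

variable {R M : Type*} [CommRing R] [AddCommGroup M] [Module R M] {n : ℕ}
  {C : ControlModule R M n} {ω : M}

/-- The matrix of `ω, Dω, …, D^{n-1}ω` in the differentials of the states is invertible. -/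
theorem Generates.isUnit_det [IsDomain R] (hn : 0 < n) (h : C.Generates ω)
    {m : Matrix (Fin n) (Fin n) R} (hm : ∀ k : Fin n, C.D^[k] ω = ∑ i, m k i • C.e i) :
    IsUnit m.det := by
  have h1 : ∀ j, ∃ A : Fin n → R, C.e j = ∑ k : Fin n, A k • C.D^[k] ω := by
    intro j
    have h2 : (fun j => C.D^[j] ω) '' Iio n = range fun k : Fin n => C.D^[k] ω := by
      ext x
      constructor
      · rintro ⟨k, hk, rfl⟩; exact ⟨⟨k, hk⟩, rfl⟩
      · rintro ⟨k, rfl⟩; exact ⟨k, k.2, rfl⟩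
    have h3 := (h.structure hn).2.2.2 j
    rw [filt, h2, Submodule.mem_span_range_iff_exists_fun] at h3
    obtain ⟨A, hA⟩ := h3
    exact ⟨A, hA.symm⟩
  choose A hA using h1
  have h2 : (Matrix.of A) * m = 1 := by
    ext j i
    have h3 : ∑ i, ((Matrix.of A * m) j i - (1 : Matrix (Fin n) (Fin n) R) j i) • C.e i = 0 := by
      simp only [sub_smul, Finset.sum_sub_distrib, Matrix.mul_apply, Matrix.one_apply, ite_smul,
        one_smul, zero_smul, Finset.sum_ite_eq, Finset.mem_univ, if_true, Matrix.of_apply]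
      rw [sub_eq_zero]
      conv_rhs => rw [hA j]
      simp only [hm, Finset.smul_sum, Finset.sum_smul, smul_smul]
      exact Finset.sum_comm
    exact sub_eq_zero.1 (Fintype.linearIndependent_iff.1 C.e_indep _ h3 i)
  have h3 := congrArg Matrix.det h2
  rw [Matrix.det_mul, Matrix.det_one] at h3
  exact IsUnit.of_mul_eq_one_right _ h3

end ControlModule

section Germs

variable {E : Type*} [AddCommGroup E] [Module ℝ E] [TopologicalSpace E] {z₀ : E}

/-- The value of germs at the base point. -/
def germValue (z₀ : E) : cylRing z₀ →+* ℝ := Germ.valueRingHom.comp (cylRing z₀).subtype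

theorem germValue_germ {h : E → ℝ} (hh : CylAt z₀ h) : germValue z₀ (germ z₀ h) = h z₀ := by
  change Germ.value (germ z₀ h : Germ (𝓝 z₀) ℝ) = _
  rw [coe_germ hh]
  rfl

theorem isUnit_iff_germValue {r : cylRing z₀} : IsUnit r ↔ germValue z₀ r ≠ 0 := by
  obtain ⟨h, hh, rfl⟩ := exists_germ_eq r
  rw [isUnit_germ_iff hh, germValue_germ hh]

end Germs

/-! ### Germs that depend on the state only -/

section States

variable {n : ℕ} {z₀ : Chart n}

theorem cylAt_comp_fst {g : (Fin n → ℝ) → ℝ} (hg : AnalyticAt ℝ g z₀.1) :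
    CylAt z₀ fun z => g z.1 := by
  obtain ⟨O, hO, hOo, hx⟩ := mem_nhds_iff.1 hg.eventually_analyticAt
  exact ⟨Prod.fst ⁻¹' O, hOo.preimage continuous_fst, hx,
    (CylAnOn.of_clm (ContinuousLinearMap.fst ℝ (Fin n → ℝ) (ℕ → ℝ))).comp (s := O)
      (fun x hx => hO hx) fun z hz => hz⟩

theorem germ_comp_fst_eq_iff {g g' : (Fin n → ℝ) → ℝ} (hg : AnalyticAt ℝ g z₀.1)
    (hg' : AnalyticAt ℝ g' z₀.1) :
    (germ z₀ fun z => g z.1) = (germ z₀ fun z => g' z.1) ↔ g =ᶠ[𝓝 z₀.1] g' := by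
  rw [germ_eq_iff (cylAt_comp_fst hg) (cylAt_comp_fst hg'), ← map_fst_nhds]
  rfl

theorem eventually_lineDeriv_comp_fst {g : (Fin n → ℝ) → ℝ} (hg : AnalyticAt ℝ g z₀.1) :
    ∀ᶠ z in 𝓝 z₀, ∀ v : Chart n, lineDeriv ℝ (fun z => g z.1) z v = fderiv ℝ g z.1 v.1 := by
  have h1 : ∀ᶠ z in 𝓝 z₀, AnalyticAt ℝ g z.1 :=
    continuous_fst.continuousAt.eventually hg.eventually_analyticAt
  filter_upwards [h1] with z hz v
  exact (hasLineDerivAt_comp_clm (L := ContinuousLinearMap.fst ℝ (Fin n → ℝ) (ℕ → ℝ)) hz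
    v).lineDeriv

/-- A germ that does not depend on the controls is a function of the state. -/
theorem exists_eq_comp_fst {r : cylRing z₀} (hr : ∀ k, (dGerm r).1 (controlV n k) = 0) :
    ∃ g : (Fin n → ℝ) → ℝ, AnalyticAt ℝ g z₀.1 ∧ r = germ z₀ fun z => g z.1 := by
  obtain ⟨h, hh, rfl⟩ := exists_germ_eq r
  obtain ⟨W, hW, hz, hW1⟩ := id hh
  obtain ⟨F, _, _, L, G, hG, e, hd⟩ := hW1.exists_deriv hW
  obtain ⟨K, hK⟩ := exists_finite_dependence (L.comp (.inr ℝ _ _))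
  have h0 : ∀ k, ∀ᶠ z in 𝓝 z₀, lineDeriv ℝ h z (controlV n k) = 0 := by
    intro k
    have := hr k
    rw [dGerm_germ hh, ← germ_zero, germ_eq_iff (hh.lineDeriv _) (CylAt.const z₀ 0)] at this
    exact this
  have hev : ∀ᶠ z in 𝓝 z₀, z ∈ W ∧ ∀ k ∈ Finset.range K, lineDeriv ℝ h z (controlV n k) = 0 :=
    Eventually.and (hW.mem_nhds hz) ((Finset.eventually_all _).2 fun k _ => h0 k)
  obtain ⟨U₁, hU₁, U₂, hU₂, hU⟩ := mem_nhds_prod_iff.1 hev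
  -- Convexity in the control variables allows `z.2` to be joined to `z₀.2` by a segment. Along it
  -- `h` is constant, because it depends on the first `K` controls at most and those partial
  -- derivatives vanish. The function of the state is `h` with the controls frozen at `z₀.2`.
  obtain ⟨T, ⟨hT, hTc⟩, hTU⟩ := (LocallyConvexSpace.convex_basis (𝕜 := ℝ) z₀.2).mem_iff.1 hU₂
  have hT0 : z₀.2 ∈ T := mem_of_mem_nhds hT
  have hx0 : z₀.1 ∈ U₁ := mem_of_mem_nhds hU₁
  have hGz : AnalyticAt ℝ G (L (z₀.1, z₀.2)) := hG _ ⟨z₀, hz, rfl⟩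
  refine ⟨fun x => G (L (x, z₀.2)), ?_, ?_⟩
  · have h1 : ∀ x, L (x, z₀.2) = L.comp (.inl ℝ _ _) x + L (0, z₀.2) := fun x => by
      simp [← map_add]
    have h2 : AnalyticAt ℝ (fun x => L.comp (.inl ℝ _ _) x + L (0, z₀.2)) z₀.1 :=
      ((L.comp (.inl ℝ _ _)).analyticAt _).add analyticAt_const
    exact (AnalyticAt.comp_of_eq hGz h2 (h1 z₀.1).symm).congr
      (Eventually.of_forall fun x => congrArg G (h1 x).symm)
  · refine germ_congr ?_
    filter_upwards [prod_mem_nhds hU₁ hT] with z hzU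
    have hseg : ∀ t ∈ Icc (0 : ℝ) 1, ((z.1, z₀.2 + t • (z.2 - z₀.2)) : Chart n) ∈ W ∧
        ∀ k ∈ Finset.range K,
          lineDeriv ℝ h (z.1, z₀.2 + t • (z.2 - z₀.2)) (controlV n k) = 0 := fun t ht =>
      hU ⟨hzU.1, hTU (hTc.add_smul_sub_mem hT0 hzU.2 ht)⟩
    set d := z.2 - z₀.2 with hdd
    set φ : ℝ → ℝ := fun t => G (L (z.1, z₀.2 + t • d)) with hφ
    have hder : ∀ t ∈ Icc (0 : ℝ) 1, HasDerivAt φ 0 t := by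
      intro t ht
      obtain ⟨hw, hk⟩ := hseg t ht
      have h1 : HasDerivAt (fun s : ℝ => L ((z.1, z₀.2) + s • ((0, d) : Chart n))) (L (0, d)) t :=
        hasDerivAt_clm_line L _ _ t
      have h2 : ∀ s : ℝ, ((z.1, z₀.2) + s • (0, d) : Chart n) = (z.1, z₀.2 + s • d) := fun s => by
        simp
      simp only [h2] at h1
      have h3 := ((hG _ ⟨_, hw, rfl⟩).differentiableAt.hasFDerivAt).comp_hasDerivAt t h1
      refine h3.congr_deriv ?_
      have h4 : L (0, d) = ∑ k ∈ Finset.range K, d k • L (controlV n k) := by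
        have h5 : (L.comp (.inr ℝ _ _)) (d - ∑ k ∈ Finset.range K, d k • Pi.single k (1 : ℝ)) = 0 := by
          refine hK _ fun k hk => ?_
          simp [Finset.sum_apply, Pi.single_apply, hk]
        rw [map_sub, sub_eq_zero, map_sum] at h5
        refine h5.trans (Finset.sum_congr rfl fun k _ => ?_)
        rw [map_smul]
        rfl
      rw [h4, map_sum]
      refine Finset.sum_eq_zero fun k hkK => ?_
      rw [map_smul, ← (hd _ hw _).lineDeriv, hk k hkK, smul_zero]
    have h2 := (convex_Icc (0 : ℝ) 1).is_const_of_fderivWithin_eq_zero (𝕜 := ℝ) (f := φ)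
      (fun t ht => (hder t ht).differentiableAt.differentiableWithinAt)
      (fun t ht => by
        rw [(hder t ht).hasFDerivAt.hasFDerivWithinAt.fderivWithin
          (uniqueDiffOn_Icc zero_lt_one t ht)]
        ext; simp)
      (right_mem_Icc.2 zero_le_one) (left_mem_Icc.2 zero_le_one)
    simp only [hφ, hdd, one_smul, add_sub_cancel, zero_smul, add_zero] at h2
    have hzW : z ∈ W := by
      have := (hseg 1 (right_mem_Icc.2 zero_le_one)).1
      simpa [hdd] using this
    rw [e z hzW]
    exact h2

end States

/-! ### Closed germs of 1-forms -/

namespace LocalForm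

variable {n : ℕ} {S : ImplicitSystem n 1} {a : (Fin n → ℝ) × (Fin n → ℝ)} (Λ : LocalForm S a)
variable {z₀ : Chart n} (hz₀ : z₀ ∈ Λ.dom)

theorem eq_sum_e {α : formModule z₀} (hα : ∀ k, α.1 (controlV n k) = 0) :
    α = ∑ i, α.1 (stateV i) • (Λ.controlModule hz₀).e i := by
  obtain ⟨K, -, hK⟩ := exists_form_eq α
  refine Subtype.ext (funext fun v => ?_)
  rw [hK v, Finset.sum_eq_zero (s := Finset.range K) fun k _ => by rw [hα k, mul_zero], add_zero]
  simp [Finset.sum_apply, dGerm_state, mul_comm, controlModule]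

theorem isUnit_det_iterate {ω : formModule z₀} (h : (Λ.controlModule hz₀).Generates ω) :
    IsUnit (Matrix.of fun k i : Fin n => ((Λ.lieForm hz₀)^[k] ω).1 (stateV i)).det :=
  h.isUnit_det S.le fun k => Λ.eq_sum_e hz₀ fun l => (h.structure S.le).1 k k.2 l

/-- `ω` is the first row of an invertible matrix, and a germ is invertible exactly when its value at
the base point is nonzero. A row without invertible entry would vanish at that point, and so would
the determinant. -/
theorem exists_isUnit_stateV {ω : formModule z₀} (h : (Λ.controlModule hz₀).Generates ω) :
    ∃ i, IsUnit (ω.1 (stateV i)) := by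
  by_contra hne
  push Not at hne
  have h1 := Λ.isUnit_det_iterate hz₀ h
  rw [isUnit_iff_germValue, RingHom.map_det] at h1
  refine h1 (Matrix.det_eq_zero_of_row_eq_zero ⟨0, S.le⟩ fun i => ?_)
  have h2 := hne i
  rw [isUnit_iff_germValue, not_not] at h2
  exact h2

/-- Closedness of germs of 1-forms. -/
def IsClosedForm (ω : formModule z₀) : Prop :=
  ∃ τ : formModule z₀, ∀ v w, germD z₀ (fun _ => v) (ω.1 w) - germD z₀ (fun _ => w) (ω.1 v) =
    τ.1 v * ω.1 w - τ.1 w * ω.1 v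

/-- `d(u ω) = (τ + du / u) ∧ u ω`. -/
theorem IsClosedForm.smul {ω : formModule z₀} (h : IsClosedForm ω) {u : cylRing z₀}
    (hu : IsUnit u) : IsClosedForm (u • ω) := by
  obtain ⟨τ, hτ⟩ := h
  obtain ⟨b, hb⟩ := hu.exists_right_inv
  refine ⟨τ + b • dGerm u, fun v w => ?_⟩
  simp only [Submodule.coe_smul, Pi.smul_apply, smul_eq_mul, Submodule.coe_add, Pi.add_apply,
    germD_mul (CylFieldAt.const z₀ _)]
  change germD z₀ (fun _ => v) u * ω.1 w + u * germD z₀ (fun _ => v) (ω.1 w) -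
    (germD z₀ (fun _ => w) u * ω.1 v + u * germD z₀ (fun _ => w) (ω.1 v)) =
    (τ.1 v + b * germD z₀ (fun _ => v) u) * (u * ω.1 w) -
    (τ.1 w + b * germD z₀ (fun _ => w) u) * (u * ω.1 v)
  linear_combination u * hτ v w - (germD z₀ (fun _ => v) u * ω.1 w -
    germD z₀ (fun _ => w) u * ω.1 v) * hb

theorem isClosedForm_pull {θ : OneForm n} (hθ : ∀ j, (θ j).AnalyticAt (Λ.param z₀))
    (h : S.OrdinaryClosedAt (Λ.param z₀) θ) : IsClosedForm (Λ.pull hz₀ θ) := by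
  obtain ⟨N, hN, hx, τ, hτ, hc⟩ := h
  have hτa : ∀ j, (τ j).AnalyticAt (Λ.param z₀) := fun j =>
    DiffOp.AnalyticAt.of_analyticOn hN hx (hτ j)
  refine ⟨Λ.pull hz₀ τ, fun v w => ?_⟩
  simp only [Λ.pull_apply hz₀ hθ, Λ.pull_apply hz₀ hτa]
  have cv := Λ.cylAt_eval hz₀ hθ v
  have cw := Λ.cylAt_eval hz₀ hθ w
  have tv := Λ.cylAt_eval hz₀ hτa v
  have tw := Λ.cylAt_eval hz₀ hτa w
  rw [germD_germ cv, germD_germ cw, ← germ_mul tv cw, ← germ_mul tw cv, sub_eq_add_neg,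
    sub_eq_add_neg, ← germ_neg (cv.lieD (CylFieldAt.const z₀ w)), ← germ_neg (tw.mul cv),
    ← germ_add (cw.lieD (CylFieldAt.const z₀ v)) (cv.lieD (CylFieldAt.const z₀ w)).neg, ← germ_add (tv.mul cw) (tw.mul cv).neg]
  refine germ_congr ?_
  filter_upwards [Λ.eventually_param hz₀ hN hx, Λ.eventually_extDeriv hz₀ hθ] with z hz h1
  have h2 := hc _ ⟨hz.2, Λ.param_mem_prolonged hz.1⟩ _ _ (Λ.isTangent_jetDeriv hz.1 v)
    (Λ.isTangent_jetDeriv hz.1 w)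
  rw [h1, sub_eq_add_neg] at h2
  exact h2.trans (sub_eq_add_neg _ _)

end LocalForm

/-! ## From closed forms to feedback linearization -/

namespace LocalForm

variable {n : ℕ} {S : ImplicitSystem n 1} {a : (Fin n → ℝ) × (Fin n → ℝ)} (Λ : LocalForm S a)
variable {z₀ : Chart n} (hz₀ : z₀ ∈ Λ.dom)

theorem germD_comp_fst {g : (Fin n → ℝ) → ℝ} (hg : AnalyticAt ℝ g z₀.1) (X : Chart n → Chart n) :
    germD z₀ X (germ z₀ fun z => g z.1) = germ z₀ fun z => fderiv ℝ g z.1 (X z).1 := by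
  rw [germD_germ (cylAt_comp_fst hg)]
  refine germ_congr ?_
  filter_upwards [eventually_lineDeriv_comp_fst hg] with z hz using hz _

/-- A closed generator is proportional to the differential of a function of the state. -/
theorem exists_generates_dGerm {ω : formModule z₀} (hω : (Λ.controlModule hz₀).Generates ω)
    (hc : IsClosedForm ω) : ∃ y : (Fin n → ℝ) → ℝ, AnalyticAt ℝ y z₀.1 ∧
      (Λ.controlModule hz₀).Generates (dGerm (germ z₀ fun z => y z.1)) := by
  obtain ⟨i₀, hi₀⟩ := Λ.exists_isUnit_stateV hz₀ hω
  obtain ⟨b, hb⟩ := hi₀.exists_left_inv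
  have hbu : IsUnit b := IsUnit.of_mul_eq_one _ hb
  -- The normalization makes the coefficient of `dx_{i₀}` equal to `1`.
  obtain ⟨τ, hτ⟩ := hc.smul hbu
  have hη := hω.of_smul hbu
  set η := b • ω with hηd
  have hη1 : η.1 (stateV i₀) = 1 := hb
  have hηc : ∀ k, η.1 (controlV n k) = 0 := fun k => hη.c_eq_zero S.le k
  have hd0 : ∀ (v : Chart n), germD z₀ (fun _ => v) (1 : cylRing z₀) = 0 := fun v => by
    rw [← germ_one, germD_const]
  -- On the pair `(∂/∂u⁽ᵏ⁾, ∂/∂x_{i₀})` the form `dη` vanishes, because the two coefficients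
  -- involved are the constants `0` and `1`; thus `τ` has no control component. The pairs `(∂/∂u⁽ᵏ⁾,
  -- ∂/∂xᵢ)` then say that the coefficients of `η` do not depend on the controls.
  have hτc : ∀ k, τ.1 (controlV n k) = 0 := by
    intro k
    have := hτ (controlV n k) (stateV i₀)
    rw [hηc, hη1, hd0, germD_zero, mul_one, mul_zero, sub_zero, sub_zero] at this
    exact this.symm
  have hηx : ∀ i, ∃ g : (Fin n → ℝ) → ℝ, AnalyticAt ℝ g z₀.1 ∧
      η.1 (stateV i) = germ z₀ fun z => g z.1 := by
    refine fun i => exists_eq_comp_fst fun k => ?_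
    have := hτ (controlV n k) (stateV i)
    rw [hηc, hτc, germD_zero, zero_mul, mul_zero, sub_zero, sub_zero] at this
    exact this
  choose g hg hηg using hηx
  let θ : (Fin n → ℝ) → (Fin n → ℝ) →L[ℝ] ℝ :=
    fun x => ∑ i, g i x • (ContinuousLinearMap.proj i : (Fin n → ℝ) →L[ℝ] ℝ)
  have hθa : ∀ x v, θ x v = ∑ i, g i x * v i := fun x v => by
    simp [θ]
  have hθ : AnalyticAt ℝ θ z₀.1 :=
    Finset.analyticAt_fun_sum _ fun i _ => (hg i).smul analyticAt_const
  have he : ∀ᶠ x in 𝓝 z₀.1, θ x (Pi.single i₀ 1) = 1 := by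
    have h1 : g i₀ =ᶠ[𝓝 z₀.1] fun _ => 1 := by
      rw [← germ_comp_fst_eq_iff (hg i₀) analyticAt_const, ← hηg, hη1, germ_one]
    filter_upwards [h1] with x hx
    simp [hθa, Pi.single_apply, hx]
  have hcl : ∀ᶠ x in 𝓝 z₀.1, ∀ v w, θ x v = 0 → θ x w = 0 →
      fderiv ℝ θ x v w = fderiv ℝ θ x w v := by
    -- The components of `τ` may still depend on the controls. This is harmless: only the vanishing
    -- of `dθ` on `ker θ` is used, and that no longer involves them.
    choose t ht hτt using fun i => exists_germ_eq (τ.1 (stateV i))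
    have h1 : ∀ i j, ∀ᶠ z in 𝓝 z₀, fderiv ℝ (g j) z.1 (Pi.single i 1) -
        fderiv ℝ (g i) z.1 (Pi.single j 1) = t i z * g j z.1 - t j z * g i z.1 := by
      intro i j
      have h2 := hτ (stateV i) (stateV j)
      have c : ∀ i j, CylAt z₀ fun z => t i z * g j z.1 := fun i j =>
        (ht i).mul (cylAt_comp_fst (hg j))
      have d : ∀ i j, CylAt z₀ fun z : Chart n => fderiv ℝ (g j) z.1 (Pi.single i 1) := fun i j =>
        ((cylAt_comp_fst (hg j)).lineDeriv (stateV i)).congr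
          ((eventually_lineDeriv_comp_fst (hg j)).mono fun z hz => (hz (stateV i)).symm)
      rw [hηg, hηg, germD_comp_fst (hg j), germD_comp_fst (hg i), ← hτt, ← hτt,
        ← germ_mul (ht i) (cylAt_comp_fst (hg j)), ← germ_mul (ht j) (cylAt_comp_fst (hg i)),
        sub_eq_add_neg, sub_eq_add_neg, ← germ_neg (c j i)] at h2
      simp only [stateV] at h2
      rw [← germ_neg (d j i), ← germ_add (d i j) (d j i).neg, ← germ_add (c i j) (c j i).neg,
        germ_eq_iff ((d i j).add (d j i).neg) ((c i j).add (c j i).neg)] at h2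
      filter_upwards [h2] with z hz
      rw [sub_eq_add_neg, sub_eq_add_neg]
      exact hz
    have h3 : ∀ᶠ x in 𝓝 z₀.1, ∀ i, AnalyticAt ℝ (g i) x :=
      eventually_all.2 fun i => (hg i).eventually_analyticAt
    have h4 : ∀ᶠ z in 𝓝 z₀, ∀ i j, _ := eventually_all.2 fun i => eventually_all.2 (h1 i)
    rw [← map_fst_nhds z₀, eventually_map] at h3 ⊢
    filter_upwards [h3, h4] with z ha hz v w hv hw
    have h5 : ∀ v w, fderiv ℝ θ z.1 v w =
        ∑ i, ∑ j, v i * w j * fderiv ℝ (g j) z.1 (Pi.single i 1) := by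
      intro v w
      have h6 : HasFDerivAt θ (∑ j, (fderiv ℝ (g j) z.1).smulRight
          (ContinuousLinearMap.proj j : (Fin n → ℝ) →L[ℝ] ℝ)) z.1 :=
        HasFDerivAt.fun_sum fun j _ => (ha j).differentiableAt.hasFDerivAt.smul_const
            (ContinuousLinearMap.proj j : (Fin n → ℝ) →L[ℝ] ℝ)
      rw [h6.fderiv, Finset.sum_comm]
      simp only [_root_.sum_apply, ContinuousLinearMap.smulRight_apply,
        _root_.smul_apply, ContinuousLinearMap.proj_apply, smul_eq_mul]
      refine Finset.sum_congr rfl fun j _ => ?_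
      conv_lhs => rw [pi_eq_sum_univ' v, map_sum]
      rw [Finset.sum_mul]
      refine Finset.sum_congr rfl fun i _ => ?_
      rw [map_smul, smul_eq_mul]
      ring
    have h7 : fderiv ℝ θ z.1 v w - fderiv ℝ θ z.1 w v =
        (∑ i, t i z * v i) * θ z.1 w - θ z.1 v * ∑ j, t j z * w j := by
      rw [h5, h5 w v, Finset.sum_comm (f := fun i j => w i * v j * _), hθa, hθa,
        Finset.sum_mul_sum, Finset.sum_mul_sum, ← Finset.sum_sub_distrib, ← Finset.sum_sub_distrib]
      refine Finset.sum_congr rfl fun i _ => ?_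
      rw [← Finset.sum_sub_distrib, ← Finset.sum_sub_distrib]
      refine Finset.sum_congr rfl fun j _ => ?_
      linear_combination v i * w j * hz i j
    rw [hv, hw, mul_zero, zero_mul, sub_zero, sub_eq_zero] at h7
    exact h7
  obtain ⟨y, hy, hyθ⟩ := exists_first_integral hθ he hcl
  refine ⟨y, hy, ?_⟩
  have hμa : AnalyticAt ℝ (fun x => fderiv ℝ y x (Pi.single i₀ 1)) z₀.1 :=
    ((ContinuousLinearMap.apply ℝ ℝ (Pi.single i₀ (1 : ℝ) : Fin n → ℝ)).analyticAt _).comp hy.fderiv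
  have hμ : ∀ᶠ x in 𝓝 z₀.1, fderiv ℝ y x (Pi.single i₀ 1) ≠ 0 ∧
      fderiv ℝ y x = fderiv ℝ y x (Pi.single i₀ 1) • θ x := by
    filter_upwards [hyθ, he] with x ⟨μ, hμ0, hμ⟩ h1
    have : fderiv ℝ y x (Pi.single i₀ 1) = μ := by
      rw [hμ, _root_.smul_apply, h1, smul_eq_mul, mul_one]
    rw [this]
    exact ⟨hμ0, hμ⟩
  have hu : IsUnit (germ z₀ fun z => fderiv ℝ y z.1 (Pi.single i₀ 1)) :=
    (isUnit_germ_iff (cylAt_comp_fst hμa)).2 hμ.self_of_nhds.1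
  have : dGerm (germ z₀ fun z => y z.1) =
      (germ z₀ fun z => fderiv ℝ y z.1 (Pi.single i₀ 1)) • η := by
    refine form_ext (fun i => ?_) fun k => ?_
    · change germD z₀ _ _ = _ * η.1 _
      rw [germD_comp_fst hy, hηg, ← germ_mul (cylAt_comp_fst hμa) (cylAt_comp_fst (hg i))]
      have h1 := hμ
      rw [← map_fst_nhds z₀, eventually_map] at h1
      refine germ_congr (h1.mono fun z hz => ?_)
      beta_reduce
      rw [hz.2, _root_.smul_apply, ← hz.2, hθa, smul_eq_mul]
      simp [stateV, Pi.single_apply]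
    · change germD z₀ _ _ = _ * η.1 _
      rw [germD_comp_fst hy, hηc, mul_zero, ← germ_zero]
      simp [controlV]
  rw [this]
  exact hη.of_smul hu

end LocalForm

/-! ### Brunovský coordinates -/

namespace LocalForm

variable {n : ℕ} {S : ImplicitSystem n 1} {a : (Fin n → ℝ) × (Fin n → ℝ)} (Λ : LocalForm S a)
variable {z₀ : Chart n} (hz₀ : z₀ ∈ Λ.dom)

/-- Freezing the derivatives of the control at their values in `z₀` gives a continuous section of `z
↦ (x, u)`. -/
theorem eventually_stateControl {P : (Fin n → ℝ) × ℝ → Prop}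
    (h : ∀ᶠ z in 𝓝 z₀, P (z.1, z.2 0)) : ∀ᶠ p in 𝓝 (z₀.1, z₀.2 0), P p := by
  have hc : Continuous fun p : (Fin n → ℝ) × ℝ => ((p.1, Function.update z₀.2 0 p.2) : Chart n) :=
    continuous_fst.prodMk (continuous_const.update 0 continuous_snd)
  have ht : Tendsto (fun p : (Fin n → ℝ) × ℝ => ((p.1, Function.update z₀.2 0 p.2) : Chart n))
      (𝓝 (z₀.1, z₀.2 0)) (𝓝 z₀) := by
    have := hc.tendsto (z₀.1, z₀.2 0)
    simpa using this
  simpa using ht.eventually h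

theorem iterate_lieForm_dGerm (r : cylRing z₀) (k : ℕ) :
    (Λ.lieForm hz₀)^[k] (dGerm r) = dGerm ((germD z₀ Λ.field)^[k] r) := by
  induction k with
  | zero => rfl
  | succ k ih => rw [Function.iterate_succ_apply', ih, lieForm_dGerm, Function.iterate_succ_apply']

include hz₀ in
theorem analyticAt_f : AnalyticAt ℝ Λ.f (z₀.1, z₀.2 0) := Λ.analytic _ hz₀

set_option maxHeartbeats 1000000 in
/-- A function of the state whose differential generates the 1-forms is, together with its
derivatives, a Brunovský coordinate system. -/
theorem exists_brunovsky {y : (Fin n → ℝ) → ℝ}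
    (hg : (Λ.controlModule hz₀).Generates (dGerm (germ z₀ fun z => y z.1))) :
    ∃ (ζ : (Fin n → ℝ) → Fin n → ℝ) (V : (Fin n → ℝ) × ℝ → ℝ), AnalyticAt ℝ ζ z₀.1 ∧
      Function.Bijective (fderiv ℝ ζ z₀.1) ∧ AnalyticAt ℝ V (z₀.1, z₀.2 0) ∧
      fderiv ℝ V (z₀.1, z₀.2 0) (0, 1) ≠ 0 ∧ ∀ᶠ p in 𝓝 (z₀.1, z₀.2 0), ∀ k : Fin n,
        fderiv ℝ ζ p.1 (Λ.f p) k = if h : (k : ℕ) + 1 < n then ζ p.1 ⟨k + 1, h⟩ else V p := by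
  have hn : 0 < n := S.le
  have hst := hg.structure hn
  have hD : ∀ k, (Λ.controlModule hz₀).D^[k] (dGerm (germ z₀ fun z => y z.1)) =
      dGerm ((germD z₀ Λ.field)^[k] (germ z₀ fun z => y z.1)) := Λ.iterate_lieForm_dGerm hz₀ _
  -- For `k < n` the form `D^k dy = dy⁽ᵏ⁾` contains no differential of the control, so `y⁽ᵏ⁾` is a
  -- function of the state.
  have hζ : ∀ k : Fin n, ∃ g : (Fin n → ℝ) → ℝ, AnalyticAt ℝ g z₀.1 ∧
      (germD z₀ Λ.field)^[k] (germ z₀ fun z => y z.1) = germ z₀ fun z => g z.1 := by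
    refine fun k => exists_eq_comp_fst fun l => ?_
    have := hst.1 k k.2 l
    rw [hD] at this
    exact this
  choose ζ hζa hζ using hζ
  let l : Fin n := ⟨n - 1, by omega⟩
  set V : (Fin n → ℝ) × ℝ → ℝ := fun p => fderiv ℝ (ζ l) p.1 (Λ.f p) with hV
  have hζA : AnalyticAt ℝ (fun x k => ζ k x) z₀.1 := AnalyticAt.pi hζa
  have hfd : ∀ x, (∀ k, AnalyticAt ℝ (ζ k) x) → ∀ v k,
      fderiv ℝ (fun x k => ζ k x) x v k = fderiv ℝ (ζ k) x v := by
    intro x hx v k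
    have := hasFDerivAt_pi.2 fun k => (hx k).differentiableAt.hasFDerivAt
    rw [this.fderiv]
    rfl
  have hVA : AnalyticAt ℝ V (z₀.1, z₀.2 0) := by
    have h1 : AnalyticAt ℝ (fun p : (Fin n → ℝ) × ℝ => fderiv ℝ (ζ l) p.1) (z₀.1, z₀.2 0) :=
      AnalyticAt.comp_of_eq (hζa l).fderiv analyticAt_fst rfl
    exact AnalyticAt.comp_of_eq
      ((ContinuousLinearMap.id ℝ ((Fin n → ℝ) →L[ℝ] ℝ)).analyticAt_bilinear _)
      (h1.prod (Λ.analyticAt_f hz₀)) rfl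
  have hnext : ∀ k : Fin n, (germD z₀ Λ.field)^[(k : ℕ) + 1] (germ z₀ fun z => y z.1) =
      germ z₀ fun z => fderiv ℝ (ζ k) z.1 (Λ.f (z.1, z.2 0)) := by
    intro k
    rw [Function.iterate_succ_apply', hζ, germD_comp_fst (hζa k)]
    rfl
  have hcyl : ∀ k : Fin n, CylAt z₀ fun z => fderiv ℝ (ζ k) z.1 (Λ.f (z.1, z.2 0)) := fun k =>
    ((cylAt_comp_fst (hζa k)).lieD (Λ.cylFieldAt hz₀)).congr
      ((eventually_lineDeriv_comp_fst (hζa k)).mono fun z hz => (hz (Λ.field z)).symm)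
  refine ⟨fun x k => ζ k x, V, hζA, ?_, hVA, ?_, ?_⟩
  · have h1 := Λ.isUnit_det_iterate hz₀ hg
    set m := Matrix.of fun k i : Fin n => ((Λ.lieForm hz₀)^[k]
      (dGerm (germ z₀ fun z => y z.1))).1 (stateV i) with hm
    -- The invertible matrix of the forms `D^k dy` has the Jacobian of `ζ` as its value at the base
    -- point.
    have h2 : ∀ k i, germValue z₀ (m k i) = fderiv ℝ (ζ k) z₀.1 (Pi.single i 1) := by
      intro k i
      have e : m k i = germ z₀ fun z => fderiv ℝ (ζ k) z.1 (Pi.single i 1) := by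
        rw [hm, Matrix.of_apply, Λ.iterate_lieForm_dGerm hz₀, hζ]
        exact germD_comp_fst (hζa k) _
      rw [e, germValue_germ]
      exact ((cylAt_comp_fst (hζa k)).lineDeriv (stateV i)).congr
          ((eventually_lineDeriv_comp_fst (hζa k)).mono fun z hz => (hz (stateV i)).symm)
    have h3 : IsUnit ((germValue z₀).mapMatrix m).det := by
      rw [← RingHom.map_det]; exact h1.map _
    have h4 : ∀ v, fderiv ℝ (fun x k => ζ k x) z₀.1 v = ((germValue z₀).mapMatrix m).mulVec v := by
      intro v
      funext k
      rw [hfd _ hζa]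
      conv_lhs => rw [pi_eq_sum_univ' v, map_sum]
      refine Finset.sum_congr rfl fun i _ => ?_
      rw [map_smul, smul_eq_mul, ← h2, mul_comm]
      rfl
    have h5 : ⇑(fderiv ℝ (fun x k => ζ k x) z₀.1) = ((germValue z₀).mapMatrix m).mulVec :=
      funext h4
    rw [h5]
    have h6 := (Matrix.isUnit_iff_isUnit_det _).2 h3
    exact ⟨Matrix.mulVec_injective_iff_isUnit.2 h6, Matrix.mulVec_surjective_iff_isUnit.2 h6⟩
  · have h2 := hnext l
    rw [show (l : ℕ) + 1 = n from Nat.sub_add_cancel hn] at h2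
    -- `V` represents `y⁽ⁿ⁾`, and the coefficient of `du` in `Dⁿ dy` is invertible.
    have h3 : IsUnit ((dGerm (germ z₀ fun z => V (z.1, z.2 0))).1 (controlV n 0)) := by
      have h1 := (hD n).trans (congrArg dGerm h2)
      have h4 := hst.2.1
      rw [h1] at h4
      exact h4
    rw [dGerm_germ (hcyl l), isUnit_germ_iff ((hcyl l).lineDeriv _)] at h3
    have h4 := (hasLineDerivAt_comp_clm (L := stateControlL n) (x := z₀) hVA
      (controlV n 0)).lineDeriv
    have h5 : stateControlL n (controlV n 0) = (0, 1) := by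
      refine Prod.ext rfl ?_
      change (Pi.single 0 (1 : ℝ) : ℕ → ℝ) 0 = 1
      simp
    rw [h5] at h4
    have h6 : fderiv ℝ V (stateControlL n z₀) (0, 1) ≠ 0 := by
      rw [← h4]; exact h3
    exact h6
  · have h1 : ∀ k : Fin n, ∀ᶠ z in 𝓝 z₀, fderiv ℝ (ζ k) z.1 (Λ.f (z.1, z.2 0)) =
        if h : (k : ℕ) + 1 < n then ζ ⟨k + 1, h⟩ z.1 else V (z.1, z.2 0) := by
      intro k
      split_ifs with h
      · have h2 := hζ ⟨k + 1, h⟩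
        rw [hnext, germ_eq_iff (hcyl k) (cylAt_comp_fst (hζa _))] at h2
        exact h2
      · have : k = l := Fin.ext (by have := k.2; simp only [l]; omega)
        rw [this]
        exact Eventually.of_forall fun z => rfl
    have h2 : ∀ᶠ z in 𝓝 z₀, ∀ k, AnalyticAt ℝ (ζ k) z.1 :=
      continuous_fst.continuousAt.eventually (eventually_all.2 fun k => (hζa k).eventually_analyticAt)
    refine eventually_stateControl ?_
    filter_upwards [h2, eventually_all.2 h1] with z hz h3 k
    rw [hfd _ hz]
    exact h3 k

end LocalForm

/-! ## Chains of integrators -/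

section Brunovsky

variable (n : ℕ)

/-- The matrix of a chain of integrators. -/
def chainA : Matrix (Fin n) (Fin n) ℝ := Matrix.of fun k j => if (j : ℕ) = k + 1 then 1 else 0

/-- The input matrix of a chain of integrators. -/
def chainB : Matrix (Fin n) (Fin 1) ℝ := Matrix.of fun k _ => if (k : ℕ) + 1 = n then 1 else 0

variable {n}

theorem chainA_mulVec (z : Fin n → ℝ) (k : Fin n) :
    (chainA n).mulVec z k = if h : (k : ℕ) + 1 < n then z ⟨k + 1, h⟩ else 0 := by
  simp only [Matrix.mulVec, dotProduct, chainA, Matrix.of_apply, ite_mul, one_mul, zero_mul]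
  split_ifs with h
  · rw [Finset.sum_eq_single ⟨k + 1, h⟩ (fun j _ hj => if_neg fun e => hj (Fin.ext e)) (by simp)]
    simp
  · exact Finset.sum_eq_zero fun j _ => if_neg fun e : (j : ℕ) = k + 1 => h (e ▸ j.2)

theorem chainB_mulVec (v : Fin 1 → ℝ) (k : Fin n) :
    (chainB n).mulVec v k = if (k : ℕ) + 1 = n then v 0 else 0 := by
  simp [Matrix.mulVec, dotProduct, chainB]

/-- `A^j B` is the basis vector of index `n - 1 - j`, and zero for `j ≥ n`. -/
theorem controllable_chain : ImplicitSystem.Controllable (chainA n) (chainB n) := by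
  have h1 : ∀ (j : ℕ) (k : Fin n), ((chainA n ^ j * chainB n).mulVec fun _ => 1) k =
      if (k : ℕ) + 1 + j = n then 1 else 0 := by
    intro j
    induction j with
    | zero => intro k; simp [chainB_mulVec]
    | succ j ih =>
      intro k
      rw [pow_succ', Matrix.mul_assoc, ← Matrix.mulVec_mulVec, chainA_mulVec]
      split_ifs with h1 h2 h2
      · rw [ih, if_pos]; simp only; omega
      · rw [ih, if_neg]; simp only; omega
      · omega
      · rfl
  rw [ImplicitSystem.Controllable, eq_top_iff]
  rintro v -
  rw [pi_eq_sum_univ' v]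
  refine Submodule.sum_mem _ fun i _ => Submodule.smul_mem _ _ (Submodule.subset_span
    ⟨n - 1 - i, fun _ => 1, ?_⟩)
  funext k
  have hi := i.2
  have hk := k.2
  rw [h1, Pi.single_apply]
  by_cases h : k = i
  · rw [if_pos h, if_pos (by rw [h]; omega)]
  · rw [if_neg h, if_neg fun e => h (Fin.ext (by omega))]

end Brunovsky

/-! ### The linearizing feedback -/

theorem bijective_of_apply_eq_mul {A : (Fin 1 → ℝ) → Fin 1 → ℝ} {c : ℝ} (hc : c ≠ 0)
    (h : ∀ v, A v 0 = c * v 0) : Function.Bijective A := by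
  constructor
  · intro v w hvw
    funext i
    rw [Subsingleton.elim i 0]
    have := congrFun hvw 0
    rw [h, h] at this
    exact mul_left_cancel₀ hc this
  · intro w
    refine ⟨fun _ => c⁻¹ * w 0, funext fun i => ?_⟩
    rw [Subsingleton.elim i 0, h, mul_inv_cancel_left₀ hc]

theorem isInvertible_of_apply_one_ne_zero {A : ℝ →L[ℝ] ℝ} (h : A 1 ≠ 0) : A.IsInvertible := by
  refine ⟨ContinuousLinearEquiv.unitsEquivAut ℝ (Units.mk0 _ h), ?_⟩
  ext
  simp [ContinuousLinearEquiv.unitsEquivAut]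

theorem staticFeedbackLinearizableAt_of_closed {n : ℕ} {S : ImplicitSystem n 1} {x₀ : Jet n}
    (hx₀ : x₀ ∈ S.prolonged) {U Q : OpMatrix n n n} (hUQ : S.IsSmithPairAt x₀ U Q)
    (hc : S.OrdinaryClosedAt x₀ (S.omega Q 0)) : S.StaticFeedbackLinearizableAt x₀ := by
  obtain ⟨Λ⟩ := exists_localForm S hx₀.1 (funext fun i => hx₀.2 0 i)
  have hO₂ : x₀ ∈ ImplicitSystem.jetsOver Λ.O₂ := Λ.mem_O₂
  have hz₀ := Λ.coord_mem_dom hx₀ hO₂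
  have hp := Λ.param_coord hx₀ hO₂
  set z₀ := Λ.coord x₀ with hz
  rw [← hp] at hUQ hc
  obtain ⟨hg, ha⟩ := Λ.generates_pull_omega hz₀ hUQ
  obtain ⟨y, -, hgy⟩ := Λ.exists_generates_dGerm hz₀ hg (Λ.isClosedForm_pull hz₀ ha hc)
  obtain ⟨ζ, V, hζ, hζb, hVa, hV1, hdyn⟩ := Λ.exists_brunovsky hz₀ hgy
  set u₀ : ℝ := z₀.2 0 with hu₀
  have hz1 : z₀.1 = x₀ 0 := rfl
  have hu1 : u₀ = Λ.ℓ (x₀ 1) := rfl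
  rw [hz1] at hζ hζb hVa hV1 hdyn
  set v₀ : ℝ := V (x₀ 0, u₀) with hv₀
  have hfa : AnalyticAt ℝ Λ.f (x₀ 0, u₀) := Λ.analytic _ hz₀
  -- the feedback
  let G : ((Fin n → ℝ) × ℝ) × ℝ → ℝ := fun q => V (q.1.1, q.2) - q.1.2
  have hG1 : AnalyticAt ℝ (fun q : ((Fin n → ℝ) × ℝ) × ℝ => V (q.1.1, q.2)) ((x₀ 0, v₀), u₀) :=
    AnalyticAt.comp_of_eq hVa
      ((analyticAt_fst.comp_of_eq analyticAt_fst rfl).prod analyticAt_snd) rfl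
  have hGa : AnalyticAt ℝ G ((x₀ 0, v₀), u₀) :=
    hG1.sub (analyticAt_snd.comp_of_eq analyticAt_fst rfl)
  have hG0 : G ((x₀ 0, v₀), u₀) = 0 := sub_self _
  have hGi : (fderiv ℝ G ((x₀ 0, v₀), u₀) ∘L .inr ℝ _ _) 1 ≠ 0 := by
    have h1 := (hGa.differentiableAt.hasFDerivAt).comp_hasDerivAt u₀
      ((hasDerivAt_const u₀ (x₀ 0, v₀)).prodMk (hasDerivAt_id u₀))
    have h2 := ((hVa.differentiableAt.hasFDerivAt).comp_hasDerivAt u₀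
      ((hasDerivAt_const u₀ (x₀ 0)).prodMk (hasDerivAt_id u₀))).sub_const v₀
    have h3 := h1.unique h2
    change fderiv ℝ G ((x₀ 0, v₀), u₀) ((0, 0), 1) ≠ 0
    rw [show (((0, 0), 1) : ((Fin n → ℝ) × ℝ) × ℝ) = (0, 1) from rfl, h3]
    exact hV1
  -- The feedback `u = ψ(x, v)` solves `V(x, u) = v`; differentiating this in `v` gives `∂ψ/∂v ≠ 0`.
  obtain ⟨ψ, hψa, hψ0, hψ, -⟩ :=
    exists_analytic_implicit hGa (isInvertible_of_apply_one_ne_zero hGi)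
  have hψV : ∀ᶠ q in 𝓝 (x₀ 0, v₀), V (q.1, ψ q) = q.2 := by
    filter_upwards [hψ] with q hq
    rw [hG0] at hq
    exact sub_eq_zero.1 hq
  have hψ1 : fderiv ℝ ψ (x₀ 0, v₀) (0, 1) ≠ 0 := by
    have hline : HasDerivAt (fun t : ℝ => ((x₀ 0, t) : (Fin n → ℝ) × ℝ)) (0, 1) v₀ :=
      (hasDerivAt_const v₀ (x₀ 0)).prodMk (hasDerivAt_id v₀)
    have h1 := (hψa.differentiableAt.hasFDerivAt).comp_hasDerivAt v₀ hline
    have hVd : HasFDerivAt V (fderiv ℝ V (x₀ 0, u₀)) (x₀ 0, (ψ ∘ fun t : ℝ => (x₀ 0, t)) v₀) := by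
      change HasFDerivAt V _ (x₀ 0, ψ (x₀ 0, v₀))
      rw [hψ0]
      exact hVa.differentiableAt.hasFDerivAt
    have h2 := hVd.comp_hasDerivAt v₀ ((hasDerivAt_const v₀ (x₀ 0)).prodMk h1)
    have h3 : HasDerivAt (fun t : ℝ => t) 1 v₀ := hasDerivAt_id v₀
    have h4 := h2.unique (h3.congr_of_eventuallyEq (hline.continuousAt.eventually hψV))
    intro h0
    simp only at h4
    rw [h0] at h4
    rw [show ((0, 0) : (Fin n → ℝ) × ℝ) = 0 from rfl, map_zero] at h4
    exact zero_ne_one h4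
  -- The local form has its control in `ℝ`, the definition of linearizability in `Fin 1 → ℝ`; `e₁`
  -- translates.
  let e₁ : (Fin n → ℝ) × (Fin 1 → ℝ) →L[ℝ] (Fin n → ℝ) × ℝ :=
    (ContinuousLinearMap.fst ℝ _ _).prod
      ((ContinuousLinearMap.proj 0).comp (ContinuousLinearMap.snd ℝ _ _))
  have he₁ : ∀ p, e₁ p = (p.1, p.2 0) := fun p => rfl
  have hcomp : ∀ {H : Type} [NormedAddCommGroup H] [NormedSpace ℝ H]
      {g : (Fin n → ℝ) × ℝ → H} {x : Fin n → ℝ} {c : ℝ}, AnalyticAt ℝ g (x, c) →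
      AnalyticAt ℝ (fun p => g (e₁ p)) (x, fun _ => c) ∧ ∀ w : Fin 1 → ℝ,
        fderiv ℝ (fun p => g (e₁ p)) (x, fun _ => c) (0, w) = w 0 • fderiv ℝ g (x, c) (0, 1) := by
    intro H _ _ g x c hg
    refine ⟨AnalyticAt.comp_of_eq hg (e₁.analyticAt _) rfl, fun w => ?_⟩
    have h1 : HasFDerivAt g (fderiv ℝ g (x, c)) (e₁ (x, fun _ => c)) :=
      hg.differentiableAt.hasFDerivAt
    have h2 : HasFDerivAt (fun p => g (e₁ p)) ((fderiv ℝ g (x, c)).comp e₁) (x, fun _ => c) :=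
      h1.comp _ e₁.hasFDerivAt
    rw [h2.fderiv, ContinuousLinearMap.comp_apply, he₁, ← map_smul]
    simp
  have hfb : Λ.f (x₀ 0, u₀) = x₀ 1 := Λ.f_base
  have hOn : ∀ᶠ p in 𝓝 (x₀ 0, u₀), p ∈ Λ.O := Λ.isOpen_O.mem_nhds hz₀
  refine ⟨fun p => Λ.f (e₁ p), fun _ => u₀, ⟨(hcomp hfa).1, hfb, ?_, ?_⟩, ζ,
    fun p _ => ψ (e₁ p), fun _ => v₀, chainA n, chainB n, hζ, hζb, ?_, ?_, ?_,
    controllable_chain, ?_⟩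
  · have h1 : Λ.ℓ (fderiv ℝ Λ.f (x₀ 0, u₀) (0, 1)) = 1 := by
      have h2 := Λ.ℓ.hasFDerivAt.comp_hasDerivAt u₀
        ((hfa.differentiableAt.hasFDerivAt).comp_hasDerivAt u₀
          ((hasDerivAt_const u₀ (x₀ 0)).prodMk (hasDerivAt_id u₀)))
      have hline : HasDerivAt (fun t : ℝ => ((x₀ 0, t) : (Fin n → ℝ) × ℝ)) (0, 1) u₀ :=
        (hasDerivAt_const u₀ (x₀ 0)).prodMk (hasDerivAt_id u₀)
      refine h2.unique ((hasDerivAt_id u₀).congr_of_eventuallyEq ?_)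
      filter_upwards [hline.continuousAt.eventually hOn] with t ht
      exact (Λ.graph _ ht).2.2
    intro v w hvw
    simp only [(hcomp hfa).2] at hvw
    have h2 := congrArg Λ.ℓ hvw
    rw [map_smul, map_smul, h1, smul_eq_mul, smul_eq_mul, mul_one, mul_one] at h2
    funext i
    rw [Subsingleton.elim i 0, h2]
  · have ht : Tendsto e₁ (𝓝 (x₀ 0, fun _ => u₀)) (𝓝 (x₀ 0, u₀)) := e₁.continuous.tendsto _
    filter_upwards [ht.eventually hOn] with p hp
    exact (Λ.graph _ hp).2.1
  · exact AnalyticAt.pi fun _ => (hcomp hψa).1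
  · exact funext fun _ => hψ0
  · refine bijective_of_apply_eq_mul hψ1 fun v => ?_
    have h1 := hasFDerivAt_pi.2 fun _ : Fin 1 =>
      (hcomp hψa).1.differentiableAt.hasFDerivAt
    rw [h1.fderiv]
    exact ((hcomp hψa).2 v).trans (mul_comm _ _)
  · have ht : Tendsto e₁ (𝓝 (x₀ 0, fun _ => v₀)) (𝓝 (x₀ 0, v₀)) := e₁.continuous.tendsto _
    have ht2 : Tendsto (fun q : (Fin n → ℝ) × ℝ => (q.1, ψ q)) (𝓝 (x₀ 0, v₀)) (𝓝 (x₀ 0, u₀)) := by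
      have : ContinuousAt (fun q : (Fin n → ℝ) × ℝ => (q.1, ψ q)) (x₀ 0, v₀) :=
        continuousAt_fst.prodMk hψa.continuousAt
      have h2 := this.tendsto
      rwa [show ψ (x₀ 0, v₀) = u₀ from hψ0] at h2
    filter_upwards [ht.eventually hψV, (ht2.comp ht).eventually hdyn] with p h1 h2
    funext k
    refine (h2 k).trans ?_
    rw [Pi.add_apply, chainA_mulVec, chainB_mulVec]
    have hk := k.2
    split_ifs with h3 h4 h4
    · omega
    · simp [he₁]
    · rw [zero_add]; exact h1
    · omega

/-! ## Brunovský form of a controllable system -/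

section Kalman

variable {n : ℕ} {A : Matrix (Fin n) (Fin n) ℝ} {B : Matrix (Fin n) (Fin 1) ℝ}

theorem mulVec_fin_one (M : Matrix (Fin n) (Fin 1) ℝ) (v : Fin 1 → ℝ) :
    M.mulVec v = v 0 • M.mulVec fun _ => 1 := by
  rw [← Matrix.mulVec_smul]
  congr 1
  funext i
  simp [Subsingleton.elim i 0]

/-- Cayley–Hamilton: `X^k` is reduced modulo the characteristic polynomial. -/
theorem pow_mem_span_pow (A : Matrix (Fin n) (Fin n) ℝ) (k : ℕ) :
    A ^ k ∈ Submodule.span ℝ (range fun j : Fin n => A ^ (j : ℕ)) := by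
  rw [Matrix.pow_eq_aeval_mod_charpoly, Polynomial.aeval_eq_sum_range]
  refine Submodule.sum_mem _ fun i hi => ?_
  by_cases h : i < n
  · exact Submodule.smul_mem _ _ (Submodule.subset_span ⟨⟨i, h⟩, rfl⟩)
  · rw [Polynomial.coeff_eq_zero_of_degree_lt, zero_smul]
    · exact zero_mem _
    · refine (Polynomial.degree_modByMonic_lt _ A.charpoly_monic).trans_le ?_
      rw [Matrix.charpoly_degree_eq_dim, Fintype.card_fin]
      exact_mod_cast not_lt.1 h

/-- With `b = B 1`, `c` is the last row of the inverse of the Kalman matrix with columns `b, A b, …,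
A^{n-1} b`. On these columns the functionals `c A^i` take the values `c A^{i+j} b`, which are `0`
for `i + j < n - 1` and `1` for `i + j = n - 1`. This antitriangular matrix is invertible, so the
functionals separate points. -/
theorem exists_brunovsky_row (hn : 0 < n) (h : ImplicitSystem.Controllable A B) :
    ∃ c : Fin n → ℝ,
      (∀ k, k + 1 < n → c ⬝ᵥ (A ^ k).mulVec (B.mulVec fun _ => 1) = 0) ∧
      c ⬝ᵥ (A ^ (n - 1)).mulVec (B.mulVec fun _ => 1) = 1 ∧
      ∀ z, (∀ k : Fin n, c ⬝ᵥ (A ^ (k : ℕ)).mulVec z = 0) → z = 0 := by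
  set b := B.mulVec fun _ => 1 with hb
  let K : Matrix (Fin n) (Fin n) ℝ := Matrix.of fun i j => (A ^ (j : ℕ)).mulVec b i
  have hK : ∀ a, K.mulVec a = ∑ j, a j • (A ^ (j : ℕ)).mulVec b := by
    intro a
    funext i
    simp [K, Matrix.mulVec, dotProduct, Finset.sum_apply, mul_comm]
  have hsurj : Function.Surjective K.mulVec := by
    have h1 : (⊤ : Submodule ℝ (Fin n → ℝ)) ≤ LinearMap.range K.mulVecLin := by
      rw [← show _ = ⊤ from h, Submodule.span_le]
      rintro _ ⟨k, v, rfl⟩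
      rw [mulVec_fin_one, ← Matrix.mulVec_mulVec]
      refine Submodule.smul_mem _ _ ?_
      have h2 := pow_mem_span_pow A k
      rw [Submodule.mem_span_range_iff_exists_fun] at h2
      obtain ⟨a, ha⟩ := h2
      refine ⟨a, ?_⟩
      rw [Matrix.mulVecLin_apply, hK, ← ha, Matrix.sum_mulVec]
      simp only [Matrix.smul_mulVec]
      rfl
    intro z
    exact h1 (Submodule.mem_top : z ∈ ⊤)
  have hKu := Matrix.mulVec_surjective_iff_isUnit.1 hsurj
  let l : Fin n := ⟨n - 1, by omega⟩
  have hc : ∀ j : Fin n, K⁻¹ l ⬝ᵥ (A ^ (j : ℕ)).mulVec b = if l = j then 1 else 0 := by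
    intro j
    have h1 := congrFun (congrFun (Matrix.nonsing_inv_mul K
      ((Matrix.isUnit_iff_isUnit_det _).1 hKu)) l) j
    rw [Matrix.one_apply] at h1
    exact h1
  have hc0 : ∀ k, k + 1 < n → K⁻¹ l ⬝ᵥ (A ^ k).mulVec b = 0 := by
    intro k hk
    have := hc ⟨k, by omega⟩
    rwa [if_neg fun e => by have := congrArg Fin.val e; simp only [l] at this; omega] at this
  have hc1 : K⁻¹ l ⬝ᵥ (A ^ (n - 1)).mulVec b = 1 := by simpa [l] using hc l
  refine ⟨K⁻¹ l, hc0, hc1, fun z hz => ?_⟩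
  obtain ⟨a, rfl⟩ := hsurj z
  have hr : ∀ i, K⁻¹ l ⬝ᵥ (A ^ i).mulVec (K.mulVec a) =
      ∑ j, a j * K⁻¹ l ⬝ᵥ (A ^ (i + j)).mulVec b := by
    intro i
    rw [hK, Matrix.mulVec_sum, dotProduct_sum]
    refine Finset.sum_congr rfl fun j _ => ?_
    rw [Matrix.mulVec_smul, dotProduct_smul, Matrix.mulVec_mulVec, pow_add, smul_eq_mul]
  have ha : ∀ i, ∀ j : Fin n, (j : ℕ) + i + 1 = n → a j = 0 := by
    intro i
    induction i using Nat.strong_induction_on with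
    | _ i ih =>
      intro j hj
      have h1 := hz ⟨i, by omega⟩
      rw [hr, Finset.sum_eq_single j] at h1
      · rwa [show i + (j : ℕ) = n - 1 by omega, hc1, mul_one] at h1
      · intro m _ hm
        rcases lt_or_gt_of_ne (Fin.val_ne_of_ne hm) with h2 | h2
        · rw [hc0 _ (by simp only; omega), mul_zero]
        · rw [ih (n - 1 - m) (by omega) m (by have := m.2; omega), zero_mul]
      · simp
  have : a = 0 := funext fun j => ha (n - 1 - j) j (by have := j.2; omega)
  rw [this, Matrix.mulVec_zero]

end Kalman

/-- A static feedback linearizable system is a chain of integrators in suitable coordinates. -/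
theorem exists_chain_form {n : ℕ} {S : ImplicitSystem n 1} {x₀ : Jet n}
    (h : S.StaticFeedbackLinearizableAt x₀) :
    ∃ (ζ : (Fin n → ℝ) → Fin n → ℝ) (g : (Fin n → ℝ) × ℝ → Fin n → ℝ) (w₀ : ℝ),
      AnalyticAt ℝ ζ (x₀ 0) ∧ Function.Bijective (fderiv ℝ ζ (x₀ 0)) ∧
      AnalyticAt ℝ g (x₀ 0, w₀) ∧ g (x₀ 0, w₀) = x₀ 1 ∧
      (∀ᶠ p in 𝓝 (x₀ 0, w₀), S.F (p.1, g p) = 0) ∧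
      ∀ᶠ p in 𝓝 (x₀ 0, w₀), ∀ k : Fin n, fderiv ℝ ζ p.1 (g p) k =
        if h : (k : ℕ) + 1 < n then ζ p.1 ⟨k + 1, h⟩ else p.2 := by
  obtain ⟨f, u₀, ⟨hf, hf0, -, hF⟩, ζ, α, v₀, A, B, hζ, hζb, hα, hα0, -, hAB, hdyn⟩ := h
  obtain ⟨c, hc0, hc1, hcz⟩ := exists_brunovsky_row S.le hAB
  let r : ℕ → (Fin n → ℝ) →L[ℝ] ℝ := fun k => LinearMap.toContinuousLinearMap
    ((dotProductBilin ℝ ℝ c).comp (A ^ k).mulVecLin)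
  have hr : ∀ k z, r k z = c ⬝ᵥ (A ^ k).mulVec z := fun k z => rfl
  -- The chain coordinates are `c A^k ζ(x)`: the drift shifts `k` by one, and the input enters only
  -- for `k = n - 1`.
  let T : (Fin n → ℝ) →L[ℝ] (Fin n → ℝ) := ContinuousLinearMap.pi fun k : Fin n => r k
  have hT : Function.Bijective T := by
    have : Function.Injective T := (injective_iff_map_eq_zero _).2 fun z hz =>
      hcz z fun k => congrFun hz k
    exact ⟨this, (LinearMap.injective_iff_surjective (f := (T : (Fin n → ℝ) →ₗ[ℝ] _))).1 this⟩
  -- The new control is `w = v + c A^n ζ(x)`, which absorbs the drift of the last integrator.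
  let κ : (Fin n → ℝ) × ℝ → (Fin n → ℝ) × (Fin 1 → ℝ) := fun p => (p.1, fun _ => p.2 - r n (ζ p.1))
  set w₀ : ℝ := v₀ 0 + r n (ζ (x₀ 0)) with hw₀
  have hκ0 : κ (x₀ 0, w₀) = (x₀ 0, v₀) := by
    refine Prod.ext rfl (funext fun i => ?_)
    simp [κ, hw₀, Subsingleton.elim i 0]
  have hζ1 : AnalyticAt ℝ (fun p : (Fin n → ℝ) × ℝ => ζ p.1) (x₀ 0, w₀) :=
    AnalyticAt.comp_of_eq hζ analyticAt_fst rfl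
  have hκ : AnalyticAt ℝ κ (x₀ 0, w₀) := by
    refine analyticAt_fst.prod (AnalyticAt.pi fun _ => analyticAt_snd.sub ?_)
    exact AnalyticAt.comp_of_eq ((r n).analyticAt _) hζ1 rfl
  let χ : (Fin n → ℝ) × ℝ → (Fin n → ℝ) × (Fin 1 → ℝ) := fun p => (p.1, α (κ p))
  have hχ0 : χ (x₀ 0, w₀) = (x₀ 0, u₀) := Prod.ext rfl (by simp only [χ]; rw [hκ0, hα0])
  have hχ : AnalyticAt ℝ χ (x₀ 0, w₀) :=
    analyticAt_fst.prod (AnalyticAt.comp_of_eq hα hκ hκ0)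
  have tκ : Tendsto κ (𝓝 (x₀ 0, w₀)) (𝓝 (x₀ 0, v₀)) := by
    have := hκ.continuousAt.tendsto
    rwa [hκ0] at this
  have tχ : Tendsto χ (𝓝 (x₀ 0, w₀)) (𝓝 (x₀ 0, u₀)) := by
    have := hχ.continuousAt.tendsto
    rwa [hχ0] at this
  have hTd : ∀ x, AnalyticAt ℝ ζ x → fderiv ℝ (fun x => T (ζ x)) x = T.comp (fderiv ℝ ζ x) :=
    fun x hx => (T.hasFDerivAt.comp x hx.differentiableAt.hasFDerivAt).fderiv
  refine ⟨fun x => T (ζ x), fun p => f (χ p), w₀,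
    AnalyticAt.comp_of_eq (T.analyticAt _) hζ rfl, ?_, AnalyticAt.comp_of_eq hf hχ hχ0, ?_,
    tχ.eventually hF, ?_⟩
  · rw [hTd _ hζ, ContinuousLinearMap.coe_comp]
    exact hT.comp hζb
  · beta_reduce
    rw [hχ0, hf0]
  · have hA : ∀ᶠ p in 𝓝 (x₀ 0, w₀), AnalyticAt ℝ ζ p.1 :=
      continuous_fst.continuousAt.eventually hζ.eventually_analyticAt
    filter_upwards [tκ.eventually hdyn, hA] with p h1 h2 k
    rw [hTd _ h2, ContinuousLinearMap.comp_apply]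
    have h3 : fderiv ℝ ζ p.1 (f (χ p)) = A.mulVec (ζ p.1) +
        (p.2 - r n (ζ p.1)) • B.mulVec fun _ => 1 := by
      rw [← mulVec_fin_one B fun _ => p.2 - r n (ζ p.1)]
      exact h1
    have h4 : ∀ z, r k (A.mulVec z) = r (k + 1) z := fun z => by
      rw [hr, hr, Matrix.mulVec_mulVec, ← pow_succ]
    rw [h3]
    change r k _ = _
    rw [map_add, map_smul, h4]
    split_ifs with h
    · rw [show r k (B.mulVec fun _ => 1) = 0 from hc0 k h, smul_zero, add_zero]
      rfl
    · have hk : (k : ℕ) = n - 1 := by have := k.2; omega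
      rw [show r k (B.mulVec fun _ => 1) = 1 by rw [hk]; exact hc1, smul_eq_mul, mul_one,
        show (k : ℕ) + 1 = n by have := k.2; omega]
      ring

/-! ## From feedback linearization to flatness -/

theorem prolong_mem_prolonged {E : Type*} [AddCommGroup E] [Module ℝ E] [TopologicalSpace E]
    [IsTopologicalAddGroup E] [ContinuousSMul ℝ E] {n : ℕ} (S : ImplicitSystem n 1) {W : Set E}
    (hW : IsOpen W) {X : E → E} {Φ : E → Jet n} (hΦ : CylMapOn W Φ) (hr : RelatedOn W X Φ)
    (hm : MapsTo Φ W (ImplicitSystem.jetsOver S.dom))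
    (hF : ∀ z ∈ W, S.F (Φ z 0, Φ z 1) = 0) {z : E} (hz : z ∈ W) : Φ z ∈ S.prolonged := by
  refine ⟨hm hz, fun k i => ?_⟩
  rw [← hr.iterate_lieD_comp hW hΦ (ImplicitSystem.isOpen_jetsOver S.isOpen_dom) hm
    (S.cylAnOn_jetF i) k hz]
  have h0 : EqOn (fun z => S.jetF i (Φ z)) (fun _ => 0) W := by
    intro z hz
    simp only [ImplicitSystem.jetF, hF z hz]
    rfl
  rw [iterate_lieD_congr hW h0 k hz]
  have : ∀ k, ((lieD X)^[k] fun _ => (0 : ℝ)) = fun _ => 0 := by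
    intro k
    induction k with
    | zero => rfl
    | succ k ih =>
      rw [Function.iterate_succ_apply', ih]
      funext z
      simp [lieD, lineDeriv]
  rw [this]

theorem CylMapOn.continuousOn_jet {E : Type*} [AddCommGroup E] [Module ℝ E] [TopologicalSpace E]
    {n : ℕ} {W : Set E} {Φ : E → Jet n} (h : CylMapOn W Φ) : ContinuousOn Φ W :=
  continuousOn_pi.2 fun k => continuousOn_pi.2 fun i => (h.apply k i).continuousOn

theorem mem_prolonged_trivialSystem (y : Jet 1) : y ∈ (trivialSystem 1).prolonged :=
  ⟨mem_univ _, fun _ i => i.elim0⟩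

/-- An analytic map with bijective derivative has an analytic local inverse. -/
theorem exists_analytic_inverse {n : ℕ} {ζ : (Fin n → ℝ) → Fin n → ℝ} {x : Fin n → ℝ}
    (hζ : AnalyticAt ℝ ζ x) (hb : Function.Bijective (fderiv ℝ ζ x)) :
    ∃ ψ : (Fin n → ℝ) → Fin n → ℝ, AnalyticAt ℝ ψ (ζ x) ∧ ψ (ζ x) = x ∧
      (∀ᶠ z in 𝓝 (ζ x), ζ (ψ z) = z) ∧ ∀ᶠ y in 𝓝 x, ψ (ζ y) = y := by
  let G : (Fin n → ℝ) × (Fin n → ℝ) → Fin n → ℝ := fun q => ζ q.2 - q.1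
  have hG1 : AnalyticAt ℝ (fun q : (Fin n → ℝ) × (Fin n → ℝ) => ζ q.2) (ζ x, x) :=
    AnalyticAt.comp_of_eq hζ analyticAt_snd rfl
  have hG : AnalyticAt ℝ G (ζ x, x) := hG1.sub analyticAt_fst
  have hi : fderiv ℝ G (ζ x, x) ∘L .inr ℝ _ _ = fderiv ℝ ζ x := by
    have h1 : HasFDerivAt G ((fderiv ℝ ζ x).comp (.snd ℝ _ _) - .fst ℝ _ _) (ζ x, x) :=
      (HasFDerivAt.comp (ζ x, x) (g := ζ) hζ.differentiableAt.hasFDerivAt hasFDerivAt_snd).sub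
        hasFDerivAt_fst
    rw [h1.fderiv]
    ext v
    simp
  obtain ⟨ψ, hψ, hψ0, h1, h2⟩ := exists_analytic_implicit hG (by
    rw [hi]
    exact ⟨ContinuousLinearEquiv.ofBijective _ (LinearMap.ker_eq_bot.2 hb.1)
      (LinearMap.range_eq_top.2 hb.2), ContinuousLinearEquiv.coe_ofBijective ..⟩)
  have hG0 : G (ζ x, x) = 0 := sub_self _
  rw [hG0] at h1 h2
  refine ⟨ψ, hψ, hψ0, h1.mono fun z hz => sub_eq_zero.1 hz, ?_⟩
  have ht : Tendsto (fun y => (ζ y, y)) (𝓝 x) (𝓝 (ζ x, x)) :=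
    hζ.continuousAt.prodMk continuousAt_id
  filter_upwards [ht.eventually h2] with y hy
  exact hy.1 (sub_self _)

namespace LocalForm

variable {n : ℕ} {S : ImplicitSystem n 1} {a : (Fin n → ℝ) × (Fin n → ℝ)} (Λ : LocalForm S a)

/-- Two explicit forms of an implicit system differ by a change of the control. -/
theorem exists_control_change {g : (Fin n → ℝ) × ℝ → Fin n → ℝ} {w₀ : ℝ}
    (hg : AnalyticAt ℝ g (a.1, w₀)) (hg0 : g (a.1, w₀) = a.2)
    (hg1 : fderiv ℝ g (a.1, w₀) (0, 1) ≠ 0) (hF : ∀ᶠ p in 𝓝 (a.1, w₀), S.F (p.1, g p) = 0) :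
    ∃ w : (Fin n → ℝ) × ℝ → ℝ, ContinuousAt w (a.1, Λ.ℓ a.2) ∧ w (a.1, Λ.ℓ a.2) = w₀ ∧
      ∀ᶠ p in 𝓝 (a.1, Λ.ℓ a.2), Λ.f p = g (p.1, w p) := by
  have hline : ∀ {x : Fin n → ℝ} {c : ℝ},
      HasDerivAt (fun t : ℝ => ((x, t) : (Fin n → ℝ) × ℝ)) (0, 1) c := fun {x c} =>
    (hasDerivAt_const c x).prodMk (hasDerivAt_id c)
  have hgd := (hg.differentiableAt.hasFDerivAt).comp_hasDerivAt w₀ (hline (x := a.1))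
  set d := fderiv ℝ g (a.1, w₀) (0, 1) with hd
  -- Differentiating `F(x, g(x, w)) = 0` in `w` puts the nonzero vector `d` in the kernel of
  -- `∂F/∂ẋ`, where `ℓ` is injective.
  have hℓd : Λ.ℓ d ≠ 0 := by
    intro h0
    refine hg1 (Λ.inj _ Λ.mem_O₂ d ?_ h0)
    have h1 : HasFDerivAt S.F (fderiv ℝ S.F a) (a.1, (g ∘ fun t : ℝ => (a.1, t)) w₀) := by
      change HasFDerivAt S.F _ (a.1, g (a.1, w₀))
      rw [hg0]
      exact (S.analytic _ (Λ.subset_dom Λ.mem_O₂)).differentiableAt.hasFDerivAt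
    have h2 := h1.comp_hasDerivAt w₀ ((hasDerivAt_const w₀ a.1).prodMk hgd)
    exact h2.unique ((hasDerivAt_const w₀ (0 : Fin (n - 1) → ℝ)).congr_of_eventuallyEq
      (hline.continuousAt.eventually hF))
  let G : ((Fin n → ℝ) × ℝ) × ℝ → ℝ := fun q => Λ.ℓ (g (q.1.1, q.2)) - q.1.2
  have hG1 : AnalyticAt ℝ (fun q : ((Fin n → ℝ) × ℝ) × ℝ => g (q.1.1, q.2))
      ((a.1, Λ.ℓ a.2), w₀) :=
    AnalyticAt.comp_of_eq hg ((analyticAt_fst.comp_of_eq analyticAt_fst rfl).prod analyticAt_snd) rfl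
  have hGa : AnalyticAt ℝ G ((a.1, Λ.ℓ a.2), w₀) :=
    (AnalyticAt.comp_of_eq (Λ.ℓ.analyticAt _) hG1 rfl).sub
      (analyticAt_snd.comp_of_eq analyticAt_fst rfl)
  have hG0 : G ((a.1, Λ.ℓ a.2), w₀) = 0 := by simp only [G]; rw [hg0, sub_self]
  have hGi : (fderiv ℝ G ((a.1, Λ.ℓ a.2), w₀) ∘L .inr ℝ _ _) 1 ≠ 0 := by
    have h1 := (hGa.differentiableAt.hasFDerivAt).comp_hasDerivAt w₀
      ((hasDerivAt_const w₀ (a.1, Λ.ℓ a.2)).prodMk (hasDerivAt_id w₀))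
    have h2 := (Λ.ℓ.hasFDerivAt.comp_hasDerivAt w₀ hgd).sub_const (Λ.ℓ a.2)
    change fderiv ℝ G ((a.1, Λ.ℓ a.2), w₀) (0, 1) ≠ 0
    rw [h1.unique h2]
    exact hℓd
  obtain ⟨w, hw, hw0, hwG, -⟩ :=
    exists_analytic_implicit hGa (isInvertible_of_apply_one_ne_zero hGi)
  refine ⟨w, hw.continuousAt, hw0, ?_⟩
  have ht : Tendsto (fun p : (Fin n → ℝ) × ℝ => (p.1, w p)) (𝓝 (a.1, Λ.ℓ a.2)) (𝓝 (a.1, w₀)) := by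
    have : ContinuousAt (fun p : (Fin n → ℝ) × ℝ => (p.1, w p)) (a.1, Λ.ℓ a.2) :=
      continuousAt_fst.prodMk hw.continuousAt
    have h2 := this.tendsto
    rwa [show w (a.1, Λ.ℓ a.2) = w₀ from hw0] at h2
  have hO : ∀ᶠ p in 𝓝 (a.1, w₀), (p.1, g p) ∈ Λ.O₂ := by
    have : ContinuousAt (fun p : (Fin n → ℝ) × ℝ => (p.1, g p)) (a.1, w₀) :=
      continuousAt_fst.prodMk hg.continuousAt
    refine this.eventually_mem (Λ.isOpen_O₂.mem_nhds ?_)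
    rw [hg0]
    exact Λ.mem_O₂
  filter_upwards [hwG, ht.eventually hF, ht.eventually hO] with p h1 h2 h3
  have h4 := (Λ.unique _ h3 h2).2
  rw [hG0] at h1
  have h5 : Λ.ℓ (g (p.1, w p)) = p.2 := sub_eq_zero.1 h1
  simp only [h5] at h4
  exact h4

end LocalForm

/-! ### The flat output of a chain of integrators -/

/-- The first `n` derivatives of the flat output. -/
def outputL (n : ℕ) : Jet 1 →L[ℝ] (Fin n → ℝ) :=
  ContinuousLinearMap.pi fun k =>
    (ContinuousLinearMap.proj 0 : (Fin 1 → ℝ) →L[ℝ] ℝ).comp (ContinuousLinearMap.proj (k : ℕ))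

/-- The first `n + 1` derivatives of the flat output. -/
def outputPairL (n : ℕ) : Jet 1 →L[ℝ] (Fin n → ℝ) × ℝ :=
  (outputL n).prod
    ((ContinuousLinearMap.proj 0 : (Fin 1 → ℝ) →L[ℝ] ℝ).comp (ContinuousLinearMap.proj n))

theorem outputPairL_apply (n : ℕ) (y : Jet 1) :
    outputPairL n y = (fun k : Fin n => y k 0, y n 0) := rfl

-- The flat output is the first chain coordinate `y = ζ₀(x)`. In the chain `ζ(x) = (y, …, y⁽ⁿ⁻¹⁾)`,
-- so with `ψ` a local inverse of `ζ` the state is recovered as `ψ(y, …, y⁽ⁿ⁻¹⁾)`. The maps `Ψ` and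
-- `Φ` are the prolongations of these two functions. Maps that respect the fields are determined by
-- their components of order `0`, so the two inversion identities need checking only there.
set_option maxHeartbeats 2000000 in
theorem exists_flatAt_of_staticFeedbackLinearizableAt {n : ℕ} {S : ImplicitSystem n 1}
    {x₀ : Jet n} (hx₀ : x₀ ∈ S.prolonged) (h : S.StaticFeedbackLinearizableAt x₀) :
    ∃ y₀ : Jet 1, S.FlatAt x₀ y₀ := by
  obtain ⟨ζ, g, w₀, hζ, hζb, hg, hg0, hF, hdyn⟩ := exists_chain_form h
  have hn : 0 < n := S.le
  obtain ⟨Λ⟩ := exists_localForm S hx₀.1 (funext fun i => hx₀.2 0 i)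
  obtain ⟨ψ, hψ, hψ0, hζψ, hψζ⟩ := exists_analytic_inverse hζ hζb
  let l : Fin n := ⟨n - 1, by omega⟩
  have hl : ¬ (l : ℕ) + 1 < n := by simp only [l]; omega
  have hg1 : fderiv ℝ g (x₀ 0, w₀) (0, 1) ≠ 0 := by
    intro h0
    have hline : HasDerivAt (fun t : ℝ => ((x₀ 0, t) : (Fin n → ℝ) × ℝ)) (0, 1) w₀ :=
      (hasDerivAt_const w₀ (x₀ 0)).prodMk (hasDerivAt_id w₀)
    have h1 := (hg.differentiableAt.hasFDerivAt).comp_hasDerivAt w₀ hline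
    rw [h0] at h1
    have h2 := hasDerivAt_pi.1 ((fderiv ℝ ζ (x₀ 0)).hasFDerivAt.comp_hasDerivAt w₀ h1) l
    have h3 := h2.unique ((hasDerivAt_id w₀).congr_of_eventuallyEq (by
      filter_upwards [hline.continuousAt.eventually hdyn] with t ht
      have := ht l
      rw [dif_neg hl] at this
      exact this))
    rw [map_zero] at h3
    exact zero_ne_one h3
  obtain ⟨w, hw, hw0, hwf⟩ := Λ.exists_control_change hg hg0 hg1 hF
  -- the neighborhood in the coordinates of the flat output
  have tψ : Tendsto (fun q : (Fin n → ℝ) × ℝ => (ψ q.1, q.2)) (𝓝 (ζ (x₀ 0), w₀))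
      (𝓝 (x₀ 0, w₀)) := by
    have : ContinuousAt (fun q : (Fin n → ℝ) × ℝ => (ψ q.1, q.2)) (ζ (x₀ 0), w₀) :=
      (ContinuousAt.comp_of_eq hψ.continuousAt continuousAt_fst rfl).prodMk continuousAt_snd
    have h2 := this.tendsto
    rwa [hψ0] at h2
  have tg : Tendsto (fun p : (Fin n → ℝ) × ℝ => (p.1, g p)) (𝓝 (x₀ 0, w₀))
      (𝓝 (x₀ 0, x₀ 1)) := by
    have : ContinuousAt (fun p : (Fin n → ℝ) × ℝ => (p.1, g p)) (x₀ 0, w₀) :=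
      continuousAt_fst.prodMk hg.continuousAt
    have h2 := this.tendsto
    rwa [hg0] at h2
  have hinj : ∀ᶠ x in 𝓝 (x₀ 0), AnalyticAt ℝ ζ x ∧ Function.Injective (fderiv ℝ ζ x) := by
    refine hζ.eventually_analyticAt.and ?_
    let e := ContinuousLinearEquiv.ofBijective _ (LinearMap.ker_eq_bot.2 hζb.1)
      (LinearMap.range_eq_top.2 hζb.2)
    have h1 : fderiv ℝ ζ (x₀ 0) ∈ range ((↑) : ((Fin n → ℝ) ≃L[ℝ] (Fin n → ℝ)) → _) :=
      ⟨e, ContinuousLinearEquiv.coe_ofBijective ..⟩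
    filter_upwards [hζ.fderiv.continuousAt.eventually_mem
      (ContinuousLinearEquiv.isOpen.mem_nhds h1)] with x ⟨e', he'⟩
    rw [← he']
    exact e'.injective
  -- The last clause says that the velocity of the chain, carried by `dψ`, is `g`; hence `Φ y`
  -- satisfies `F = 0`.
  have hG : ∀ᶠ q in 𝓝 (ζ (x₀ 0), w₀), AnalyticAt ℝ ψ q.1 ∧ ζ (ψ q.1) = q.1 ∧
      (ψ q.1, g (ψ q.1, q.2)) ∈ S.dom ∧ S.F (ψ q.1, g (ψ q.1, q.2)) = 0 ∧
      fderiv ℝ ψ q.1 (fun k => if h : (k : ℕ) + 1 < n then q.1 ⟨k + 1, h⟩ else q.2) =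
        g (ψ q.1, q.2) := by
    have e1 : ∀ᶠ q in 𝓝 (ζ (x₀ 0), w₀), AnalyticAt ℝ ψ q.1 :=
      hψ.eventually_analyticAt.prod_inl_nhds w₀
    have e2 : ∀ᶠ q in 𝓝 (ζ (x₀ 0), w₀), ∀ᶠ z in 𝓝 q.1, ζ (ψ z) = z :=
      hζψ.eventually_nhds.prod_inl_nhds w₀
    have e3 := tψ.eventually (tg.eventually_mem (S.isOpen_dom.mem_nhds hx₀.1))
    have e4 : ∀ᶠ q in 𝓝 (ζ (x₀ 0), w₀), AnalyticAt ℝ ζ (ψ q.1) ∧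
        Function.Injective (fderiv ℝ ζ (ψ q.1)) :=
      (continuous_fst.continuousAt.tendsto.comp tψ).eventually hinj
    filter_upwards [e1, e2, e3, e4, tψ.eventually hF, tψ.eventually hdyn] with q h1 h2 h3 h4 h5 h6
    refine ⟨h1, h2.self_of_nhds, h3, h5, h4.2 ?_⟩
    have h7 := (h4.1.differentiableAt.hasFDerivAt).comp q.1 h1.differentiableAt.hasFDerivAt
    have h8 := h7.unique ((hasFDerivAt_id q.1).congr_of_eventuallyEq h2)
    have h9 := fun v => DFunLike.congr_fun h8 v
    simp only [ContinuousLinearMap.comp_apply, ContinuousLinearMap.id_apply] at h9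
    rw [h9]
    funext k
    rw [h6 k]
    simp only [h2.self_of_nhds]
  obtain ⟨G, hGP, hGo, hGm⟩ := eventually_nhds_iff.1 hG
  -- the neighborhood in the coordinates of the system
  have tζ : Tendsto (fun p : (Fin n → ℝ) × ℝ => (ζ p.1, w p)) (𝓝 (x₀ 0, Λ.ℓ (x₀ 1)))
      (𝓝 (ζ (x₀ 0), w₀)) := by
    have : ContinuousAt (fun p : (Fin n → ℝ) × ℝ => (ζ p.1, w p)) (x₀ 0, Λ.ℓ (x₀ 1)) :=
      (ContinuousAt.comp_of_eq hζ.continuousAt continuousAt_fst rfl).prodMk hw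
    have h2 := this.tendsto
    rwa [hw0] at h2
  have tw : Tendsto (fun p : (Fin n → ℝ) × ℝ => (p.1, w p)) (𝓝 (x₀ 0, Λ.ℓ (x₀ 1)))
      (𝓝 (x₀ 0, w₀)) := by
    have : ContinuousAt (fun p : (Fin n → ℝ) × ℝ => (p.1, w p)) (x₀ 0, Λ.ℓ (x₀ 1)) :=
      continuousAt_fst.prodMk hw
    have h2 := this.tendsto
    rwa [hw0] at h2
  have hH : ∀ᶠ p in 𝓝 (x₀ 0, Λ.ℓ (x₀ 1)), AnalyticAt ℝ ζ p.1 ∧ ψ (ζ p.1) = p.1 ∧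
      (ζ p.1, w p) ∈ G ∧ (∀ k : Fin n, fderiv ℝ ζ p.1 (Λ.f p) k =
        if h : (k : ℕ) + 1 < n then ζ p.1 ⟨k + 1, h⟩ else w p) ∧ p ∈ Λ.O := by
    have e1 : ∀ᶠ p in 𝓝 (x₀ 0, Λ.ℓ (x₀ 1)), AnalyticAt ℝ ζ p.1 ∧ ψ (ζ p.1) = p.1 :=
      (hζ.eventually_analyticAt.and hψζ).prod_inl_nhds _
    filter_upwards [e1, tζ.eventually_mem (hGo.mem_nhds hGm), tw.eventually hdyn, hwf,
      Λ.isOpen_O.mem_nhds Λ.mem_O] with p h1 h2 h3 h4 h5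
    refine ⟨h1.1, h1.2, h2, fun k => ?_, h5⟩
    rw [h4]
    exact h3 k
  obtain ⟨H, hHP, hHo, hHm⟩ := eventually_nhds_iff.1 hH
  let W : Set (Chart n) := {z | (z.1, z.2 0) ∈ H}
  have hWo : IsOpen W := hHo.preimage (by fun_prop : Continuous fun z : Chart n => (z.1, z.2 0))
  have hWd : W ⊆ Λ.dom := fun z hz => (hHP _ hz).2.2.2.2
  let NX₀ : Set (Jet n) := ImplicitSystem.jetsOver Λ.O₂ ∩ Λ.coord ⁻¹' W
  have hNX₀ : IsOpen NX₀ :=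
    (ImplicitSystem.isOpen_jetsOver Λ.isOpen_O₂).inter (hWo.preimage Λ.coord.continuous)
  have hx₀N : x₀ ∈ NX₀ := ⟨Λ.mem_O₂, hHm⟩
  let NY₀ : Set (Jet 1) := outputPairL n ⁻¹' G
  have hNY₀ : IsOpen NY₀ := hGo.preimage (outputPairL n).continuous
  -- the maps
  let η : Jet n → Fin 1 → ℝ := fun x _ => ζ (x 0) ⟨0, hn⟩
  let φ : Jet 1 → Fin n → ℝ := fun y => ψ (outputL n y)
  have hη : ∀ i, CylAnOn NX₀ fun x => η x i := fun i => by
    have h1 : CylAnOn NX₀ fun x : Jet n => ζ (x 0) :=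
      (CylAnOn.of_clm (ContinuousLinearMap.proj 0 : Jet n →L[ℝ] (Fin n → ℝ))).comp
        (s := {x | AnalyticAt ℝ ζ x}) (fun x hx => hx) fun x hx => (hHP _ hx.2).1
    exact h1.clm_comp (ContinuousLinearMap.proj (⟨0, hn⟩ : Fin n) : (Fin n → ℝ) →L[ℝ] ℝ)
  have hφ' : CylAnOn NY₀ φ := (CylAnOn.of_clm (outputL n)).comp
    (s := {x | AnalyticAt ℝ ψ x}) (fun x hx => hx) fun y hy => (hGP _ hy).1
  have hφ : ∀ i, CylAnOn NY₀ fun y => φ y i := fun i =>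
    hφ'.clm_comp (ContinuousLinearMap.proj i : (Fin n → ℝ) →L[ℝ] ℝ)
  let Ψ : Jet n → Jet 1 := prolong cartanField η
  let Φ : Jet 1 → Jet n := prolong cartanField φ
  have hΨc : CylMapOn NX₀ Ψ := cylMapOn_prolong hNX₀ (cylMapOn_cartanField _) hη
  have hΦc : CylMapOn NY₀ Φ := cylMapOn_prolong hNY₀ (cylMapOn_cartanField _) hφ
  -- `Φ` on solutions
  have hΦ1 : ∀ y ∈ NY₀, Φ y 1 = g (ψ (outputL n y), y n 0) := by
    intro y hy
    obtain ⟨h1, h2, h3, h4, h5⟩ := hGP _ hy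
    funext i
    have h6 := hasLineDerivAt_comp_clm (L := outputL n) (x := y) h1 (cartanField y)
    have h7 : HasLineDerivAt ℝ (fun y => φ y i)
        (fderiv ℝ ψ (outputL n y) (outputL n (cartanField y)) i) y (cartanField y) :=
      hasDerivAt_pi.1 h6 i
    refine (h7.lineDeriv : lineDeriv ℝ (fun y => φ y i) y (cartanField y) = _).trans ?_
    refine Eq.trans (congrFun (congrArg (fderiv ℝ ψ (outputL n y)) (funext fun k => ?_)) i)
      (congrFun h5 i)
    change y (k + 1) 0 = _
    split_ifs with hk
    · rfl
    · rw [show (k : ℕ) + 1 = n by have := k.2; omega]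
      rfl
  have hΦS : ∀ y ∈ NY₀, Φ y ∈ S.prolonged := by
    intro y hy
    refine prolong_mem_prolonged S hNY₀ hΦc (relatedOn_prolong _ _ _) ?_ ?_ hy
    · intro y hy
      change (Φ y 0, Φ y 1) ∈ S.dom
      rw [hΦ1 y hy]
      exact (hGP _ hy).2.2.1
    · intro y hy
      rw [hΦ1 y hy]
      exact (hGP _ hy).2.2.2.1
  -- the flat output in the coordinates of the system
  have hparam : MapsTo Λ.param W NX₀ := fun z hz => by
    refine ⟨Λ.param_mem_jetsOver (hWd hz), ?_⟩
    rw [mem_preimage, Λ.coord_param (hWd hz)]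
    exact hz
  have hfield : CylMapOn W Λ.field := Λ.cylMapOn_field.mono hWd
  have hprel : RelatedOn W Λ.field Λ.param := relatedOn_prolong _ _ _
  -- This is `Ψ` read in the chart. Identities that hold only on solution jets cannot be
  -- differentiated in the ambient jet space, but in the chart they hold on an open set.
  let Ψ' : Chart n → Jet 1 := prolong Λ.field fun z _ => ζ z.1 ⟨0, hn⟩
  have hΨΨ' : ∀ z ∈ W, Ψ (Λ.param z) = Ψ' z := by
    intro z hz
    funext k i
    exact (hprel.iterate_lieD_comp hWo (Λ.cylMapOn_param.mono hWd) hNX₀ hparam (hη i) k hz).symm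
  have hζfst : ∀ k : Fin n, ∀ z ∈ W, lieD Λ.field (fun z => ζ z.1 k) z =
      fderiv ℝ ζ z.1 (Λ.f (z.1, z.2 0)) k := by
    intro k z hz
    have h1 := hasLineDerivAt_comp_clm (L := ContinuousLinearMap.fst ℝ (Fin n → ℝ) (ℕ → ℝ))
      (hHP _ hz).1 (Λ.field z)
    have h2 : HasLineDerivAt ℝ (fun z : Chart n => ζ z.1 k)
      (fderiv ℝ ζ z.1 (Λ.field z).1 k) z (Λ.field z) := hasDerivAt_pi.1 h1 k
    exact h2.lineDeriv
  have hchain : ∀ (k : ℕ) (hk : k < n), EqOn (fun z => Ψ' z k 0) (fun z => ζ z.1 ⟨k, hk⟩) W := by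
    intro k
    induction k with
    | zero => exact fun _ _ _ => rfl
    | succ k ih =>
      intro hk z hz
      beta_reduce
      refine (lieD_prolong _ _ _ _ _).symm.trans ((lieD_congr hWo (ih (by omega)) hz).trans ?_)
      rw [hζfst _ z hz, (hHP _ hz).2.2.2.1, dif_pos hk]
  have hchain' : ∀ z ∈ W, Ψ' z n 0 = w (z.1, z.2 0) := by
    intro z hz
    have h1 : Ψ' z (n - 1 + 1) 0 = w (z.1, z.2 0) := by
      refine (lieD_prolong _ _ _ _ _).symm.trans
        ((lieD_congr hWo (hchain (n - 1) (by omega)) hz).trans ?_)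
      rw [hζfst _ z hz, (hHP _ hz).2.2.2.1, dif_neg hl]
    rwa [Nat.sub_add_cancel hn] at h1
  have hout : ∀ z ∈ W, outputPairL n (Ψ' z) = (ζ z.1, w (z.1, z.2 0)) := by
    intro z hz
    rw [outputPairL_apply]
    refine Prod.ext ?_ (hchain' z hz)
    funext k
    exact hchain k k.2 hz
  have hΨ'N : MapsTo Ψ' W NY₀ := fun z hz => by
    rw [mem_preimage, hout z hz]
    exact (hHP _ hz).2.2.1
  have hΨ'c : CylMapOn W Ψ' := cylMapOn_prolong hWo hfield fun i => by
    have h1 : CylAnOn W fun z : Chart n => ζ z.1 :=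
      (CylAnOn.of_clm (ContinuousLinearMap.fst ℝ (Fin n → ℝ) (ℕ → ℝ))).comp
        (s := {x | AnalyticAt ℝ ζ x}) (fun x hx => hx) fun z hz => (hHP _ hz).1
    exact h1.clm_comp (ContinuousLinearMap.proj (⟨0, hn⟩ : Fin n) : (Fin n → ℝ) →L[ℝ] ℝ)
  have hΦΨ' : ∀ z ∈ W, Φ (Ψ' z) = Λ.param z := by
    intro z hz
    have hrel : RelatedOn W Λ.field Ψ' := relatedOn_prolong _ _ _
    funext k i
    refine (hrel.iterate_lieD_comp hWo hΨ'c hNY₀ hΨ'N (hφ i) k hz).symm.trans ?_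
    refine iterate_lieD_congr hWo (fun z hz => ?_) k hz
    have h1 : outputL n (Ψ' z) = ζ z.1 := congrArg Prod.fst (hout z hz)
    simp only [φ]
    rw [h1, (hHP _ hz).2.1]
  have hpc : ∀ x ∈ NX₀ ∩ S.prolonged, Λ.param (Λ.coord x) = x := fun x hx =>
    Λ.param_coord hx.2 hx.1.1
  have hΨN : ∀ x ∈ NX₀ ∩ S.prolonged, Ψ x ∈ NY₀ := fun x hx => by
    rw [← hpc x hx, hΨΨ' _ hx.1.2]
    exact hΨ'N hx.1.2
  have hΦΨ : ∀ x ∈ NX₀ ∩ S.prolonged, Φ (Ψ x) = x := fun x hx => by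
    conv_lhs => rw [← hpc x hx, hΨΨ' _ hx.1.2, hΦΨ' _ hx.1.2]
    exact hpc x hx
  -- the final neighborhoods
  let NX : Set (Jet n) := NX₀ ∩ Ψ ⁻¹' NY₀
  let NY : Set (Jet 1) := NY₀ ∩ Φ ⁻¹' NX₀
  have hNX : IsOpen NX := hΨc.continuousOn_jet.isOpen_inter_preimage hNX₀ hNY₀
  have hNY : IsOpen NY := hΦc.continuousOn_jet.isOpen_inter_preimage hNY₀ hNX₀
  have hΨΦ : ∀ y ∈ NY, Ψ (Φ y) = y := by
    intro y hy
    have hrel : RelatedOn NY cartanField Φ := relatedOn_prolong _ _ _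
    have hid : RelatedOn NY cartanField (fun y : Jet 1 => y) := fun y _ k i =>
      lineDeriv_clm ((ContinuousLinearMap.proj i : (Fin 1 → ℝ) →L[ℝ] ℝ).comp
        (ContinuousLinearMap.proj k : Jet 1 →L[ℝ] (Fin 1 → ℝ))) y (cartanField y)
    funext k i
    refine (hrel.iterate_lieD_comp hNY (hΦc.mono inter_subset_left) hNX₀ (fun y hy => hy.2)
      (hη i) k hy).symm.trans ?_
    refine Eq.trans ?_ (hid.apply_eq hNY k i hy).symm
    refine iterate_lieD_congr hNY (fun y hy => ?_) k hy
    change ζ (ψ (outputL n y)) ⟨0, hn⟩ = y 0 i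
    rw [show ζ (ψ (outputL n y)) = outputL n y from (hGP _ hy.1).2.1, Subsingleton.elim i 0]
    rfl
  refine ⟨Ψ x₀, hx₀, mem_prolonged_trivialSystem _, NX, NY, Φ, Ψ, hNX,
    ⟨hx₀N, hΨN _ ⟨hx₀N, hx₀⟩⟩, hNY, ⟨hΨN _ ⟨hx₀N, hx₀⟩, ?_⟩, ?_, ?_, ?_, ?_, ⟨?_, ?_⟩,
    hΦΨ _ ⟨hx₀N, hx₀⟩, rfl, ?_, ?_⟩
  · rw [mem_preimage, hΦΨ _ ⟨hx₀N, hx₀⟩]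
    exact hx₀N
  · exact fun k i => jetAnalyticOn_iff.2 ((hΦc.apply k i).mono inter_subset_left)
  · exact fun k i => jetAnalyticOn_iff.2 ((hΨc.apply k i).mono inter_subset_left)
  · rintro y ⟨hy, -⟩
    refine ⟨⟨hy.2, ?_⟩, hΦS y hy.1⟩
    rw [mem_preimage, hΨΦ y hy]
    exact hy.1
  · rintro x ⟨hx, hxS⟩
    refine ⟨⟨hx.2, ?_⟩, mem_prolonged_trivialSystem _⟩
    rw [mem_preimage, hΦΨ x ⟨hx.1, hxS⟩]
    exact hx.1
  · exact fun y hy => hΨΦ y hy.1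
  · exact fun x hx => hΦΨ x ⟨hx.1.1, hx.2⟩
  · exact fun y _ k i => lieD_prolong cartanField φ y k i
  · exact fun x _ k i => lieD_prolong cartanField η x k i

/-! ## From flatness to closedness -/

section Families

variable {n : ℕ} {W : Set (Chart n)}

/-- Families of linear forms on the coordinate space that depend on finitely many coordinates,
uniformly in the point. -/
def IsFormFamily (W : Set (Chart n)) (β : Chart n → Chart n → ℝ) : Prop :=
  (∀ z ∈ W, ∀ v w, β z (v + w) = β z v + β z w) ∧ (∀ z ∈ W, ∀ (c : ℝ) v, β z (c • v) = c * β z v) ∧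
    ∃ K : ℕ, ∀ z ∈ W, ∀ v : Chart n, v.1 = 0 → (∀ k < K, v.2 k = 0) → β z v = 0

theorem isFormFamily_lineDeriv (hW : IsOpen W) {h : Chart n → ℝ} (hh : CylAnOn W h) :
    IsFormFamily W fun z v => lineDeriv ℝ h z v :=
  ⟨fun _ hz v w => hh.lineDeriv_add_dir hW hz v w, fun _ hz c v => hh.lineDeriv_smul_dir hW hz c v,
    exists_lineDeriv_eq_zero hW hh⟩

theorem IsFormFamily.mul {β : Chart n → Chart n → ℝ} (hβ : IsFormFamily W β) (a : Chart n → ℝ) :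
    IsFormFamily W fun z v => a z * β z v := by
  obtain ⟨h1, h2, K, h3⟩ := hβ
  refine ⟨fun z hz v w => by beta_reduce; rw [h1 z hz]; ring, fun z hz c v => by beta_reduce; rw [h2 z hz]; ring, K,
    fun z hz v hv hk => by beta_reduce; rw [h3 z hz v hv hk, mul_zero]⟩

theorem IsFormFamily.add {β γ : Chart n → Chart n → ℝ} (hβ : IsFormFamily W β)
    (hγ : IsFormFamily W γ) : IsFormFamily W fun z v => β z v + γ z v := by
  obtain ⟨h1, h2, K, h3⟩ := hβ
  obtain ⟨h1', h2', K', h3'⟩ := hγ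
  refine ⟨fun z hz v w => by beta_reduce; rw [h1 z hz, h1' z hz]; ring,
    fun z hz c v => by beta_reduce; rw [h2 z hz, h2' z hz]; ring, max K K', fun z hz v hv hk => ?_⟩
  beta_reduce
  rw [h3 z hz v hv fun k h => hk k (lt_max_of_lt_left h),
    h3' z hz v hv fun k h => hk k (lt_max_of_lt_right h), add_zero]

theorem IsFormFamily.sum {ι : Type*} (s : Finset ι) {β : ι → Chart n → Chart n → ℝ}
    (hβ : ∀ i ∈ s, IsFormFamily W (β i)) : IsFormFamily W fun z v => ∑ i ∈ s, β i z v := by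
  classical
  induction s using Finset.induction_on with
  | empty => exact ⟨by simp, by simp, 0, by simp⟩
  | insert a s ha ih =>
    simp only [Finset.sum_insert ha]
    exact (hβ a (by simp)).add (ih fun i hi => hβ i (by simp [hi]))

/-- An equality of germs of forms provides a separate neighborhood for each vector `v`. Finitely
many coordinate vectors determine the family, uniformly in the point, so one neighborhood serves for
all `v`. -/
theorem IsFormFamily.eventually_eq_zero {β : Chart n → Chart n → ℝ} (hβ : IsFormFamily W β)
    {z₀ : Chart n} (hW : W ∈ 𝓝 z₀) (h : ∀ v, ∀ᶠ z in 𝓝 z₀, β z v = 0) :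
    ∀ᶠ z in 𝓝 z₀, ∀ v, β z v = 0 := by
  obtain ⟨h1, h2, K, h3⟩ := hβ
  have e1 : ∀ᶠ z in 𝓝 z₀, ∀ i : Fin n, β z (stateV i) = 0 := eventually_all.2 fun i => h _
  have e2 : ∀ᶠ z in 𝓝 z₀, ∀ k ∈ Finset.range K, β z (controlV n k) = 0 :=
    (Finset.eventually_all _).2 fun k _ => h _
  filter_upwards [hW, e1, e2] with z hz e1 e2 v
  have hsum : ∀ {ι : Type} (s : Finset ι) (c : ι → ℝ) (u : ι → Chart n),
      (∀ i ∈ s, β z (u i) = 0) → β z (∑ i ∈ s, c i • u i) = 0 := by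
    classical
    intro ι s c u hu
    induction s using Finset.induction_on with
    | empty => simpa using h2 z hz 0 0
    | insert a s ha ih =>
      rw [Finset.sum_insert ha, h1 z hz, h2 z hz, hu a (by simp),
        ih fun i hi => hu i (by simp [hi]), mul_zero, add_zero]
  have d : v = (v.1, 0) + (∑ k ∈ Finset.range K, v.2 k • controlV n k +
      (v - (v.1, 0) - ∑ k ∈ Finset.range K, v.2 k • controlV n k)) := by abel
  have d2 : β z (v - (v.1, 0) - ∑ k ∈ Finset.range K, v.2 k • controlV n k) = 0 := by
    refine h3 z hz _ ?_ fun k hk => ?_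
    · simp [Prod.fst_sum, controlV]
    · simp only [Prod.snd_sub, Prod.snd_sum, Prod.smul_snd, sub_zero, Pi.sub_apply,
        Finset.sum_apply, Pi.smul_apply, controlV, Pi.single_apply, smul_eq_mul, mul_ite, mul_one,
        mul_zero, Finset.sum_ite_eq, Finset.mem_range]
      simp [hk]
  rw [d, h1 z hz, h1 z hz, d2, add_zero, state_decomp, hsum _ _ _ fun i _ => e1 i,
    hsum _ _ _ e2, add_zero]

end Families

/-- The logarithmic differential of an analytic function on jets. -/
theorem exists_logDeriv_form {n : ℕ} {N : Set (Jet n)} (hN : IsOpen N) {h : Jet n → ℝ}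
    (hh : CylAnOn N h) (h0 : ∀ x ∈ N, h x ≠ 0) :
    ∃ τ : OneForm n, (∀ j k, JetAnalyticOn N (τ j k)) ∧
      ∀ x ∈ N, ∀ v, τ.eval x v = (h x)⁻¹ * lineDeriv ℝ h x v := by
  obtain ⟨r, g, hg, e⟩ := jetAnalyticOn_iff.2 hh
  let ev : ℕ → Fin n → Jet n := fun k j => Pi.single k (Pi.single j 1)
  let c : Fin n → ℕ → Jet n → ℝ := fun j k =>
    if k < r then fun x => (h x)⁻¹ * lineDeriv ℝ h x (ev k j) else 0
  have hc : ∀ j k, c j k ≠ 0 → k ∈ Finset.range r := by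
    intro j k hk
    by_contra hr
    rw [Finset.mem_range] at hr
    exact hk (if_neg hr)
  refine ⟨fun j => Finsupp.onFinset (Finset.range r) (c j) (hc j), fun j k => ?_, fun x hx v => ?_⟩
  · rw [jetAnalyticOn_iff, Finsupp.onFinset_apply]
    simp only [c]
    split_ifs
    · exact (hh.inv h0).mul (hh.lineDeriv_const hN _)
    · exact CylAnOn.const 0
  · have hd : ∀ v, lineDeriv ℝ h x v = fderiv ℝ g (truncL n r x) (truncL n r v) := fun v =>
      (hasLineDerivAt_congr_nhds (hasLineDerivAt_comp_clm (L := truncL n r) (hg _ ⟨x, hx, rfl⟩) v)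
        (eventually_of_mem (hN.mem_nhds hx) e)).lineDeriv
    have hv : truncL n r v = ∑ j, ∑ k ∈ Finset.range r, v k j • truncL n r (ev k j) := by
      funext k i
      have hk : ∀ j : Fin n, ∑ l ∈ Finset.range r, v l j * (ev l j) k i =
          v k j * (Pi.single j (1 : ℝ) : Fin n → ℝ) i := by
        intro j
        rw [Finset.sum_eq_single (k : ℕ)]
        · simp [ev]
        · intro l _ hl
          simp [ev, Ne.symm hl]
        · intro hk; exact absurd (Finset.mem_range.2 k.2) hk
      simp only [Finset.sum_apply, Pi.smul_apply, smul_eq_mul]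
      change v k i = ∑ j, ∑ l ∈ Finset.range r, v l j * (ev l j) k i
      simp only [hk, Pi.single_apply, mul_ite, mul_one, mul_zero, Finset.sum_ite_eq,
        Finset.mem_univ, if_true]
    rw [OneForm.eval_eq_sum (s := Finset.range r) fun j => Finsupp.support_onFinset_subset, hd, hv,
      map_sum, Finset.mul_sum]
    refine Finset.sum_congr rfl fun j _ => ?_
    rw [map_sum, Finset.mul_sum]
    refine Finset.sum_congr rfl fun k hk => ?_
    rw [Finsupp.onFinset_apply]
    simp only [c]
    rw [if_pos (Finset.mem_range.1 hk), hd, map_smul, smul_eq_mul]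
    ring

/-! ### Flat outputs as generators, and closedness of their multiples -/

namespace LocalForm

variable {n : ℕ} {S : ImplicitSystem n 1} {a : (Fin n → ℝ) × (Fin n → ℝ)} (Λ : LocalForm S a)
variable {z₀ : Chart n} (hz₀ : z₀ ∈ Λ.dom)

/-- The differential of a flat output generates the 1-forms. -/
theorem exists_generates_of_flatAt {y₀ : Jet 1} (h : S.FlatAt (Λ.param z₀) y₀) :
    ∃ y : Chart n → ℝ, CylAt z₀ y ∧ (Λ.controlModule hz₀).Generates (dGerm (germ z₀ y)) := by
  obtain ⟨-, -, NX, NY, Φ, Ψ, hNX, hxN, hNY, hyN, hΦ, hΨ, hΦm, hΨm, ⟨-, hinv⟩, -, -, -, hΨr⟩ := h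
  let W : Set (Chart n) := Λ.dom ∩ Λ.param ⁻¹' NX
  have hW : IsOpen W := Λ.continuousOn_param.isOpen_inter_preimage Λ.isOpen_dom hNX
  have hz : z₀ ∈ W := ⟨hz₀, hxN⟩
  have hpar : CylMapOn W Λ.param := Λ.cylMapOn_param.mono inter_subset_left
  have hmaps : MapsTo Λ.param W NX := fun z hz => hz.2
  have hmem : ∀ z ∈ W, Λ.param z ∈ NX ∩ S.prolonged := fun z hz =>
    ⟨hz.2, Λ.param_mem_prolonged hz.1⟩
  let Y : ℕ → Chart n → ℝ := fun k z => Ψ (Λ.param z) k 0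
  have hY : ∀ k, CylAnOn W (Y k) := fun k =>
    (jetAnalyticOn_iff.1 (hΨ k 0)).comp_map hpar hmaps
  have hYa : ∀ k, CylAt z₀ (Y k) := fun k => ⟨W, hW, hz, hY k⟩
  have hrel : RelatedOn W Λ.field Λ.param := relatedOn_prolong _ _ _
  have hYs : ∀ k, germD z₀ Λ.field (germ z₀ (Y k)) = germ z₀ (Y (k + 1)) := by
    intro k
    rw [germD_germ (hYa k)]
    refine germ_congr (eventually_of_mem (hW.mem_nhds hz) fun z hz => ?_)
    refine (hrel.lieD_comp hW hpar hNX hmaps (jetAnalyticOn_iff.1 (hΨ k 0)) hz).trans ?_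
    exact hΨr _ (hmem z hz) k 0
  have hYD : ∀ k, (Λ.controlModule hz₀).D^[k] (dGerm (germ z₀ (Y 0))) = dGerm (germ z₀ (Y k)) := by
    intro k
    induction k with
    | zero => rfl
    | succ k ih =>
      rw [Function.iterate_succ_apply', ih]
      exact (Λ.lieForm_dGerm hz₀ _).trans (by rw [hYs])
  refine ⟨Y 0, hYa 0, fun i => ?_⟩
  -- Since `Φ ∘ Ψ` is the identity on `𝔛₀`, `xᵢ = g(y, …, y⁽ʳ⁻¹⁾)`. The differential of this
  -- relation expresses `dxᵢ` through `dy⁽ᵏ⁾ = D^k dy` with `k < r`.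
  obtain ⟨r, g, hg, e⟩ := hΦ 0 i
  let T : Chart n → Fin r → Fin 1 → ℝ := fun z => trunc r (Ψ (Λ.param z))
  have hΨN : ∀ z ∈ W, Ψ (Λ.param z) ∈ NY := fun z hz => (hΨm (hmem z hz)).1
  have hT1 : ∀ z (k : Fin r) (l : Fin 1), T z k l = Y k z := fun z k l => by
    rw [Subsingleton.elim l 0]; rfl
  have hT : CylAnOn W T := CylAnOn.pi fun k => CylAnOn.pi fun l =>
    (hY k).congr fun z _ => hT1 z k l
  have hTm : MapsTo T W (trunc r '' NY) := fun z hz => ⟨_, hΨN z hz, rfl⟩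
  let ev : Fin r → Fin r → Fin 1 → ℝ := fun k => Pi.single k fun _ => 1
  have hcoef : ∀ k, CylAt z₀ fun z => fderiv ℝ g (T z) (ev k) := fun k =>
    ⟨W, hW, hz, (hT.comp hg.fderiv hTm).clm_comp (ContinuousLinearMap.apply ℝ ℝ (ev k))⟩
  have hx : ∀ z ∈ W, z.1 i = g (T z) := by
    intro z hz
    rw [← e _ (hΨN z hz)]
    beta_reduce
    rw [hinv (hmem z hz)]
    rfl
  have hE : (Λ.controlModule hz₀).e i = ∑ k : Fin r, germ z₀ (fun z => fderiv ℝ g (T z) (ev k)) •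
      (Λ.controlModule hz₀).D^[k] (dGerm (germ z₀ (Y 0))) := by
    simp only [hYD]
    change dGerm (germ z₀ fun z : Chart n => z.1 i) = _
    refine Subtype.ext (funext fun v => ?_)
    simp only [Submodule.coe_sum, Finset.sum_apply, Submodule.coe_smul, Pi.smul_apply, smul_eq_mul,
      dGerm_germ (hYa _), dGerm_germ (cylAt_state z₀ i)]
    simp only [← germ_mul (hcoef _) ((hYa _).lineDeriv v)]
    rw [← germ_sum _ fun k _ => (hcoef k).mul ((hYa k).lineDeriv v)]
    refine germ_congr (eventually_of_mem (hW.mem_nhds hz) fun z hz => ?_)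
    have hTd : HasDerivAt (fun t : ℝ => T (z + t • v))
        (fun (k : Fin r) (_ : Fin 1) => lineDeriv ℝ (Y k) z v) 0 := by
      refine hasDerivAt_pi.2 fun k => hasDerivAt_pi.2 fun l => ?_
      simp only [hT1]
      exact (hY k).hasLineDerivAt hW hz v
    have hgT : HasFDerivAt g (fderiv ℝ g (T z)) (T (z + (0 : ℝ) • v)) := by
      rw [zero_smul, add_zero]
      exact (hg _ (hTm hz)).differentiableAt.hasFDerivAt
    have h1 : HasLineDerivAt ℝ (fun z => g (T z)) _ z v := hgT.comp_hasDerivAt (0 : ℝ) hTd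
    beta_reduce
    rw [lineDeriv_congr_nhds (eventually_of_mem (hW.mem_nhds hz) hx), h1.lineDeriv]
    have h2 : (fun (k : Fin r) (_ : Fin 1) => lineDeriv ℝ (Y k) z v) =
        ∑ k : Fin r, lineDeriv ℝ (Y k) z v • ev k := by
      funext k l
      simp [ev, Finset.sum_apply, Pi.single_apply, ite_apply]
    rw [h2, map_sum]
    refine Finset.sum_congr rfl fun k _ => ?_
    rw [map_smul, smul_eq_mul, mul_comm]
  refine ⟨r, ?_⟩
  rw [hE]
  exact Submodule.sum_mem _ fun k _ =>
    Submodule.smul_mem _ _ (ControlModule.iterate_mem_filt k.2)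

include hz₀ in
/-- A 1-form that is proportional to the differential of a function is closed. -/
theorem ordinaryClosedAt_of_eq_smul_dGerm {θ : OneForm n} (hθ : ∀ j, (θ j).AnalyticAt (Λ.param z₀)) {y : Chart n → ℝ} (hy : CylAt z₀ y)
    {c : cylRing z₀} (hc : IsUnit c) (heq : Λ.pull hz₀ θ = c • dGerm (germ z₀ y)) :
    S.OrdinaryClosedAt (Λ.param z₀) θ := by
  obtain ⟨h, hh, rfl⟩ := exists_germ_eq c
  obtain ⟨Wy, hWy, hzy, hWya⟩ := id hy
  have hd := Λ.isOpen_dom.mem_nhds hz₀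
  let W := Λ.dom ∩ Wy
  have hW : IsOpen W := Λ.isOpen_dom.inter hWy
  have hfam : IsFormFamily W fun z v => θ.eval (Λ.param z) (jetDeriv Λ.param z v) +
      -h z * lineDeriv ℝ y z v := by
    refine IsFormFamily.add ?_
      ((isFormFamily_lineDeriv hW (hWya.mono inter_subset_right)).mul _)
    refine IsFormFamily.sum _ fun j _ => IsFormFamily.sum _ fun k _ => ?_
    exact (isFormFamily_lineDeriv hW
      ((Λ.cylMapOn_param.apply k j).mono inter_subset_left)).mul fun z => θ j k (Λ.param z)
  have hev : ∀ v, ∀ᶠ z in 𝓝 z₀, θ.eval (Λ.param z) (jetDeriv Λ.param z v) +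
      -h z * lineDeriv ℝ y z v = 0 := by
    intro v
    have h1 := congrArg (fun α : formModule z₀ => α.1 v) heq
    simp only [Submodule.coe_smul, Pi.smul_apply, smul_eq_mul] at h1
    rw [Λ.pull_apply hz₀ hθ, dGerm_germ hy, ← germ_mul hh (hy.lineDeriv v),
      germ_eq_iff (Λ.cylAt_eval hz₀ hθ v) (hh.mul (hy.lineDeriv v))] at h1
    filter_upwards [h1] with z hz
    rw [hz]
    ring
  have hev' := hfam.eventually_eq_zero (hW.mem_nhds ⟨hz₀, hzy⟩) hev
  have hev2 : ∀ᶠ z in 𝓝 z₀, ∀ v, θ.eval (Λ.param z) (jetDeriv Λ.param z v) =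
      h z * lineDeriv ℝ y z v := by
    filter_upwards [hev'] with z hz v
    linarith [hz v]
  -- `d(h dy) = dh ∧ dy`, by the symmetry of the second derivatives of `y`.
  have hext : ∀ᶠ z in 𝓝 z₀, ∀ v w,
      θ.extDeriv (Λ.param z) (jetDeriv Λ.param z v) (jetDeriv Λ.param z w) =
      lineDeriv ℝ h z v * lineDeriv ℝ y z w - lineDeriv ℝ h z w * lineDeriv ℝ y z v := by
    filter_upwards [Λ.eventually_extDeriv hz₀ hθ, hev2.eventually_nhds,
      hh.eventually_hasLineDerivAt, hWy.mem_nhds hzy] with z h1 h2 h3 h4 v w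
    have h5 : ∀ v w, lineDeriv ℝ (fun z => θ.eval (Λ.param z) (jetDeriv Λ.param z w)) z v =
        lineDeriv ℝ h z v * lineDeriv ℝ y z w +
          h z * lineDeriv ℝ (fun z => lineDeriv ℝ y z w) z v := by
      intro v w
      rw [lineDeriv_congr_nhds (h2.mono fun z hz => hz w)]
      have h6 := (hWya.lineDeriv_const hWy w).hasLineDerivAt hWy h4 v
      have h7 : HasLineDerivAt ℝ (fun z => h z * lineDeriv ℝ y z w)
          (lineDeriv ℝ h z v * lineDeriv ℝ y z w +
            h z * lineDeriv ℝ (fun z => lineDeriv ℝ y z w) z v) z v := by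
        refine HasDerivAt.congr_deriv (HasDerivAt.mul (h3 v) h6) ?_
        simp [lieD]
      exact h7.lineDeriv
    have h8 : lineDeriv ℝ (fun z => lineDeriv ℝ y z w) z v =
        lineDeriv ℝ (fun z => lineDeriv ℝ y z v) z w := by
      have h9 : HasCylDeriv (fun _ : Chart n => w) (0 : Chart n) z v := fun F _ _ L => by
        rw [map_zero]
        exact hasDerivAt_const (0 : ℝ) (L w)
      have h10 := hWya.lineDeriv_comm hWy h4 h9
      rw [lineDeriv_zero, add_zero] at h10
      exact h10
    rw [h1, h5, h5, h8]
    ring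
  have h0 : h z₀ ≠ 0 := (isUnit_germ_iff hh).1 hc
  obtain ⟨Wh, hWh, hzh, hWha⟩ := id hh
  obtain ⟨V, hV, hVo, hzV⟩ := eventually_nhds_iff.1 ((hext.and hev2).and
    ((hh.continuousAt.eventually_ne h0).and (hWh.mem_nhds hzh)))
  let N : Set (Jet n) := ImplicitSystem.jetsOver Λ.O₂ ∩ Λ.coord ⁻¹' V
  have hN : IsOpen N :=
    (ImplicitSystem.isOpen_jetsOver Λ.isOpen_O₂).inter (hVo.preimage Λ.coord.continuous)
  -- `τ = dh / h`, so that `dh ∧ dy = τ ∧ (h dy)`. The composition with `coord` extends `h` to an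
  -- open set of jets, as a form on the jet space is required.
  obtain ⟨τ, hτ, hτe⟩ := exists_logDeriv_form hN (h := fun x => h (Λ.coord x))
    (hWha.comp_map (CylMapOn.of_clm N Λ.coord) fun x hx => (hV _ hx.2).2.2)
    fun x hx => (hV _ hx.2).2.1
  refine ⟨N, hN, ⟨Λ.param_mem_jetsOver hz₀, ?_⟩, τ, hτ, ?_⟩
  · rw [mem_preimage, Λ.coord_param hz₀]
    exact hzV
  rintro x ⟨hxN, hxS⟩ v w hv hw
  obtain ⟨⟨h1, h2⟩, h3, -⟩ := hV _ hxN.2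
  have hz := Λ.coord_mem_dom hxS hxN.1
  have hpx := Λ.param_coord hxS hxN.1
  set z := Λ.coord x with hzd
  have hl : ∀ v, τ.eval x v = (h z)⁻¹ * lineDeriv ℝ h z (Λ.coord v) := by
    intro v
    rw [hτe x hxN]
    congr 1
    simp only [lineDeriv, map_add, map_smul]
    rfl
  have hv' : v = jetDeriv Λ.param z (Λ.coord v) := Λ.eq_jetDeriv_of_isTangent hz (by rwa [hpx])
  have hw' : w = jetDeriv Λ.param z (Λ.coord w) := Λ.eq_jetDeriv_of_isTangent hz (by rwa [hpx])
  have e1 : ∀ u, u = jetDeriv Λ.param z (Λ.coord u) →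
      θ.eval x u = h z * lineDeriv ℝ y z (Λ.coord u) := by
    intro u hu
    conv_lhs => rw [hu, ← hpx]
    exact h2 _
  rw [OneForm.wedge, hl, hl, e1 v hv', e1 w hw']
  conv_lhs => rw [hv', hw', ← hpx]
  rw [h1]
  field_simp

end LocalForm

theorem ordinaryClosedAt_of_flatAt {n : ℕ} {S : ImplicitSystem n 1} {x₀ : Jet n}
    (hx₀ : x₀ ∈ S.prolonged) {U Q : OpMatrix n n n} (hUQ : S.IsSmithPairAt x₀ U Q) {y₀ : Jet 1}
    (h : S.FlatAt x₀ y₀) : S.OrdinaryClosedAt x₀ (S.omega Q 0) := by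
  obtain ⟨Λ⟩ := exists_localForm S hx₀.1 (funext fun i => hx₀.2 0 i)
  have hO₂ : x₀ ∈ ImplicitSystem.jetsOver Λ.O₂ := Λ.mem_O₂
  have hz₀ := Λ.coord_mem_dom hx₀ hO₂
  have hp := Λ.param_coord hx₀ hO₂
  rw [← hp] at hUQ h ⊢
  obtain ⟨hg, ha⟩ := Λ.generates_pull_omega hz₀ hUQ
  obtain ⟨y, hy, hgy⟩ := Λ.exists_generates_of_flatAt hz₀ h
  obtain ⟨c, hc, hcy⟩ := hgy.exists_eq_unit_smul S.le hg
  exact Λ.ordinaryClosedAt_of_eq_smul_dGerm hz₀ ha hy hc hcy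

end Flatness

end

/-! ### The three equivalences -/

theorem mainTheorem7 {n : ℕ} (S : Flatness.ImplicitSystem n 1) (x₀ : Flatness.Jet n)
    (hx₀ : x₀ ∈ S.prolonged) (hP : S.HyperRegularAt x₀ S.P) :
    ((∃ y₀ : Flatness.Jet 1, S.FlatAt x₀ y₀) ↔
      ∃ U Q : Flatness.OpMatrix n n n,
        S.IsSmithPairAt x₀ U Q ∧ S.OrdinaryClosedAt x₀ (S.omega Q 0)) ∧
    (∀ U Q : Flatness.OpMatrix n n n, S.IsSmithPairAt x₀ U Q →
      ((∃ y₀ : Flatness.Jet 1, S.FlatAt x₀ y₀) ↔ S.OrdinaryClosedAt x₀ (S.omega Q 0))) ∧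
    ((∃ y₀ : Flatness.Jet 1, S.FlatAt x₀ y₀) ↔ S.StaticFeedbackLinearizableAt x₀) := by
  have closed_of_flat : ∀ U Q, S.IsSmithPairAt x₀ U Q →
      (∃ y₀ : Flatness.Jet 1, S.FlatAt x₀ y₀) → S.OrdinaryClosedAt x₀ (S.omega Q 0) :=
    fun U Q h ⟨_, hy⟩ => Flatness.ordinaryClosedAt_of_flatAt hx₀ h hy
  have linear_of_closed : ∀ U Q, S.IsSmithPairAt x₀ U Q →
      S.OrdinaryClosedAt x₀ (S.omega Q 0) → S.StaticFeedbackLinearizableAt x₀ :=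
    fun U Q h => Flatness.staticFeedbackLinearizableAt_of_closed hx₀ h
  have flat_of_linear : S.StaticFeedbackLinearizableAt x₀ →
      ∃ y₀ : Flatness.Jet 1, S.FlatAt x₀ y₀ :=
    Flatness.exists_flatAt_of_staticFeedbackLinearizableAt hx₀
  -- Hyper-regularity enters here, through the existence of a Smith pair on which flatness can be
  -- tested.
  obtain ⟨U, Q, hUQ⟩ := S.exists_isSmithPairAt hP
  refine ⟨⟨fun h => ⟨U, Q, hUQ, closed_of_flat U Q hUQ h⟩, ?_⟩, fun U Q h =>
    ⟨closed_of_flat U Q h, fun hc => flat_of_linear (linear_of_closed U Q h hc)⟩,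
    fun h => linear_of_closed U Q hUQ (closed_of_flat U Q hUQ h), flat_of_linear⟩
  rintro ⟨U, Q, h, hc⟩
  exact flat_of_linear (linear_of_closed U Q h hc)
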